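/- **Theorem (Generalized point-set embeddability of plane 3-trees).** The Generalized Point-Set Embeddability problem for plane 3-trees can be solved in $O(n\cdot k^4)$ time. In detail: A *plane 3-tree* is a triangulated plane graph (a plane simple graph with at least three vertices in which every face, including the outer one, is bounded by a triangle) that either has exactly three vertices or has a vertex $x$ such that the plane graph induced by $V\setminus\{x\}$ is again a plane 3-tree. Let $G$ be a plane 3-tree with $n$ vertices, given by the rotational order of the neighbours around each vertex together with its outer facial triangle, and let $S$ be a set of $k>n$ distinct points in $\mathbb{R}^2$ (three or more of them may be collinear), given by their coordinates. A *point-set embedding* of $G$ on $S$ is an injective map from the vertices of $G$ to $S$ such that drawing the edges as straight line segments gives a drawing in which no vertex lies on an edge it is not an end of, two distinct edges meet only at common end vertices, and the faces are those of $G$, the outer face being that of $G$ (a drawing and its mirror image are both allowed). There are a program for the unit-cost real RAM (random access to memory; addition, subtraction, comparison of integers; addition, subtraction, multiplication, comparison of real numbers; one step per operation) and a constant $C$ such that for all $n$, $k$, $G$ and $S$ as above the program halts after at most $C\,n\,k^4$ steps and outputs a point-set embedding of $G$ on $S$ if there is one, and otherwise reports that there is none. In particular it decides in $O(nk^4)$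 time whether $G$ can be embedded on some $n$ of the points of $S$. -/

import Mathlib

/-! ## Plane graphs, triangulations and plane 3-trees -/

/-- A simple graph with, at every vertex `v`, a permutation `rot v` sending each neighbour of `v`
to the next neighbour of `v` in the rotational order around `v`.  (The values of `rot v` at
non-neighbours of `v` carry no information.) -/
structure RotationSystem (V : Type) where
  graph : SimpleGraph V
  rot : V → Equiv.Perm V

namespace RotationSystem

variable {V : Type}

/-- The face-tracing rule: after the directed edge `u → v` comes `v → rot v u`. -/
def FaceStep (G : RotationSystem V) (d e : G.graph.Dart) : Prop :=
  e.fst = d.snd ∧ e.snd = G.rot d.snd d.fst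

/-- The faces: classes of directed edges under face tracing. -/
def Face (G : RotationSystem V) : Type := Quot G.FaceStep

/-- Connected plane graphs with at least one edge, described combinatorially: the neighbours of
each vertex are arranged in one cycle, and the number of faces is the one that Euler's formula
prescribes for the sphere. -/
structure IsPlane (G : RotationSystem V) : Prop where
  isCycleOn : ∀ v, (G.rot v).IsCycleOn (G.graph.neighborSet v)
  connected : G.graph.Connected
  euler : Nat.card V + Nat.card G.Face = Nat.card G.graph.edgeSet + 2

/-- `u → v → w → u` is the full boundary walk of a face. -/
def IsFacialTriangle (G : RotationSystem V) (u v w : V) : Prop :=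
  G.graph.Adj u v ∧ G.rot v u = w ∧ G.rot w v = u ∧ G.rot u w = v

/-- A triangulated plane graph: a plane graph on at least three vertices all of whose faces
(including the outer one) are triangles. -/
structure IsTriangulated (G : RotationSystem V) : Prop where
  isPlane : G.IsPlane
  three_le : 3 ≤ Nat.card V
  face : ∀ u v, G.graph.Adj u v → G.IsFacialTriangle u v (G.rot v u)

open Classical in
/-- The plane graph induced by `V - {x}`: in each rotation `x` is skipped. -/
noncomputable def delete (G : RotationSystem V) (x : V) : RotationSystem {v : V // v ≠ x} where
  graph := G.graph.comap Subtype.val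
  rot v := (Equiv.swap x (G.rot v x) * G.rot v).subtypePerm (by
    intro w
    have hx : (Equiv.swap x (G.rot v x) * G.rot v) x = x := by simp
    exact not_congr ⟨fun h => (Equiv.injective _) (h.trans hx.symm), fun h => h ▸ hx⟩)

end RotationSystem

/-- A plane 3-tree: a triangulated plane graph that has three vertices, or has a vertex `x` whose
deletion leaves a plane 3-tree. -/
inductive IsPlane3Tree : {V : Type} → RotationSystem V → Prop
  | triangle {V : Type} (G : RotationSystem V) :
      G.IsTriangulated → Nat.card V = 3 → IsPlane3Tree G
  | step {V : Type} (G : RotationSystem V) (x : V) :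
      G.IsTriangulated → IsPlane3Tree (G.delete x) → IsPlane3Tree G

/-! ## Straight-line drawings -/

/-- The subset of the plane covered by the drawing of `G` with vertex `v` drawn at `pos v` and
edges drawn as line segments. -/
def drawingSet {V : Type} (G : SimpleGraph V) (pos : V → ℝ × ℝ) : Set (ℝ × ℝ) :=
  Set.range pos ∪ {q | ∃ u v, G.Adj u v ∧ q ∈ segment ℝ (pos u) (pos v)}

/-- Vertices are distinct points, no vertex lies on an edge that is not incident with it, and two
distinct edges meet at most in common end vertices. -/
structure IsCrossingFree {V : Type} (G : SimpleGraph V) (pos : V → ℝ × ℝ) : Prop where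
  injective : Function.Injective pos
  vertex_edge : ∀ u v w, G.Adj u v → w ≠ u → w ≠ v → pos w ∉ segment ℝ (pos u) (pos v)
  edge_edge : ∀ u v x y, G.Adj u v → G.Adj x y → s(u, v) ≠ s(x, y) →
    ∀ q, q ∈ segment ℝ (pos u) (pos v) → q ∈ segment ℝ (pos x) (pos y) →
      ∃ w, w ∈ s(u, v) ∧ w ∈ s(x, y) ∧ q = pos w

/-- `pos` is a straight-line drawing of the triangulated plane graph `G` with outer face
`a → b → c → a`: it is crossing-free and has the same faces as `G`, that is, the outer face of the
drawing is the outside of the triangle `a b c`, and every other face of `G` is drawn as an open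
triangle that the drawing does not enter.  A drawing and its mirror image both qualify. -/
structure IsStraightLineDrawing {V : Type} (G : RotationSystem V) (a b c : V)
    (pos : V → ℝ × ℝ) : Prop where
  crossingFree : IsCrossingFree G.graph pos
  outer : drawingSet G.graph pos ⊆ convexHull ℝ {pos a, pos b, pos c}
  inner : ∀ u v w, G.IsFacialTriangle u v w →
    (u, v) ≠ (a, b) → (u, v) ≠ (b, c) → (u, v) ≠ (c, a) →
      Disjoint (interior (convexHull ℝ {pos u, pos v, pos w})) (drawingSet G.graph pos)

/-! ## A unit-cost real RAM -/

/-- A configuration: word registers, real registers, word memory and real memory. -/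
structure RAMState where
  I : ℕ → ℕ
  R : ℕ → ℝ
  M : ℕ → ℕ
  X : ℕ → ℝ

/-- Basic instructions.  `d`, `a`, `b`, `s` are register names.  Memory is accessed at the address
held in a word register. -/
inductive RAMInstr where
  | const (d c : ℕ)
  | add (d a b : ℕ)
  | sub (d a b : ℕ)
  | load (d a : ℕ)
  | store (a s : ℕ)
  | radd (d a b : ℕ)
  | rsub (d a b : ℕ)
  | rmul (d a b : ℕ)
  | rload (d a : ℕ)
  | rstore (a s : ℕ)

/-- The effect of one instruction (`sub` is truncated at zero). -/
noncomputable def RAMInstr.exec : RAMInstr → RAMState → RAMState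
  | .const d c, σ => { σ with I := Function.update σ.I d c }
  | .add d a b, σ => { σ with I := Function.update σ.I d (σ.I a + σ.I b) }
  | .sub d a b, σ => { σ with I := Function.update σ.I d (σ.I a - σ.I b) }
  | .load d a, σ => { σ with I := Function.update σ.I d (σ.M (σ.I a)) }
  | .store a s, σ => { σ with M := Function.update σ.M (σ.I a) (σ.I s) }
  | .radd d a b, σ => { σ with R := Function.update σ.R d (σ.R a + σ.R b) }
  | .rsub d a b, σ => { σ with R := Function.update σ.R d (σ.R a - σ.R b) }
  | .rmul d a b, σ => { σ with R := Function.update σ.R d (σ.R a * σ.R b) }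
  | .rload d a, σ => { σ with R := Function.update σ.R d (σ.X (σ.I a)) }
  | .rstore a s, σ => { σ with X := Function.update σ.X (σ.I a) (σ.R s) }

/-- Branching conditions: comparisons of two registers. -/
inductive RAMTest where
  | lt (a b : ℕ)
  | eq (a b : ℕ)
  | rlt (a b : ℕ)

/-- The truth of a branching condition. -/
def RAMTest.Holds : RAMTest → RAMState → Prop
  | .lt a b, σ => σ.I a < σ.I b
  | .eq a b, σ => σ.I a = σ.I b
  | .rlt a b, σ => σ.R a < σ.R b

/-- Programs. -/
inductive RAMProg where
  | instr (i : RAMInstr)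
  | seq (P Q : RAMProg)
  | ite (b : RAMTest) (P Q : RAMProg)
  | while (b : RAMTest) (P : RAMProg)

/-- `RAMRun P σ τ t`: started in `σ`, the program `P` halts in `τ` after exactly `t` steps, where
every executed instruction and every evaluated branching condition is one step. -/
inductive RAMRun : RAMProg → RAMState → RAMState → ℕ → Prop
  | instr (i : RAMInstr) (σ : RAMState) : RAMRun (.instr i) σ (i.exec σ) 1
  | seq {P Q : RAMProg} {σ τ υ : RAMState} {t₁ t₂ : ℕ} :
      RAMRun P σ τ t₁ → RAMRun Q τ υ t₂ → RAMRun (.seq P Q) σ υ (t₁ + t₂)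
  | ite_true {b : RAMTest} {P Q : RAMProg} {σ τ : RAMState} {t : ℕ} :
      b.Holds σ → RAMRun P σ τ t → RAMRun (.ite b P Q) σ τ (1 + t)
  | ite_false {b : RAMTest} {P Q : RAMProg} {σ τ : RAMState} {t : ℕ} :
      ¬ b.Holds σ → RAMRun Q σ τ t → RAMRun (.ite b P Q) σ τ (1 + t)
  | while_true {b : RAMTest} {P : RAMProg} {σ τ υ : RAMState} {t₁ t₂ : ℕ} :
      b.Holds σ → RAMRun P σ τ t₁ → RAMRun (.while b P) τ υ t₂ →
        RAMRun (.while b P) σ υ (1 + t₁ + t₂)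
  | while_false {b : RAMTest} {P : RAMProg} {σ : RAMState} :
      ¬ b.Holds σ → RAMRun (.while b P) σ σ 1

/-! ## Input and output -/

open Classical in
/-- The initial configuration.  Registers: `n`, `k` and the outer vertices `a`, `b`, `c`.  Word
memory: the table with `rot u v + 1` in cell `u * n + v` if `v` is a neighbour of `u`, and `0` if it
is not.  Real memory: the coordinates of the points, in cells `2 * i` and `2 * i + 1`.  Everything
else is `0`. -/
noncomputable def inputState {n k : ℕ} (G : RotationSystem (Fin n)) (a b c : Fin n)
    (S : Fin k → ℝ × ℝ) : RAMState where
  I r := match r with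
    | 0 => n
    | 1 => k
    | 2 => a
    | 3 => b
    | 4 => c
    | _ => 0
  R _ := 0
  M m :=
    if h : m / n < n ∧ m % n < n then
      if G.graph.Adj ⟨m / n, h.1⟩ ⟨m % n, h.2⟩ then
        (G.rot ⟨m / n, h.1⟩ ⟨m % n, h.2⟩ : ℕ) + 1
      else 0
    else 0
  X m :=
    if h : m / 2 < k then
      if m % 2 = 0 then (S ⟨m / 2, h⟩).1 else (S ⟨m / 2, h⟩).2
    else 0

/-- `f` maps the vertices of `G` to (indices of) points of `S` so that a straight-line drawing of
`G` results. -/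
def IsPointSetEmbedding {n k : ℕ} (G : RotationSystem (Fin n)) (a b c : Fin n)
    (S : Fin k → ℝ × ℝ) (f : Fin n → Fin k) : Prop :=
  IsStraightLineDrawing G a b c (fun v => S (f v))

/-- The final configuration `τ` answers the instance correctly: register `0` holds `1` and the
first `n` cells of word memory hold a point-set embedding, or register `0` holds `0` and there is
no point-set embedding. -/
def IsCorrectAnswer {n k : ℕ} (G : RotationSystem (Fin n)) (a b c : Fin n)
    (S : Fin k → ℝ × ℝ) (τ : RAMState) : Prop :=
  (τ.I 0 = 1 ∧ ∃ f : Fin n → Fin k,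
      IsPointSetEmbedding G a b c S f ∧ ∀ v : Fin n, τ.M (v : ℕ) = (f v : ℕ)) ∨
  (τ.I 0 = 0 ∧ ¬ ∃ f : Fin n → Fin k, IsPointSetEmbedding G a b c S f)

/-! ## Stacked triangulations -/

/-! A plane 3-tree grows from a triangle by repeatedly inserting a vertex into a face. If deleting
`x` from a triangulation leaves a triangulation, then `x` has degree three and sits in one face of
what is left (`RotationSystem.IsTriangulated.exists_eq_subdivide`). So the oriented faces form a
`StackedSphere`. Any face of it may serve as the outer one (`StackedSphere.stackedDisc`), and any
inner vertex of degree three may be treated as the one inserted last (`StackedDisc.exists_remove`).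

The geometry then reduces to signs: a placement of the vertices is a correct drawing exactly when
the signed areas of all inner faces have the same strict sign (`isStraightLineDrawing_iff`). If the
signs agree, every inserted vertex lies in the open triangle of its face, and induction along the
insertions keeps the drawing free of crossings and its faces empty and disjoint
(`StackedDisc.isOrientedDrawing`). Conversely, mixed signs at a vertex of degree three would force
two edges to cross or a vertex to lie inside a face (`IsEmptyFaceDrawing.exists_mem_openTriangle`).
Hence the vertex lies inside the triangle of its neighbours and can be removed without spoiling the
drawing.

Once a triangle and the vertex inside it are placed, the three parts are independent, which gives a
dynamic program. A flag for each triple of vertices and triple of points says whether everything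
removed so far inside that triangle can be placed there, `0` meaning yes. A round removes an inner
vertex `x` of degree three: for each of the `k ^ 3` places of its neighbours it tries all `k` points
for `x`, asking that the point be strictly inside and that the flags of the three parts be `0`. The
invariant `IsReduction` says that every drawing of the whole graph is admissible for the current
tables (completeness), and that every admissible placement of the remaining vertices extends to a
drawing through the recorded positions (soundness); `IsReduction.step` preserves both. After `n - 3`
rounds a single triangle is left. A search over its places decides the instance, and the recorded
positions are traced back.

On the machine, cells are addressed by a tag followed by six digits in base `k`. Tags are positive,
so the tables avoid the adjacency matrix and start out as `0`, the right flag for an empty face.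
Words can only be added and subtracted, so an address costs `O(k)` steps; but the point tried for
`x` is the last digit, so it is just added to base addresses computed once per place. A candidate
therefore costs constant time and a round `O(k ^ 4)` (`removeVertexTime_le`). -/

section Stacked

variable {V W : Type}

/-- `(p, q, r)` is a rotation of `(u, v, w)`. -/
def IsRotationOf (u v w p q r : V) : Prop :=
  (p = u ∧ q = v ∧ r = w) ∨ (p = v ∧ q = w ∧ r = u) ∨ (p = w ∧ q = u ∧ r = v)

/-- The oriented faces after the face `(u, v, w)` has been split by a new vertex `x`. -/
def subdivide (F : V → V → V → Prop) (u v w x p q r : V) : Prop :=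
  (F p q r ∧ ¬ IsRotationOf u v w p q r) ∨ IsRotationOf u v x p q r ∨ IsRotationOf v w x p q r ∨
    IsRotationOf w u x p q r

/-- Vertex sets and oriented faces that result from `A₀`, `F₀` by inserting vertices into faces. -/
inductive Stacked (A₀ : Set V) (F₀ : V → V → V → Prop) : Set V → (V → V → V → Prop) → Prop
  | base : Stacked A₀ F₀ A₀ F₀
  | step {A : Set V} {F : V → V → V → Prop} (x u v w : V) :
      Stacked A₀ F₀ A F → x ∉ A → F u v w → Stacked A₀ F₀ (insert x A) (subdivide F u v w x)

/-- Stacked triangulations of the disc with boundary `a`, `b`, `c`: the outer face `(a, b, c)`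
is not a face. -/
def StackedDisc (a b c : V) : Set V → (V → V → V → Prop) → Prop :=
  Stacked {a, b, c} (IsRotationOf b a c)

/-- Two vertices are adjacent if they lie on a common face. -/
def FaceAdj (F : V → V → V → Prop) (p q : V) : Prop := ∃ r, F p q r ∨ F q p r

theorem FaceAdj.symm {F : V → V → V → Prop} {p q : V} (h : FaceAdj F p q) : FaceAdj F q p := by
  obtain ⟨r, h⟩ := h; exact ⟨r, h.symm⟩

theorem IsRotationOf.refl (u v w : V) : IsRotationOf u v w u v w := Or.inl ⟨rfl, rfl, rfl⟩

theorem IsRotationOf.rotate_iff (u v w : V) : IsRotationOf v w u = IsRotationOf u v w := by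
  funext p q r
  simp only [IsRotationOf, eq_iff_iff]
  constructor <;> rintro (h | h | h) <;> simp [h]

theorem IsRotationOf.rotate {u v w p q r : V} (h : IsRotationOf u v w p q r) :
    IsRotationOf u v w q r p := by
  rcases h with ⟨rfl, rfl, rfl⟩ | ⟨rfl, rfl, rfl⟩ | ⟨rfl, rfl, rfl⟩ <;> simp [IsRotationOf]

theorem IsRotationOf.eq {u v w p q r : V} (h : IsRotationOf u v w p q r) :
    IsRotationOf p q r = IsRotationOf u v w := by
  rcases h with ⟨rfl, rfl, rfl⟩ | ⟨rfl, rfl, rfl⟩ | ⟨rfl, rfl, rfl⟩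
  · rfl
  · rw [rotate_iff]
  · rw [rotate_iff, rotate_iff]

theorem IsRotationOf.symm {u v w p q r : V} (h : IsRotationOf u v w p q r) :
    IsRotationOf p q r u v w := by
  rw [h.eq]; exact .refl u v w

theorem IsRotationOf.mem {u v w p q r : V} (h : IsRotationOf u v w p q r) :
    w = p ∨ w = q ∨ w = r := by
  rcases h with ⟨rfl, rfl, rfl⟩ | ⟨rfl, rfl, rfl⟩ | ⟨rfl, rfl, rfl⟩ <;> simp

/-- A triple determines its rotations once the vertex that follows a given one is known. -/
theorem IsRotationOf.not_consecutive {p q x u v w y : V} (hpq : p ≠ q) (hpx : x ≠ p)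
    (hqx : x ≠ q) (h : IsRotationOf p q x u v w) (h' : IsRotationOf q y x u v w) : False := by
  unfold IsRotationOf at h h'
  rcases h with ⟨rfl, rfl, rfl⟩ | ⟨rfl, rfl, rfl⟩ | ⟨rfl, rfl, rfl⟩ <;>
    rcases h' with ⟨e1, e2, e3⟩ | ⟨e1, e2, e3⟩ | ⟨e1, e2, e3⟩ <;> grind

theorem subdivide_rotate (F : V → V → V → Prop) (u v w x : V) :
    subdivide F v w u x = subdivide F u v w x := by
  funext p q r
  simp only [subdivide, IsRotationOf.rotate_iff u v w, eq_iff_iff]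
  rw [or_comm (a := IsRotationOf u v x p q r), or_assoc, or_comm (b := IsRotationOf u v x p q r)]

/-- What is preserved by inserting vertices: faces have three distinct vertices in the vertex set
and are closed under rotation. -/
structure IsFaceSystem (A : Set V) (F : V → V → V → Prop) : Prop where
  mem : ∀ p q r, F p q r → p ∈ A
  ne : ∀ p q r, F p q r → p ≠ q
  rotate : ∀ p q r, F p q r → F q r p

namespace IsFaceSystem

variable {A : Set V} {F : V → V → V → Prop}

theorem mem₂ (h : IsFaceSystem A F) {p q r : V} (hf : F p q r) : q ∈ A :=
  h.mem _ _ _ (h.rotate _ _ _ hf)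

theorem mem₃ (h : IsFaceSystem A F) {p q r : V} (hf : F p q r) : r ∈ A :=
  h.mem₂ (h.rotate _ _ _ hf)

theorem ne₂ (h : IsFaceSystem A F) {p q r : V} (hf : F p q r) : q ≠ r :=
  h.ne _ _ _ (h.rotate _ _ _ hf)

theorem ne₃ (h : IsFaceSystem A F) {p q r : V} (hf : F p q r) : r ≠ p :=
  h.ne₂ (h.rotate _ _ _ hf)

theorem subdivide (h : IsFaceSystem A F) {u v w x : V} (hx : x ∉ A) (hf : F u v w) :
    IsFaceSystem (insert x A) (subdivide F u v w x) := by
  have h1 := h.mem _ _ _ hf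
  have h2 := h.mem₂ hf
  have h3 := h.mem₃ hf
  have n1 := h.ne _ _ _ hf
  have n2 := h.ne₂ hf
  have n3 := h.ne₃ hf
  have x1 : x ≠ u := fun e => hx (e ▸ h1)
  have x2 : x ≠ v := fun e => hx (e ▸ h2)
  have x3 : x ≠ w := fun e => hx (e ▸ h3)
  constructor
  · intro p q r hp
    rcases hp with hp | hp | hp | hp
    · exact Or.inr (h.mem _ _ _ hp.1)
    all_goals rcases hp with ⟨rfl, -⟩ | ⟨rfl, -⟩ | ⟨rfl, -⟩ <;> simp [*]
  · intro p q r hp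
    rcases hp with hp | hp | hp | hp
    · exact h.ne _ _ _ hp.1
    all_goals rcases hp with ⟨rfl, rfl, -⟩ | ⟨rfl, rfl, -⟩ | ⟨rfl, rfl, -⟩ <;>
      first | assumption | exact Ne.symm ‹_›
  · intro p q r hp
    rcases hp with hp | hp | hp | hp
    · exact Or.inl ⟨h.rotate _ _ _ hp.1, fun hr => hp.2 hr.rotate.rotate⟩
    · exact Or.inr (Or.inl hp.rotate)
    · exact Or.inr (Or.inr (Or.inl hp.rotate))
    · exact Or.inr (Or.inr (Or.inr hp.rotate))

theorem base {a b c : V} (hab : a ≠ b) (hbc : b ≠ c) (hca : c ≠ a) :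
    IsFaceSystem {a, b, c} (IsRotationOf b a c) := by
  constructor
  · rintro p q r (⟨rfl, -⟩ | ⟨rfl, -⟩ | ⟨rfl, -⟩) <;> simp
  · rintro p q r (⟨rfl, rfl, -⟩ | ⟨rfl, rfl, -⟩ | ⟨rfl, rfl, -⟩) <;>
      first | assumption | exact Ne.symm ‹_›
  · exact fun p q r h => h.rotate

end IsFaceSystem

theorem Stacked.isFaceSystem {A₀ : Set V} {F₀ : V → V → V → Prop} (h₀ : IsFaceSystem A₀ F₀)
    {A : Set V} {F : V → V → V → Prop} (h : Stacked A₀ F₀ A F) : IsFaceSystem A F := by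
  induction h with
  | base => exact h₀
  | step x u v w _ hx hf ih => exact ih.subdivide hx hf

theorem Stacked.step' {A₀ : Set V} {F₀ : V → V → V → Prop} {A A' : Set V}
    {F F' : V → V → V → Prop} (h : Stacked A₀ F₀ A F) (x u v w : V) (hx : x ∉ A) (hf : F u v w)
    (hA : A' = insert x A) (hF : F' = subdivide F u v w x) : Stacked A₀ F₀ A' F' := by
  subst hA hF; exact h.step x u v w hx hf

theorem Stacked.subset {A₀ : Set V} {F₀ : V → V → V → Prop}
    {A : Set V} {F : V → V → V → Prop} (h : Stacked A₀ F₀ A F) : A₀ ⊆ A := by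
  induction h with
  | base => exact subset_rfl
  | step x u v w _ hx hf ih => exact ih.trans (Set.subset_insert _ _)

theorem IsRotationOf.map_iff (φ : V → W) (u v w : V) (p q r : W) :
    (∃ p' q' r', φ p' = p ∧ φ q' = q ∧ φ r' = r ∧ IsRotationOf u v w p' q' r') ↔
      IsRotationOf (φ u) (φ v) (φ w) p q r := by
  constructor
  · rintro ⟨p', q', r', rfl, rfl, rfl, (⟨rfl, rfl, rfl⟩ | ⟨rfl, rfl, rfl⟩ | ⟨rfl, rfl, rfl⟩)⟩ <;>
      simp [IsRotationOf]
  · rintro (⟨rfl, rfl, rfl⟩ | ⟨rfl, rfl, rfl⟩ | ⟨rfl, rfl, rfl⟩) <;>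
      exact ⟨_, _, _, rfl, rfl, rfl, by simp [IsRotationOf]⟩

/-- The image of a system of faces under a map of vertices. -/
def mapFaces (φ : V → W) (F : V → V → V → Prop) (p q r : W) : Prop :=
  ∃ p' q' r', φ p' = p ∧ φ q' = q ∧ φ r' = r ∧ F p' q' r'

theorem mapFaces_subdivide {φ : V → W} (hφ : Function.Injective φ) (F : V → V → V → Prop)
    (u v w x : V) :
    mapFaces φ (subdivide F u v w x) = subdivide (mapFaces φ F) (φ u) (φ v) (φ w) (φ x) := by
  funext p q r
  apply propext
  simp only [mapFaces, subdivide, ← IsRotationOf.map_iff φ]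
  constructor
  · rintro ⟨p', q', r', rfl, rfl, rfl, h | h | h | h⟩
    · refine Or.inl ⟨⟨p', q', r', rfl, rfl, rfl, h.1⟩, ?_⟩
      rintro ⟨p2, q2, r2, e1, e2, e3, h2⟩
      rw [hφ e1, hφ e2, hφ e3] at h2
      exact h.2 h2
    · exact Or.inr (Or.inl ⟨p', q', r', rfl, rfl, rfl, h⟩)
    · exact Or.inr (Or.inr (Or.inl ⟨p', q', r', rfl, rfl, rfl, h⟩))
    · exact Or.inr (Or.inr (Or.inr ⟨p', q', r', rfl, rfl, rfl, h⟩))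
  · rintro (⟨⟨p', q', r', rfl, rfl, rfl, h⟩, h2⟩ | ⟨p', q', r', rfl, rfl, rfl, h⟩ |
      ⟨p', q', r', rfl, rfl, rfl, h⟩ | ⟨p', q', r', rfl, rfl, rfl, h⟩)
    · exact ⟨p', q', r', rfl, rfl, rfl, Or.inl ⟨h, fun h3 =>
        h2 ⟨p', q', r', rfl, rfl, rfl, h3⟩⟩⟩
    · exact ⟨p', q', r', rfl, rfl, rfl, Or.inr (Or.inl h)⟩
    · exact ⟨p', q', r', rfl, rfl, rfl, Or.inr (Or.inr (Or.inl h))⟩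
    · exact ⟨p', q', r', rfl, rfl, rfl, Or.inr (Or.inr (Or.inr h))⟩

theorem Stacked.map {A₀ : Set V} {F₀ : V → V → V → Prop} {A : Set V} {F : V → V → V → Prop}
    {φ : V → W} (hφ : Function.Injective φ) (h : Stacked A₀ F₀ A F) :
    Stacked (φ '' A₀) (mapFaces φ F₀) (φ '' A) (mapFaces φ F) := by
  induction h with
  | base => exact .base
  | step x u v w _ hx hf ih =>
    refine ih.step' (φ x) (φ u) (φ v) (φ w) ?_ ⟨u, v, w, rfl, rfl, rfl, hf⟩
      (Set.image_insert_eq ..) (mapFaces_subdivide hφ ..)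
    rintro ⟨y, hy, e⟩
    exact hx (hφ e ▸ hy)

theorem StackedDisc.map {a b c : V} {A : Set V} {F : V → V → V → Prop}
    {φ : V → W} (hφ : Function.Injective φ) (h : StackedDisc a b c A F) :
    StackedDisc (φ a) (φ b) (φ c) (φ '' A) (mapFaces φ F) := by
  have := Stacked.map hφ h
  have e : mapFaces φ (IsRotationOf b a c) = IsRotationOf (φ b) (φ a) (φ c) := by
    funext p q r; exact propext (IsRotationOf.map_iff φ b a c p q r)
  rw [e] at this
  simpa [Set.image_insert_eq, StackedDisc] using this

/-- Stacked triangulations of the sphere. -/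
def StackedSphere (A : Set V) (F : V → V → V → Prop) : Prop :=
  ∃ a b c, a ≠ b ∧ b ≠ c ∧ c ≠ a ∧
    Stacked {a, b, c} (fun p q r => IsRotationOf a b c p q r ∨ IsRotationOf b a c p q r) A F

theorem StackedSphere.map {A : Set V} {F : V → V → V → Prop}
    {φ : V → W} (hφ : Function.Injective φ) (h : StackedSphere A F) :
    StackedSphere (φ '' A) (mapFaces φ F) := by
  obtain ⟨a, b, c, hab, hbc, hca, h⟩ := h
  refine ⟨φ a, φ b, φ c, hφ.ne hab, hφ.ne hbc, hφ.ne hca, ?_⟩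
  have := Stacked.map hφ h
  have e : mapFaces φ (fun p q r => IsRotationOf a b c p q r ∨ IsRotationOf b a c p q r) =
      fun p q r => IsRotationOf (φ a) (φ b) (φ c) p q r ∨
        IsRotationOf (φ b) (φ a) (φ c) p q r := by
    funext p q r
    apply propext
    rw [← IsRotationOf.map_iff φ, ← IsRotationOf.map_iff φ]
    simp only [mapFaces, and_or_left, exists_or]
  rw [e] at this
  simpa [Set.image_insert_eq] using this

theorem StackedDisc.rotate {a b c : V} {A : Set V} {F : V → V → V → Prop}
    (h : StackedDisc a b c A F) : StackedDisc b c a A F := by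
  unfold StackedDisc at *
  rw [show ({b, c, a} : Set V) = {a, b, c} by ext; simp; tauto,
    show IsRotationOf c b a = IsRotationOf b a c by
      rw [← IsRotationOf.rotate_iff c b a]]
  exact h

theorem StackedDisc.isFaceSystem {a b c : V} (hab : a ≠ b) (hbc : b ≠ c) (hca : c ≠ a)
    {A : Set V} {F : V → V → V → Prop}
    (h : StackedDisc a b c A F) : IsFaceSystem A F :=
  Stacked.isFaceSystem (.base hab hbc hca) h

/-- Moving the boundary across a vertex `y` that is stacked onto the outer face. -/
theorem StackedDisc.expand {u v w : V} (huv : u ≠ v) (hvw : v ≠ w) (hwu : w ≠ u)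
    {A : Set V} {F : V → V → V → Prop} (h : StackedDisc u v w A F) {y : V} (hy : y ∉ A) :
    StackedDisc u v y (insert y A)
      (fun p q r => F p q r ∨ IsRotationOf v w y p q r ∨ IsRotationOf w u y p q r) := by
  unfold StackedDisc at *
  induction h with
  | base =>
    simp only [Set.mem_insert_iff, Set.mem_singleton_iff, not_or] at hy
    -- The new disc starts as the face `(v, u, y)`. Inserting `w` first produces the old initial
    -- face `(v, u, w)` together with the two faces at `y`.
    refine Stacked.base.step' w v u y ?_ (.refl ..) ?_ ?_
    · simp only [Set.mem_insert_iff, Set.mem_singleton_iff, not_or]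
      exact ⟨hwu, hvw.symm, Ne.symm hy.2.2⟩
    · ext z
      simp only [Set.mem_insert_iff, Set.mem_singleton_iff]
      grind
    · funext p q r
      simp only [subdivide, and_not_self, false_or, eq_iff_iff]
      rw [IsRotationOf.rotate_iff w u y, ← IsRotationOf.rotate_iff y v w]
      exact or_congr_right or_comm
  | @step A F x p q r hs hx hf ih =>
    simp only [Set.mem_insert_iff, not_or] at hy
    have fs := Stacked.isFaceSystem (.base huv hvw hwu) hs
    have y1 : y ≠ p := fun e => hy.2 (e ▸ fs.mem _ _ _ hf)
    have y2 : y ≠ q := fun e => hy.2 (e ▸ fs.mem₂ hf)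
    have y3 : y ≠ r := fun e => hy.2 (e ▸ fs.mem₃ hf)
    -- The same insertion is made in the expanded disc; the two added faces contain `y`, which is
    -- not a corner of `(p, q, r)`, so they are not affected.
    refine (ih hy.2).step' x p q r ?_ (Or.inl hf) (Set.insert_comm ..) ?_
    · simp only [Set.mem_insert_iff, not_or]
      exact ⟨Ne.symm hy.1, hx⟩
    · funext p' q' r'
      apply propext
      have k : ∀ s t, IsRotationOf s t y p' q' r' → ¬ IsRotationOf p q r p' q' r' := by
        intro s t h h'
        have := (h'.eq ▸ h.eq : IsRotationOf p q r = _) ▸ IsRotationOf.refl p q r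
        rcases this.mem with e | e | e <;> contradiction
      have k1 := k v w
      have k2 := k w u
      simp only [subdivide]
      grind

/-- Any face of a stacked sphere may be taken as the outer face. -/
theorem StackedSphere.stackedDisc {A : Set V} {F : V → V → V → Prop} (h : StackedSphere A F)
    {u v w : V} (hf : F u v w) :
    StackedDisc u v w A (fun p q r => F p q r ∧ ¬ IsRotationOf u v w p q r) := by
  obtain ⟨a, b, c, hab, hbc, hca, h⟩ := h
  have h₀ : IsFaceSystem {a, b, c}
      (fun p q r => IsRotationOf a b c p q r ∨ IsRotationOf b a c p q r) := by
    have h1 := IsFaceSystem.base hab.symm hca.symm hbc.symm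
    rw [show ({b, a, c} : Set V) = {a, b, c} from Set.insert_comm ..] at h1
    have h2 := IsFaceSystem.base hab hbc hca
    exact ⟨fun p q r h => h.elim (h1.mem p q r) (h2.mem p q r),
      fun p q r h => h.elim (h1.ne p q r) (h2.ne p q r),
      fun p q r h => h.imp (h1.rotate p q r) (h2.rotate p q r)⟩
  induction h generalizing u v w with
  | base =>
    unfold StackedDisc
    convert Stacked.base using 1
    · ext z
      simp only [Set.mem_insert_iff, Set.mem_singleton_iff]
      rcases hf with hf | hf <;>
        rcases hf with ⟨rfl, rfl, rfl⟩ | ⟨rfl, rfl, rfl⟩ | ⟨rfl, rfl, rfl⟩ <;> grind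
    -- The two initial faces have no triple in common, so discarding the outer one leaves exactly
    -- the other.
    · have k : ∀ p q r, IsRotationOf a b c p q r → ¬ IsRotationOf b a c p q r := by
        intro p q r h h'
        rcases h with ⟨rfl, rfl, rfl⟩ | ⟨rfl, rfl, rfl⟩ | ⟨rfl, rfl, rfl⟩ <;>
          rcases h' with ⟨e1, e2, e3⟩ | ⟨e1, e2, e3⟩ | ⟨e1, e2, e3⟩ <;> grind
      funext p q r
      have k := k p q r
      apply propext
      rcases hf with hf | hf
      · rw [hf.eq, show IsRotationOf v u w = IsRotationOf b a c by
          rcases hf with ⟨rfl, rfl, rfl⟩ | ⟨rfl, rfl, rfl⟩ | ⟨rfl, rfl, rfl⟩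
          · rfl
          · rw [← IsRotationOf.rotate_iff]
          · rw [IsRotationOf.rotate_iff]]
        grind
      · rw [hf.eq, show IsRotationOf v u w = IsRotationOf a b c by
          rcases hf with ⟨rfl, rfl, rfl⟩ | ⟨rfl, rfl, rfl⟩ | ⟨rfl, rfl, rfl⟩
          · rfl
          · rw [← IsRotationOf.rotate_iff]
          · rw [IsRotationOf.rotate_iff]]
        grind
  | @step A F x p q r hs hx hpqr ih =>
    have fs := Stacked.isFaceSystem h₀ hs
    -- Either the desired outer face is older than `x`, and `x` is inserted into the disc obtained
    -- by induction, or it is one of the three faces at `x`.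
    rcases hf with hf | hf
    · have := ih hf.1
      have hne : ¬ IsRotationOf u v w p q r := fun hr => hf.2 hr.symm
      refine Stacked.step' this x p q r hx ⟨hpqr, hne⟩ rfl ?_
      have u1 : x ≠ u := fun e => hx (e ▸ fs.mem _ _ _ hf.1)
      have u2 : x ≠ v := fun e => hx (e ▸ fs.mem₂ hf.1)
      have u3 : x ≠ w := fun e => hx (e ▸ fs.mem₃ hf.1)
      funext p' q' r'
      apply propext
      have k : ∀ s t, IsRotationOf s t x p' q' r' → ¬ IsRotationOf u v w p' q' r' := by
        intro s t h h'
        have := (h'.eq ▸ h.eq : IsRotationOf u v w = _) ▸ IsRotationOf.refl u v w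
        rcases this.mem with e | e | e <;> contradiction
      have k1 := k p q
      have k2 := k q r
      have k3 := k r p
      simp only [subdivide]
      grind
    · have n1 := fs.ne _ _ _ hpqr
      have n2 := fs.ne₂ hpqr
      have n3 := fs.ne₃ hpqr
      have x1 : x ≠ p := fun e => hx (e ▸ fs.mem _ _ _ hpqr)
      have x2 : x ≠ q := fun e => hx (e ▸ fs.mem₂ hpqr)
      have x3 : x ≠ r := fun e => hx (e ▸ fs.mem₃ hpqr)
      -- By induction the face `(p, q, r)` that receives `x` may itself be taken as the outer face.
      -- Stacking `x` onto it from outside leaves `(p, q, x)` as the outer face.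
      have key : ∀ p q r, F p q r → p ≠ q → q ≠ r → r ≠ p → x ≠ p → x ≠ q → x ≠ r →
          StackedDisc p q x (insert x A)
            (fun p' q' r' => subdivide F p q r x p' q' r' ∧ ¬ IsRotationOf p q x p' q' r') := by
        intro p q r hpqr n1 n2 n3 x1 x2 x3
        convert (ih hpqr).expand n1 n2 n3 hx using 1
        funext p' q' r'
        apply propext
        have k1 : F p' q' r' → ¬ IsRotationOf p q x p' q' r' := by
          intro h
          have u1 : x ≠ p' := fun e => hx (e ▸ fs.mem _ _ _ h)
          have u2 : x ≠ q' := fun e => hx (e ▸ fs.mem₂ h)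
          have u3 : x ≠ r' := fun e => hx (e ▸ fs.mem₃ h)
          intro h'
          rcases h'.mem with e | e | e <;> contradiction
        have k2 : IsRotationOf q r x p' q' r' → ¬ IsRotationOf p q x p' q' r' :=
          fun h h' => h'.not_consecutive n1 x1 x2 h
        have k3 : IsRotationOf r p x p' q' r' → ¬ IsRotationOf p q x p' q' r' :=
          fun h h' => h.not_consecutive n3 x3 x1 h'
        simp only [subdivide]
        grind
      have fin : ∀ p q r, F p q r → p ≠ q → q ≠ r → r ≠ p → x ≠ p → x ≠ q → x ≠ r →
          IsRotationOf p q x u v w → StackedDisc u v w (insert x A)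
            (fun p' q' r' => subdivide F p q r x p' q' r' ∧ ¬ IsRotationOf u v w p' q' r') := by
        intro p q r hpqr n1 n2 n3 x1 x2 x3 hr
        have := key p q r hpqr n1 n2 n3 x1 x2 x3
        rcases hr with ⟨rfl, rfl, rfl⟩ | ⟨rfl, rfl, rfl⟩ | ⟨rfl, rfl, rfl⟩
        · exact this
        · have h2 := this.rotate
          rwa [← IsRotationOf.rotate_iff] at h2
        · have h2 := this.rotate.rotate
          rwa [← IsRotationOf.rotate_iff, ← IsRotationOf.rotate_iff] at h2
      rcases hf with hf | hf | hf
      · exact fin p q r hpqr n1 n2 n3 x1 x2 x3 hf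
      · rw [← subdivide_rotate]
        exact fin q r p (fs.rotate _ _ _ hpqr) n2 n3 n1 x2 x3 x1 hf
      · rw [← subdivide_rotate, ← subdivide_rotate]
        exact fin r p q (fs.rotate _ _ _ (fs.rotate _ _ _ hpqr)) n3 n1 n2 x3 x1 x2 hf

end Stacked

/-! ### Removing inner vertices of degree three in any order -/

section Removal

variable {V : Type} {a b c : V} {A : Set V} {F : V → V → V → Prop}

theorem exists_subdivide_of_face {u v w x p q r : V} (h : F p q r) :
    ∃ s, subdivide F u v w x p q s := by
  by_cases hr : IsRotationOf u v w p q r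
  · refine ⟨x, ?_⟩
    rcases hr with ⟨rfl, rfl, rfl⟩ | ⟨rfl, rfl, rfl⟩ | ⟨rfl, rfl, rfl⟩ <;>
      simp [subdivide, IsRotationOf]
  · exact ⟨r, Or.inl ⟨h, hr⟩⟩

theorem exists_face_of_subdivide (fs : IsFaceSystem A F) {u v w x p q r : V} (hf : F u v w)
    (hp : p ≠ x) (hq : q ≠ x) (h : subdivide F u v w x p q r) : ∃ s, F p q s := by
  have h1 := fs.rotate _ _ _ hf
  have h2 := fs.rotate _ _ _ h1
  rcases h with h | h | h | h
  · exact ⟨r, h.1⟩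
  all_goals
    rcases h with ⟨rfl, rfl, rfl⟩ | ⟨rfl, rfl, rfl⟩ | ⟨rfl, rfl, rfl⟩
    · exact ⟨_, by assumption⟩
    · exact absurd rfl hq
    · exact absurd rfl hp

/-- Splitting a face keeps its three sides, and every new edge ends at `x`. Adjacency among old
vertices therefore never changes, which is why one adjacency matrix serves the whole computation. -/
theorem faceAdj_subdivide_iff (fs : IsFaceSystem A F) {u v w x p q : V} (hf : F u v w)
    (hp : p ≠ x) (hq : q ≠ x) : FaceAdj (subdivide F u v w x) p q ↔ FaceAdj F p q := by
  constructor
  · rintro ⟨r, h | h⟩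
    · exact (exists_face_of_subdivide fs hf hp hq h).imp fun _ => Or.inl
    · exact (exists_face_of_subdivide fs hf hq hp h).imp fun _ => Or.inr
  · rintro ⟨r, h | h⟩
    · exact (exists_subdivide_of_face h).imp fun _ => Or.inl
    · exact (exists_subdivide_of_face h).imp fun _ => Or.inr

theorem faceAdj_subdivide_self_iff (fs : IsFaceSystem A F) {u v w x : V} (hx : x ∉ A)
    (hf : F u v w) (y : V) : FaceAdj (subdivide F u v w x) x y ↔ y = u ∨ y = v ∨ y = w := by
  have x1 : x ≠ u := fun e => hx (e ▸ fs.mem _ _ _ hf)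
  have x2 : x ≠ v := fun e => hx (e ▸ fs.mem₂ hf)
  have x3 : x ≠ w := fun e => hx (e ▸ fs.mem₃ hf)
  constructor
  · rintro ⟨r, h | h⟩
    · rcases h with h | h | h | h
      · exact absurd (fs.mem _ _ _ h.1) hx
      all_goals rcases h with ⟨e1, e2, e3⟩ | ⟨e1, e2, e3⟩ | ⟨e1, e2, e3⟩ <;> simp_all
    · rcases h with h | h | h | h
      · exact absurd (fs.mem₂ h.1) hx
      all_goals rcases h with ⟨e1, e2, e3⟩ | ⟨e1, e2, e3⟩ | ⟨e1, e2, e3⟩ <;> simp_all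
  · rintro (rfl | rfl | rfl)
    · exact ⟨v, Or.inl (Or.inr (Or.inl (by simp [IsRotationOf])))⟩
    · exact ⟨w, Or.inl (Or.inr (Or.inr (Or.inl (by simp [IsRotationOf]))))⟩
    · exact ⟨u, Or.inl (Or.inr (Or.inr (Or.inr (by simp [IsRotationOf]))))⟩

theorem IsRotationOf.not_of_not_mem {u v w s t y p q r : V} (hu : y ≠ u) (hv : y ≠ v)
    (hw : y ≠ w) (h : IsRotationOf s t y p q r) : ¬ IsRotationOf u v w p q r := by
  intro h'
  have := (h'.eq ▸ h.eq : IsRotationOf u v w = _) ▸ IsRotationOf.refl u v w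
  rcases this.mem with e | e | e <;> contradiction

/-- A face created by one insertion contains the inserted vertex, which is not a corner of the face
split by the other insertion. Neither insertion destroys a face made by the other. -/
theorem subdivide_comm {u v w x p q r y : V} (x1 : x ≠ p) (x2 : x ≠ q) (x3 : x ≠ r)
    (y1 : y ≠ u) (y2 : y ≠ v) (y3 : y ≠ w) :
    subdivide (subdivide F u v w x) p q r y = subdivide (subdivide F p q r y) u v w x := by
  funext p' q' r'
  have k : ∀ s t, IsRotationOf s t x p' q' r' → ¬ IsRotationOf p q r p' q' r' :=
    fun s t => IsRotationOf.not_of_not_mem x1 x2 x3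
  have k' : ∀ s t, IsRotationOf s t y p' q' r' → ¬ IsRotationOf u v w p' q' r' :=
    fun s t => IsRotationOf.not_of_not_mem y1 y2 y3
  have k1 := k u v
  have k2 := k v w
  have k3 := k w u
  have k4 := k' p q
  have k5 := k' q r
  have k6 := k' r p
  apply propext
  simp only [subdivide]
  grind

/-- An inner vertex has three neighbours when it is inserted, and later insertions only add
neighbours. -/
theorem StackedDisc.exists_three_adj (hab : a ≠ b) (hbc : b ≠ c) (hca : c ≠ a)
    (h : StackedDisc a b c A F) {x : V} (hx : x ∈ A) (hxo : x ∉ ({a, b, c} : Set V)) :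
    ∃ u v w, u ≠ v ∧ v ≠ w ∧ w ≠ u ∧ FaceAdj F x u ∧ FaceAdj F x v ∧ FaceAdj F x w := by
  unfold StackedDisc at h
  induction h with
  | base => exact absurd hx hxo
  | @step A F y p q r hs hy hf ih =>
    have fs := Stacked.isFaceSystem (.base hab hbc hca) hs
    by_cases hxy : x = y
    · subst hxy
      have := faceAdj_subdivide_self_iff fs hy hf
      exact ⟨p, q, r, fs.ne _ _ _ hf, fs.ne₂ hf, fs.ne₃ hf, (this p).2 (by simp),
        (this q).2 (by simp), (this r).2 (by simp)⟩
    · obtain ⟨u, v, w, n1, n2, n3, h1, h2, h3⟩ := ih (Set.mem_of_mem_insert_of_ne hx hxy)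
      have k : ∀ z, FaceAdj F x z → FaceAdj (subdivide F p q r y) x z := by
        intro z hz
        refine (faceAdj_subdivide_iff fs hf hxy ?_).2 hz
        rintro rfl
        obtain ⟨s, hs | hs⟩ := hz
        · exact hy (fs.mem₂ hs)
        · exact hy (fs.mem _ _ _ hs)
      exact ⟨u, v, w, n1, n2, n3, k u h1, k v h2, k w h3⟩

theorem FaceAdj.mem (fs : IsFaceSystem A F) {p q : V} (h : FaceAdj F p q) : q ∈ A := by
  obtain ⟨s, hs | hs⟩ := h
  · exact fs.mem₂ hs
  · exact fs.mem _ _ _ hs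

/-- A neighbourhood of three vertices determines the surrounding face only up to orientation, which
accounts for the two alternatives in `StackedDisc.exists_remove`. -/
theorem perm_cases {p q r u v w : V} (n1 : p ≠ q) (n2 : q ≠ r) (n3 : r ≠ p)
    (h : ∀ y, (y = p ∨ y = q ∨ y = r) ↔ (y = u ∨ y = v ∨ y = w)) :
    IsRotationOf p q r u v w ∨ IsRotationOf p q r v u w := by
  have h1 := (h p).1 (by simp)
  have h2 := (h q).1 (by simp)
  have h3 := (h r).1 (by simp)
  unfold IsRotationOf
  rcases h1 with rfl | rfl | rfl <;> rcases h2 with rfl | rfl | rfl <;>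
    rcases h3 with rfl | rfl | rfl <;> simp_all

theorem subdivide_congr_rotation {u v w p q r : V} (h : IsRotationOf p q r u v w) (x : V) :
    subdivide F p q r x = subdivide F u v w x := by
  rcases h with ⟨rfl, rfl, rfl⟩ | ⟨rfl, rfl, rfl⟩ | ⟨rfl, rfl, rfl⟩
  · rfl
  · exact (subdivide_rotate ..).symm
  · exact subdivide_rotate ..

theorem IsFaceSystem.of_rotation (fs : IsFaceSystem A F) {u v w p q r : V}
    (h : IsRotationOf p q r u v w) (hf : F p q r) : F u v w := by
  rcases h with ⟨rfl, rfl, rfl⟩ | ⟨rfl, rfl, rfl⟩ | ⟨rfl, rfl, rfl⟩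
  · exact hf
  · exact fs.rotate _ _ _ hf
  · exact fs.rotate _ _ _ (fs.rotate _ _ _ hf)

/-- When `x` is no corner of the face that receives `y`, this face already exists without `x`. So
`y` can be inserted before `x`. -/
theorem StackedDisc.exists_remove_aux {p q r u v w : V} {y x : V}
    {F₁ : V → V → V → Prop} (hy : y ∉ A) (hf : F p q r)
    (x1 : x ≠ p) (x2 : x ≠ q) (x3 : x ≠ r)
    (h₁ : StackedDisc a b c (A \ {x}) F₁) (hf₁ : F₁ u v w) (hF : F = subdivide F₁ u v w x)
    (fs₁ : IsFaceSystem (A \ {x}) F₁) (hxy : x ≠ y) :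
    ∃ F', StackedDisc a b c (insert y A \ {x}) F' ∧ F' u v w ∧
      subdivide F p q r y = subdivide F' u v w x := by
  have y1 : y ≠ u := fun e => hy (e ▸ (fs₁.mem _ _ _ hf₁).1)
  have y2 : y ≠ v := fun e => hy (e ▸ (fs₁.mem₂ hf₁).1)
  have y3 : y ≠ w := fun e => hy (e ▸ (fs₁.mem₃ hf₁).1)
  have hf' : F₁ p q r ∧ ¬ IsRotationOf u v w p q r := by
    rw [hF] at hf
    rcases hf with h | h | h | h
    · exact h
    all_goals exact absurd h.mem (by simp [x1, x2, x3])
  refine ⟨subdivide F₁ p q r y, ?_, Or.inl ⟨hf₁, fun h => hf'.2 h.symm⟩, ?_⟩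
  · refine Stacked.step' h₁ y p q r (fun h => hy h.1) hf'.1 ?_ rfl
    rw [Set.insert_sdiff_of_notMem _ (by simpa using hxy.symm)]
  · rw [hF, subdivide_comm x1 x2 x3 y1 y2 y3]

/-- Any inner vertex of degree three may be removed. -/
theorem StackedDisc.exists_remove (hab : a ≠ b) (hbc : b ≠ c) (hca : c ≠ a)
    (h : StackedDisc a b c A F) {x u v w : V} (hx : x ∈ A) (hxo : x ∉ ({a, b, c} : Set V))
    (hN : ∀ y, FaceAdj F x y ↔ y = u ∨ y = v ∨ y = w) :
    ∃ F', StackedDisc a b c (A \ {x}) F' ∧ ((F' u v w ∧ F = subdivide F' u v w x) ∨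
      (F' v u w ∧ F = subdivide F' v u w x)) := by
  unfold StackedDisc at h
  induction h with
  | base => exact absurd hx hxo
  | @step A F y p q r hs hy hf ih =>
    have fs := Stacked.isFaceSystem (.base hab hbc hca) hs
    have hNy := faceAdj_subdivide_self_iff fs hy hf
    by_cases hxy : x = y
    · subst hxy
      refine ⟨F, by simpa [Set.insert_sdiff_of_mem, hy, StackedDisc] using hs, ?_⟩
      have := perm_cases (fs.ne _ _ _ hf) (fs.ne₂ hf) (fs.ne₃ hf)
        (fun z => (hNy z).symm.trans (hN z))
      exact this.imp (fun h => ⟨fs.of_rotation h hf, subdivide_congr_rotation h x⟩)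
        (fun h => ⟨fs.of_rotation h hf, subdivide_congr_rotation h x⟩)
    · have hxA : x ∈ A := Set.mem_of_mem_insert_of_ne hx hxy
      have k : ∀ z, FaceAdj F x z → z = u ∨ z = v ∨ z = w := by
        intro z hz
        rw [← hN, faceAdj_subdivide_iff fs hf hxy]
        · exact hz
        · rintro rfl; exact hy (hz.mem fs)
      -- If `y` went into a face at `x`, it would be a fourth neighbour besides the at least three
      -- that `x` had before.
      by_cases hxf : x = p ∨ x = q ∨ x = r
      · exfalso
        obtain ⟨u', v', w', n1, n2, n3, h1, h2, h3⟩ :=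
          StackedDisc.exists_three_adj hab hbc hca hs hxA hxo
        have e1 := k _ h1
        have e2 := k _ h2
        have e3 := k _ h3
        have e4 := (hN y).1 ((hNy x).2 hxf).symm
        have m1 : y ≠ u' := fun e => hy (e ▸ h1.mem fs)
        have m2 : y ≠ v' := fun e => hy (e ▸ h2.mem fs)
        have m3 : y ≠ w' := fun e => hy (e ▸ h3.mem fs)
        grind
      · simp only [not_or] at hxf
        obtain ⟨x1, x2, x3⟩ := hxf
        obtain ⟨F₁, h₁, hF₁⟩ := ih hxA (by
          refine fun z => ⟨k z, fun hz => ?_⟩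
          rw [← hN] at hz
          by_cases hzy : z = y
          · subst hzy
            have := (hNy x).1 hz.symm
            simp [x1, x2, x3] at this
          · rwa [faceAdj_subdivide_iff fs hf hxy hzy] at hz)
        have fs₁ := Stacked.isFaceSystem (.base hab hbc hca) h₁
        rcases hF₁ with ⟨hf₁, hF₁⟩ | ⟨hf₁, hF₁⟩
        · obtain ⟨F', h1, h2, h3⟩ := StackedDisc.exists_remove_aux hy hf x1 x2 x3 h₁ hf₁ hF₁ fs₁ hxy
          exact ⟨F', h1, Or.inl ⟨h2, h3⟩⟩
        · obtain ⟨F', h1, h2, h3⟩ := StackedDisc.exists_remove_aux hy hf x1 x2 x3 h₁ hf₁ hF₁ fs₁ hxy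
          exact ⟨F', h1, Or.inr ⟨h2, h3⟩⟩

/-- The vertex inserted last qualifies. -/
theorem StackedDisc.exists_degree_three (hab : a ≠ b) (hbc : b ≠ c) (hca : c ≠ a)
    (h : StackedDisc a b c A F) (hA : A ≠ {a, b, c}) :
    ∃ x u v w, x ∈ A ∧ x ∉ ({a, b, c} : Set V) ∧ u ≠ v ∧ v ≠ w ∧ w ≠ u ∧
      ∀ y, FaceAdj F x y ↔ y = u ∨ y = v ∨ y = w := by
  unfold StackedDisc at h
  cases h with
  | base => exact absurd rfl hA
  | @step A F x p q r hs hx hf =>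
    have fs := Stacked.isFaceSystem (.base hab hbc hca) hs
    exact ⟨x, p, q, r, Set.mem_insert _ _, fun h => hx (hs.subset h), fs.ne _ _ _ hf,
      fs.ne₂ hf, fs.ne₃ hf, faceAdj_subdivide_self_iff fs hx hf⟩

end Removal

/-! ### Deleting a vertex from a triangulated rotation system -/

namespace RotationSystem

variable {V : Type} {G : RotationSystem V}

theorem IsPlane.adj_rot_iff (h : G.IsPlane) {u v : V} :
    G.graph.Adj v (G.rot v u) ↔ G.graph.Adj v u :=
  (h.isCycleOn v).apply_mem_iff

theorem IsPlane.isFacialTriangle_rotate (h : G.IsPlane) {u v w : V}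
    (hf : G.IsFacialTriangle u v w) : G.IsFacialTriangle v w u :=
  ⟨by have := h.adj_rot_iff.2 hf.1.symm; rwa [hf.2.1] at this, hf.2.2.1, hf.2.2.2, hf.2.1⟩

theorem IsTriangulated.isFaceSystem (h : G.IsTriangulated) :
    IsFaceSystem Set.univ G.IsFacialTriangle :=
  ⟨fun _ _ _ _ => trivial, fun _ _ _ hf => hf.1.ne,
    fun _ _ _ hf => h.isPlane.isFacialTriangle_rotate hf⟩

theorem IsTriangulated.exists_adj (h : G.IsTriangulated) (x : V) : ∃ u, G.graph.Adj x u := by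
  have : Finite V := Nat.finite_of_card_ne_zero (by have := h.three_le; omega)
  have : Nontrivial V := Finite.one_lt_card_iff_nontrivial.1 (by have := h.three_le; omega)
  obtain ⟨y, hy⟩ := exists_ne x
  obtain ⟨p⟩ := h.isPlane.connected.preconnected x y
  cases p with
  | nil => exact absurd rfl hy
  | cons e _ => exact ⟨_, e⟩

open Classical in
theorem delete_rot_apply (x : V) (v w : {v : V // v ≠ x}) :
    (((G.delete x).rot v w : {v : V // v ≠ x}) : V) =
      Equiv.swap x (G.rot v x) (G.rot v w) := rfl

open Classical in
theorem delete_rot_eq (x : V) (v w : {v : V // v ≠ x}) (h : G.rot v w ≠ x) :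
    (((G.delete x).rot v w : {v : V // v ≠ x}) : V) = G.rot v w := by
  rw [delete_rot_apply, Equiv.swap_apply_of_ne_of_ne h]
  exact fun e => w.2 ((G.rot v).injective e)

open Classical in
theorem delete_rot_eq' (x : V) (v w : {v : V // v ≠ x}) (h : G.rot v w = x) :
    (((G.delete x).rot v w : {v : V // v ≠ x}) : V) = G.rot v x := by
  rw [delete_rot_apply, h, Equiv.swap_apply_left]

/-- If deleting `x` leaves a triangulation, then `x` was inserted into one of its faces. -/
theorem IsTriangulated.exists_eq_subdivide (hG : G.IsTriangulated) (x : V)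
    (hD : (G.delete x).IsTriangulated) :
    ∃ u v w, (G.delete x).IsFacialTriangle u v w ∧
      G.IsFacialTriangle =
        subdivide (mapFaces Subtype.val (G.delete x).IsFacialTriangle) u v w x := by
  have nb : ∀ {u v}, G.graph.Adj v u → G.graph.Adj v (G.rot v u) :=
    fun h => hG.isPlane.adj_rot_iff.2 h
  -- the two faces at the edge from `u` to `x`
  have before : ∀ u, G.graph.Adj x u →
      G.rot (G.rot x u) x = u ∧ G.rot u (G.rot x u) = x := by
    intro u hu
    have := hG.face u x hu.symm
    exact ⟨this.2.2.1, this.2.2.2⟩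
  have after : ∀ u, G.graph.Adj x u →
      G.graph.Adj x (G.rot u x) ∧ G.rot x (G.rot u x) = u ∧ G.rot (G.rot u x) u = x := by
    intro u hu
    have := hG.face x u hu
    have h2 := hG.isPlane.isFacialTriangle_rotate (hG.isPlane.isFacialTriangle_rotate this)
    exact ⟨h2.1.symm, this.2.2.2, this.2.2.1⟩
  obtain ⟨u0, h0⟩ := hG.exists_adj x
  -- Three consecutive neighbours of `x`; it will turn out that the rotation closes up after them.
  obtain ⟨u1, e1⟩ : ∃ u1, u1 = G.rot x u0 := ⟨_, rfl⟩
  obtain ⟨u2, e2⟩ : ∃ u2, u2 = G.rot x u1 := ⟨_, rfl⟩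
  have h1 : G.graph.Adj x u1 := e1 ▸ nb h0
  have h2 : G.graph.Adj x u2 := e2 ▸ nb h1
  have b0 := before u0 h0
  have b1 := before u1 h1
  rw [← e1] at b0
  rw [← e2] at b1
  have f0 : G.IsFacialTriangle u0 x u1 := e1 ▸ hG.face u0 x h0.symm
  have f1 : G.IsFacialTriangle u1 x u2 := e2 ▸ hG.face u1 x h1.symm
  have a21 : G.graph.Adj u2 u1 := by
    have := hG.isPlane.isFacialTriangle_rotate (hG.isPlane.isFacialTriangle_rotate f1)
    exact this.1
  -- At `u1` the rotation of `G` passes from `u2` to `x` to `u0`. Skipping `x` makes `u0` the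
  -- successor of `u2`, and since the smaller graph is triangulated this corner closes to a
  -- triangle.
  have f' : (G.delete x).IsFacialTriangle ⟨u2, h2.ne'⟩ ⟨u1, h1.ne'⟩ ⟨u0, h0.ne'⟩ := by
    have := hD.face ⟨u2, h2.ne'⟩ ⟨u1, h1.ne'⟩ a21
    have e : (G.delete x).rot ⟨u1, h1.ne'⟩ ⟨u2, h2.ne'⟩ = ⟨u0, h0.ne'⟩ := by
      apply Subtype.ext
      rw [delete_rot_eq' _ _ _ b1.2]
      exact b0.1
    rwa [e] at this
  -- The triangle just found has a corner at `u0`: there `u2` follows `u1` once `x` is skipped, so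
  -- in `G` it follows `x`. The face of `G` at that corner then gives the rotation at `x`.
  have e3 : G.rot x u2 = u0 := by
    have h := congrArg Subtype.val f'.2.2.1
    rw [delete_rot_eq' _ _ _ b0.2] at h
    have := (after u0 h0).2.1
    simp only at h
    rwa [h] at this
  have f2 : G.IsFacialTriangle u2 x u0 := e3 ▸ hG.face u2 x h2.symm
  -- The rotation at `x` is a single cycle on its neighbours and permutes `u0`, `u1`, `u2`, so there
  -- are no others.
  have all : ∀ y, G.graph.Adj x y → y = u0 ∨ y = u1 ∨ y = u2 := by
    intro y hy
    obtain ⟨i, hi⟩ := (hG.isPlane.isCycleOn x).2 h0 hy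
    have key : ∀ i : ℤ, ((G.rot x ^ i) u0 = u0 ∨ (G.rot x ^ i) u0 = u1 ∨
        (G.rot x ^ i) u0 = u2) := by
      intro i
      induction i using Int.induction_on with
      | zero => simp
      | succ i ih =>
        rw [add_comm, zpow_add, zpow_one, Equiv.Perm.mul_apply]
        rcases ih with h | h | h <;> rw [h]
        · exact Or.inr (Or.inl e1.symm)
        · exact Or.inr (Or.inr e2.symm)
        · exact Or.inl e3
      | pred i ih =>
        rw [sub_eq_add_neg, add_comm, zpow_add, zpow_neg_one, Equiv.Perm.mul_apply]
        rcases ih with h | h | h <;> rw [h, Equiv.Perm.inv_eq_iff_eq, Equiv.Perm.inv_eq_iff_eq,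
          Equiv.Perm.inv_eq_iff_eq, ← e1, ← e2, e3] <;> simp
    rw [← hi]
    exact key i
  have rotF : ∀ {p q r}, G.IsFacialTriangle p q r → G.IsFacialTriangle q r p :=
    fun h => hG.isPlane.isFacialTriangle_rotate h
  refine ⟨_, _, _, f', ?_⟩
  funext p q r
  simp only [eq_iff_iff]
  -- faces at `x`
  have atx : ∀ q r, G.IsFacialTriangle x q r → IsRotationOf u2 u1 x x q r ∨
      IsRotationOf u1 u0 x x q r ∨ IsRotationOf u0 u2 x x q r := by
    intro q r h
    have hr := all r (rotF (rotF h)).1.symm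
    have := h.2.2.2
    rcases hr with rfl | rfl | rfl
    · rw [← e1] at this
      exact Or.inr (Or.inl (by simp [IsRotationOf, this]))
    · rw [← e2] at this
      exact Or.inl (by simp [IsRotationOf, this])
    · rw [e3] at this
      exact Or.inr (Or.inr (by simp [IsRotationOf, this]))
  constructor
  · intro h
    by_cases hp : p = x
    · subst hp; exact Or.inr (atx _ _ h)
    by_cases hq : q = x
    · subst hq; exact Or.inr ((atx _ _ (rotF h)).imp (·.rotate.rotate)
        (Or.imp (·.rotate.rotate) (·.rotate.rotate)))
    by_cases hr : r = x
    · subst hr; exact Or.inr ((atx _ _ (rotF (rotF h))).imp (·.rotate)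
        (Or.imp (·.rotate) (·.rotate)))
    refine Or.inl ⟨⟨⟨p, hp⟩, ⟨q, hq⟩, ⟨r, hr⟩, rfl, rfl, rfl, h.1, ?_, ?_, ?_⟩, ?_⟩
    · apply Subtype.ext
      rw [delete_rot_eq _ _ _ (by rw [h.2.1]; exact hr)]
      exact h.2.1
    · apply Subtype.ext
      rw [delete_rot_eq _ _ _ (by rw [h.2.2.1]; exact hp)]
      exact h.2.2.1
    · apply Subtype.ext
      rw [delete_rot_eq _ _ _ (by rw [h.2.2.2]; exact hq)]
      exact h.2.2.2
    · intro hr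
      have := hG.isFaceSystem.of_rotation hr.symm h
      have h3 := this.2.1
      rw [b1.2] at h3
      exact h0.ne h3
  · rintro (⟨⟨p, q, r, rfl, rfl, rfl, h⟩, hn⟩ | h | h | h)
    -- A face of the smaller graph can fail to be a face of `G` only if `x` was skipped at one of
    -- its corners. That corner is then a neighbour of `x`, and the face is `(u2, u1, u0)`.
    · have key : ∀ p q r, (G.delete x).IsFacialTriangle p q r → G.rot q p = x →
          IsRotationOf u2 u1 u0 (p : V) q r := by
        intro p q r h hx
        have hr := congrArg Subtype.val h.2.1
        rw [delete_rot_eq' _ _ _ hx] at hr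
        have hpq : G.graph.Adj p q := h.1
        have hxq : G.graph.Adj x q := by
          have := nb hpq.symm
          rw [hx] at this
          exact this.symm
        have hp : G.rot x q = p := (G.rot q).injective ((before q hxq).2.trans hx.symm)
        have hr' : G.rot x r = q := by
          have := (after q hxq).2.1
          rwa [hr] at this
        unfold IsRotationOf
        rcases all q hxq with e | e | e
        · rw [e, ← e1] at hp
          rw [e, ← e3] at hr'
          have := (G.rot x).injective hr'
          simp [e, hp, this]
        · rw [e, ← e2] at hp
          rw [e, e1] at hr'
          have := (G.rot x).injective hr'
          simp [e, hp, this]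
        · rw [e, e3] at hp
          rw [e, e2] at hr'
          have := (G.rot x).injective hr'
          simp [e, hp, this]
      have h' := hD.isPlane.isFacialTriangle_rotate h
      have h'' := hD.isPlane.isFacialTriangle_rotate h'
      have k1 : G.rot q p ≠ x := fun e => hn (key _ _ _ h e)
      have k2 : G.rot r q ≠ x := fun e => hn (key _ _ _ h' e).rotate.rotate
      have k3 : G.rot p r ≠ x := fun e => hn (key _ _ _ h'' e).rotate
      refine ⟨h.1, ?_, ?_, ?_⟩
      · rw [← delete_rot_eq _ _ _ k1, h.2.1]
      · rw [← delete_rot_eq _ _ _ k2, h.2.2.1]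
      · rw [← delete_rot_eq _ _ _ k3, h.2.2.2]
    · exact hG.isFaceSystem.of_rotation h (rotF (rotF f1))
    · exact hG.isFaceSystem.of_rotation h (rotF (rotF f0))
    · exact hG.isFaceSystem.of_rotation h (rotF (rotF f2))

/-- The faces on the two sides of an edge use the same three vertices in opposite directions, and no
further cyclic order of three vertices exists. -/
theorem IsTriangulated.stackedSphere_of_card (hG : G.IsTriangulated) (hV : Nat.card V = 3) :
    StackedSphere Set.univ G.IsFacialTriangle := by
  have : Finite V := Nat.finite_of_card_ne_zero (by omega)
  have : Nonempty V := (Nat.card_pos_iff.1 (by omega)).1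
  obtain ⟨a⟩ := this
  obtain ⟨b, hab⟩ := hG.exists_adj a
  have fs := hG.isFaceSystem
  have f := hG.face a b hab
  have f' := hG.face b a hab.symm
  set c := G.rot b a
  have hu : ({a, b, c} : Set V) = Set.univ := by
    refine Set.eq_of_subset_of_ncard_le (Set.subset_univ _) ?_
    rw [Set.ncard_univ, hV]
    refine (Set.ncard_eq_three.2 ⟨a, b, c, fs.ne _ _ _ f, (fs.ne₃ f).symm, fs.ne₂ f, rfl⟩).ge
  have all : ∀ z, z = a ∨ z = b ∨ z = c := fun z => by
    have : z ∈ ({a, b, c} : Set V) := hu ▸ trivial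
    simpa using this
  have hc : G.rot a b = c := by
    rcases all (G.rot a b) with e | e | e
    · exact absurd e.symm (fs.ne₂ f')
    · exact absurd e (fs.ne₃ f')
    · exact e
  rw [hc] at f'
  refine ⟨a, b, c, fs.ne _ _ _ f, fs.ne₂ f, fs.ne₃ f, ?_⟩
  rw [hu]
  convert Stacked.base using 1
  funext p q r
  apply propext
  constructor
  · intro h
    have n1 := fs.ne _ _ _ h
    have n2 := fs.ne₂ h
    have n3 := fs.ne₃ h
    unfold IsRotationOf
    rcases all p with rfl | rfl | rfl <;> rcases all q with rfl | rfl | rfl <;>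
      rcases all r with rfl | rfl | rfl <;> simp_all
  · rintro (h | h)
    · exact fs.of_rotation h f
    · exact fs.of_rotation h f'

end RotationSystem

/-! ### Plane 3-trees are stacked triangulations -/

theorem IsPlane3Tree.isTriangulated {V : Type} {G : RotationSystem V} (h : IsPlane3Tree G) :
    G.IsTriangulated := by
  cases h <;> assumption

theorem IsPlane3Tree.stackedSphere {V : Type} {G : RotationSystem V} (h : IsPlane3Tree G) :
    StackedSphere Set.univ G.IsFacialTriangle := by
  induction h with
  | triangle G hG hV => exact hG.stackedSphere_of_card hV
  | @step V G x hG hD ih =>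
    obtain ⟨u, v, w, hf, hF⟩ := hG.exists_eq_subdivide x hD.isTriangulated
    obtain ⟨a, b, c, hab, hbc, hca, h⟩ := ih.map Subtype.val_injective
    refine ⟨a, b, c, hab, hbc, hca, h.step' x u v w (by simp) ⟨u, v, w, rfl, rfl, rfl, hf⟩ ?_ hF⟩
    ext y
    simp [em]

theorem IsPlane3Tree.stackedDisc {V : Type} {G : RotationSystem V} (h : IsPlane3Tree G)
    {a b c : V} (hf : G.IsFacialTriangle a b c) :
    StackedDisc a b c Set.univ
      (fun p q r => G.IsFacialTriangle p q r ∧ ¬ IsRotationOf a b c p q r) :=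
  h.stackedSphere.stackedDisc hf

/-! ## Oriented triangles in the plane -/

section Plane

/-- Twice the signed area of the triangle `p q r`. -/
def signedArea (p q r : ℝ × ℝ) : ℝ := (q.1 - p.1) * (r.2 - p.2) - (q.2 - p.2) * (r.1 - p.1)

theorem signedArea_rotate (p q r : ℝ × ℝ) : signedArea q r p = signedArea p q r := by
  unfold signedArea; ring

theorem signedArea_swap (p q r : ℝ × ℝ) : signedArea q p r = -signedArea p q r := by
  unfold signedArea; ring

theorem signedArea_swap' (p q r : ℝ × ℝ) : signedArea p r q = -signedArea p q r := by
  unfold signedArea; ring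

theorem signedArea_combo (p q y z : ℝ × ℝ) {s t : ℝ} (h : s + t = 1) :
    signedArea p q (s • y + t • z) = s * signedArea p q y + t * signedArea p q z := by
  obtain rfl : s = 1 - t := by linarith
  simp only [signedArea, Prod.fst_add, Prod.snd_add, Prod.smul_fst, Prod.smul_snd, smul_eq_mul]
  ring

theorem signedArea_split (u v w x : ℝ × ℝ) :
    signedArea u v x + signedArea v w x + signedArea w u x = signedArea u v w := by
  unfold signedArea; ring

theorem signedArea_left (p q : ℝ × ℝ) : signedArea p q p = 0 := by unfold signedArea; ring

theorem signedArea_right (p q : ℝ × ℝ) : signedArea p q q = 0 := by unfold signedArea; ring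

/-- The points that lie strictly on the `σ`-side of the three sides of the triangle `u v w`. -/
def openTriangle (σ : ℝ) (u v w : ℝ × ℝ) : Set (ℝ × ℝ) :=
  {y | 0 < σ * signedArea u v y ∧ 0 < σ * signedArea v w y ∧ 0 < σ * signedArea w u y}

theorem openTriangle_rotate (σ : ℝ) (u v w : ℝ × ℝ) :
    openTriangle σ v w u = openTriangle σ u v w := by
  ext y; simp only [openTriangle, Set.mem_ofPred_eq]; tauto

theorem pos_of_mem_openTriangle {σ : ℝ} {u v w y : ℝ × ℝ} (h : y ∈ openTriangle σ u v w) :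
    0 < σ * signedArea u v w := by
  rw [← signedArea_split u v w y]
  have := h.1; have := h.2.1; have := h.2.2
  linarith

/-- Cramer's rule: the barycentric coordinates of a point are ratios of signed areas. -/
theorem eq_combo {u v w : ℝ × ℝ} (h : signedArea u v w ≠ 0) (y : ℝ × ℝ) :
    y = (signedArea v w y / signedArea u v w) • u + ((signedArea w u y / signedArea u v w) • v +
      (signedArea u v y / signedArea u v w) • w) := by
  have : signedArea u v w • y = signedArea v w y • u + (signedArea w u y • v +
      signedArea u v y • w) := by
    ext <;> simp [signedArea] <;> ring
  have h2 := congrArg (fun z => (signedArea u v w)⁻¹ • z) this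
  simp only [smul_add, smul_smul, inv_mul_cancel₀ h, one_smul] at h2
  simpa only [div_eq_inv_mul] using h2

theorem openTriangle_subset_convexHull {σ : ℝ} {u v w : ℝ × ℝ} :
    openTriangle σ u v w ⊆ convexHull ℝ {u, v, w} := by
  intro y hy
  have hD := pos_of_mem_openTriangle hy
  have h0 : signedArea u v w ≠ 0 := fun e => by simp [e] at hD
  have div_pos' : ∀ d, 0 < σ * d → 0 ≤ d / signedArea u v w := by
    intro d hd
    have hσ : σ ≠ 0 := fun e => by simp [e] at hd
    rw [← mul_div_mul_left _ _ hσ]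
    positivity
  rw [eq_combo h0 y]
  have e := signedArea_split u v w y
  have hs : signedArea v w y / signedArea u v w + signedArea w u y / signedArea u v w +
      signedArea u v y / signedArea u v w = 1 := by
    rw [← add_div, ← add_div, div_eq_one_iff_eq h0]
    linarith
  have := (convex_convexHull ℝ {u, v, w}).sum_mem (t := Finset.univ)
    (w := ![signedArea v w y / signedArea u v w, signedArea w u y / signedArea u v w,
      signedArea u v y / signedArea u v w]) (z := ![u, v, w]) ?_ ?_ ?_
  · simpa [Fin.sum_univ_succ] using this
  · intro i _
    fin_cases i
    · exact div_pos' _ hy.2.1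
    · exact div_pos' _ hy.2.2
    · exact div_pos' _ hy.1
  · simpa [Fin.sum_univ_succ, add_assoc] using hs
  · intro i _
    apply subset_convexHull
    fin_cases i <;> simp

theorem continuous_signedArea (u v : ℝ × ℝ) : Continuous (signedArea u v) := by
  unfold signedArea; fun_prop

theorem isOpen_openTriangle (σ : ℝ) (u v w : ℝ × ℝ) : IsOpen (openTriangle σ u v w) := by
  have h : ∀ u v : ℝ × ℝ, IsOpen {y | 0 < σ * signedArea u v y} := fun u v =>
    isOpen_lt continuous_const (continuous_const.mul (continuous_signedArea u v))
  exact (h u v).inter ((h v w).inter (h w u))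

/-- The triangle lies in a closed half-plane bounded by the line through `u` and `v`. An interior
point can still be moved a little in the direction `u - w`, towards that line, so the inequality is
strict. -/
theorem pos_of_mem_interior {σ : ℝ} {u v w y : ℝ × ℝ} (hD : 0 < σ * signedArea u v w)
    (hy : y ∈ interior (convexHull ℝ {u, v, w})) : 0 < σ * signedArea u v y := by
  have hsub : convexHull ℝ {u, v, w} ⊆ {y | 0 ≤ σ * signedArea u v y} := by
    apply convexHull_min
    · rintro z (rfl | rfl | rfl)
      · simp [signedArea_left]
      · simp [signedArea_right]
      · exact hD.le
    · intro a ha b hb s t hs ht hst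
      simp only [Set.mem_ofPred_eq] at *
      rw [signedArea_combo _ _ _ _ hst]
      have := mul_nonneg hs ha
      have := mul_nonneg ht hb
      linarith
  have hc : Filter.Tendsto (fun ε : ℝ => y - ε • (w - u)) (nhds 0) (nhds y) := by
    have : Continuous (fun ε : ℝ => y - ε • (w - u)) := by fun_prop
    simpa using this.tendsto 0
  have hev := hc.eventually (mem_interior_iff_mem_nhds.1 hy)
  obtain ⟨ε, hε, hε0⟩ := ((hev.filter_mono nhdsWithin_le_nhds).and
    (self_mem_nhdsWithin (s := Set.Ioi (0 : ℝ)))).exists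
  have h1 := hsub hε
  have e : signedArea u v (y - ε • (w - u)) = signedArea u v y - ε * signedArea u v w := by
    simp [signedArea]; ring
  simp only [Set.mem_ofPred_eq, e] at h1
  have := mul_pos (Set.mem_Ioi.1 hε0) hD
  nlinarith

theorem interior_convexHull_triangle {σ : ℝ} {u v w : ℝ × ℝ} (hD : 0 < σ * signedArea u v w) :
    interior (convexHull ℝ {u, v, w}) = openTriangle σ u v w := by
  apply Set.Subset.antisymm
  · intro y hy
    have r : ∀ u v w : ℝ × ℝ, ({v, w, u} : Set (ℝ × ℝ)) = {u, v, w} := by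
      intro u v w; ext; simp only [Set.mem_insert_iff, Set.mem_singleton_iff]; tauto
    refine ⟨pos_of_mem_interior hD hy, pos_of_mem_interior (w := u) ?_ ?_,
      pos_of_mem_interior (w := v) ?_ ?_⟩
    · rwa [signedArea_rotate]
    · rwa [r]
    · rwa [signedArea_rotate, signedArea_rotate]
    · rwa [r, r]
  · exact interior_maximal openTriangle_subset_convexHull (isOpen_openTriangle ..)

theorem mem_openTriangle_of_mem_segment {σ : ℝ} {u v w x q : ℝ × ℝ}
    (hx : x ∈ openTriangle σ u v w) (hq : q ∈ segment ℝ x u) :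
    q = u ∨ q ∈ openTriangle σ u v w := by
  obtain ⟨s, t, hs, ht, hst, rfl⟩ := hq
  have hD := pos_of_mem_openTriangle hx
  rcases hs.eq_or_lt with rfl | hs
  · left
    obtain rfl : t = 1 := by linarith
    simp
  · right
    obtain ⟨h1, h2, h3⟩ := hx
    rw [← signedArea_rotate u v w] at hD
    simp only [openTriangle, Set.mem_ofPred_eq, signedArea_combo _ _ _ _ hst, signedArea_left,
      signedArea_right]
    refine ⟨?_, ?_, ?_⟩
    · nlinarith [mul_pos hs h1]
    · nlinarith [mul_pos hs h2, mul_nonneg ht hD.le]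
    · nlinarith [mul_pos hs h3]

theorem signedArea_eq_zero_of_mem_segment {u v q : ℝ × ℝ} (hq : q ∈ segment ℝ u v) :
    signedArea u v q = 0 := by
  obtain ⟨s, t, hs, ht, hst, rfl⟩ := hq
  simp [signedArea_combo _ _ _ _ hst, signedArea_left, signedArea_right]

theorem eq_of_mem_segments {u v w q : ℝ × ℝ} (h : signedArea u v w ≠ 0)
    (h1 : q ∈ segment ℝ u v) (h2 : q ∈ segment ℝ u w) : q = u := by
  have h0 := signedArea_eq_zero_of_mem_segment h1
  obtain ⟨s, t, hs, ht, hst, rfl⟩ := h2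
  rw [signedArea_combo _ _ _ _ hst, signedArea_left, mul_zero, zero_add] at h0
  rcases mul_eq_zero.1 h0 with rfl | h0
  · obtain rfl : s = 1 := by linarith
    simp
  · exact absurd h0 h

/-- The part shares the side `u v` with the whole triangle. For each of the other two sides a
three-term relation between products of signed areas writes the wanted area, times a positive one,
as a sum of positive products. -/
theorem subtriangle_subset {σ : ℝ} {u v w x : ℝ × ℝ} (hx : x ∈ openTriangle σ u v w) :
    openTriangle σ u v x ⊆ openTriangle σ u v w := by
  intro y hy
  obtain ⟨h1, h2, h3⟩ := hx
  obtain ⟨k1, k2, k3⟩ := hy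
  refine ⟨k1, ?_, ?_⟩
  · have e : signedArea u v x * signedArea v w y =
        signedArea u v y * signedArea v w x + signedArea v x y * signedArea u v w := by
      unfold signedArea; ring
    have hD : 0 < σ * signedArea u v w := by rw [← signedArea_split u v w x]; linarith
    have : 0 < (σ * signedArea u v x) * (σ * signedArea v w y) := by
      have : (σ * signedArea u v x) * (σ * signedArea v w y) =
        (σ * signedArea u v y) * (σ * signedArea v w x) +
          (σ * signedArea v x y) * (σ * signedArea u v w) := by
        linear_combination σ ^ 2 * e
      rw [this]; positivity
    exact (pos_iff_pos_of_mul_pos this).1 h1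
  · have e : signedArea u v x * signedArea w u y =
        signedArea u v y * signedArea w u x + signedArea x u y * signedArea u v w := by
      unfold signedArea; ring
    have hD : 0 < σ * signedArea u v w := by rw [← signedArea_split u v w x]; linarith
    have : 0 < (σ * signedArea u v x) * (σ * signedArea w u y) := by
      have : (σ * signedArea u v x) * (σ * signedArea w u y) =
        (σ * signedArea u v y) * (σ * signedArea w u x) +
          (σ * signedArea x u y) * (σ * signedArea u v w) := by
        linear_combination σ ^ 2 * e
      rw [this]; positivity
    exact (pos_iff_pos_of_mul_pos this).1 h1

theorem subtriangle_disjoint_segment {σ : ℝ} {u v w x q : ℝ × ℝ}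
    (hx : x ∈ openTriangle σ u v w) (hq : q ∈ openTriangle σ u v x) :
    q ∉ segment ℝ x u ∧ q ∉ segment ℝ x v ∧ q ∉ segment ℝ x w := by
  obtain ⟨k1, k2, k3⟩ := hq
  refine ⟨fun h => ?_, fun h => ?_, fun h => ?_⟩
  · simp [signedArea_eq_zero_of_mem_segment h] at k3
  · rw [segment_symm] at h
    simp [signedArea_eq_zero_of_mem_segment h] at k2
  · obtain ⟨s, t, hs, ht, hst, rfl⟩ := h
    rw [signedArea_combo _ _ _ _ hst, signedArea_right, signedArea_swap'] at k2
    have := mul_nonneg ht hx.2.1.le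
    nlinarith

theorem subtriangles_disjoint {σ : ℝ} {u v w x : ℝ × ℝ} :
    Disjoint (openTriangle σ u v x) (openTriangle σ v w x) := by
  rw [Set.disjoint_left]
  rintro y ⟨-, h, -⟩ ⟨-, -, h'⟩
  rw [signedArea_swap] at h'
  linarith

theorem mem_segment_of_signedArea_eq_zero {p q r : ℝ × ℝ} (h : signedArea p q r = 0) :
    p ∈ segment ℝ q r ∨ q ∈ segment ℝ p r ∨ r ∈ segment ℝ p q := by
  by_cases hpq : p = q
  · subst hpq; exact Or.inl (left_mem_segment ..)
  obtain ⟨t, rfl⟩ : ∃ t : ℝ, r = t • (q - p) + p := by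
    by_cases h1 : q.1 - p.1 = 0
    · have h2 : q.2 - p.2 ≠ 0 := fun h2 => hpq (Prod.ext (by linarith) (by linarith))
      refine ⟨(r.2 - p.2) / (q.2 - p.2), Prod.ext ?_ ?_⟩
      · simp only [signedArea, h1, zero_mul, zero_sub, neg_eq_zero, mul_eq_zero, h2,
          false_or] at h
        simp [h1]; linarith
      · simp; field_simp; ring
    · refine ⟨(r.1 - p.1) / (q.1 - p.1), Prod.ext ?_ ?_⟩
      · simp; field_simp; ring
      · simp only [signedArea] at h
        simp; field_simp; linarith
  have hc : Collinear ℝ {p, q, t • (q - p) + p} := by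
    rw [collinear_iff_of_mem (p₀ := p) (by simp)]
    refine ⟨q - p, ?_⟩
    rintro z (rfl | rfl | rfl)
    · exact ⟨0, by simp⟩
    · exact ⟨1, by simp⟩
    · exact ⟨t, by simp⟩
  rcases hc.wbtw_or_wbtw_or_wbtw with h | h | h
  · exact Or.inr (Or.inl (mem_segment_iff_wbtw.2 h))
  · exact Or.inr (Or.inr (by rw [segment_symm]; exact mem_segment_iff_wbtw.2 h))
  · exact Or.inl (by rw [segment_symm]; exact mem_segment_iff_wbtw.2 h)

/-- Seen from `x`, only the side `w u` has the wrong sign. If `u v w` itself has sign `σ`, then `x`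
lies beyond that side and `v x` crosses it; if it has the opposite sign, `v` is enclosed by `w`, `u`
and `x`. -/
theorem crossing_or_inside {σ : ℝ} {u v w x : ℝ × ℝ} (h1 : 0 < σ * signedArea u v x)
    (h2 : 0 < σ * signedArea v w x) (h3 : σ * signedArea w u x < 0)
    (hD : signedArea u v w ≠ 0) :
    (∃ q, q ∈ segment ℝ u w ∧ q ∈ segment ℝ v x) ∨
      v ∈ interior (convexHull ℝ {w, u, x}) := by
  have hσ : σ ≠ 0 := fun e => by simp [e] at h1
  have e := signedArea_split u v w x
  rcases lt_or_gt_of_ne (mul_ne_zero hσ hD) with hD' | hD'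
  · right
    rw [interior_convexHull_triangle (σ := -σ) (by linarith)]
    refine ⟨?_, ?_, ?_⟩
    · rw [signedArea_rotate, signedArea_rotate]; linarith
    · rw [signedArea_swap']; linarith
    · rw [signedArea_rotate, signedArea_swap']; linarith
  · left
    set S := σ * signedArea v w x + σ * signedArea u v x
    have hS : 0 < S := by positivity
    -- An affine relation between the four points. Both sides have total weight `S / σ`, so after
    -- division each exhibits the crossing point on one of the two segments.
    have hv : signedArea v w x • u + signedArea u v x • w =
        signedArea u v w • x + (-signedArea w u x) • v := by
      ext <;> simp [signedArea] <;> ring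
    refine ⟨(σ * signedArea v w x / S) • u + (σ * signedArea u v x / S) • w,
      ⟨_, _, by positivity, by positivity, by rw [← add_div, div_self hS.ne'], rfl⟩,
      ⟨(-(σ * signedArea w u x)) / S, (σ * signedArea u v w) / S,
        div_nonneg (by linarith) hS.le, by positivity, ?_, ?_⟩⟩
    · rw [← add_div, div_eq_one_iff_eq hS.ne', ← e]; simp only [S]; ring
    · have := congrArg (fun z => (σ / S) • z) hv
      simp only [smul_add, smul_smul] at this
      rw [add_comm]
      convert this.symm using 3 <;> ring

/-- Relative to `x`, the coordinates of `y` along `v - x` and `u - x` are ratios of areas. The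
second vanishes, the sign at `x u` bounds the first from below by zero, and lying on the right side
of `u v` bounds it from above by one. -/
theorem mem_segment_of_boundary {τ : ℝ} {u v x y : ℝ × ℝ} (h1 : 0 < τ * signedArea u v x)
    (hy : 0 < τ * signedArea u v y) (e1 : 0 < τ * signedArea x u y)
    (e2 : signedArea x v y = 0) : y ∈ segment ℝ x v := by
  have hv : signedArea u v x • (y - x) = signedArea x u y • (v - x) := by
    have : signedArea u v x • (y - x) = signedArea x u y • (v - x) - signedArea x v y • (u - x) := by
      ext <;> simp [signedArea] <;> ring
    rw [this, e2]; simp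
  have hτ : τ ≠ 0 := fun e => by simp [e] at h1
  have h0 : signedArea u v x ≠ 0 := fun e => by simp [e] at h1
  set s := τ * signedArea x u y / (τ * signedArea u v x)
  have hs : 0 ≤ s := by positivity
  have hyx : y = (1 - s) • x + s • v := by
    have : y - x = s • (v - x) := by
      have h2 := congrArg (fun z => (signedArea u v x)⁻¹ • z) hv
      simp only [smul_smul, inv_mul_cancel₀ h0, one_smul] at h2
      rw [h2]; congr 1
      simp only [s]; rw [mul_div_mul_left _ _ hτ]; ring
    rw [sub_eq_iff_eq_add] at this
    rw [this]; module
  have hs1 : s ≤ 1 := by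
    rw [hyx, signedArea_combo _ _ _ _ (by ring), signedArea_right] at hy
    by_contra hs1
    have : (1 - s) * (τ * signedArea u v x) < 0 := mul_neg_of_neg_of_pos (by linarith) h1
    nlinarith
  exact ⟨1 - s, s, by linarith, hs, by ring, hyx.symm⟩

/-- A point of an open triangle lies in one of the three parts or on one of the three segments
from `x` to the corners. -/
theorem openTriangle_cover {τ : ℝ} {u v w x y : ℝ × ℝ} (hx : x ∈ openTriangle τ u v w)
    (hy : y ∈ openTriangle τ u v w) :
    (y ∈ openTriangle τ u v x ∨ y ∈ openTriangle τ v w x ∨ y ∈ openTriangle τ w u x) ∨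
      (y ∈ segment ℝ x u ∨ y ∈ segment ℝ x v ∨ y ∈ segment ℝ x w) := by
  obtain ⟨h1, h2, h3⟩ := hx
  obtain ⟨k1, k2, k3⟩ := hy
  have s1 : signedArea v x y = -signedArea x v y := signedArea_swap ..
  have s2 : signedArea w x y = -signedArea x w y := signedArea_swap ..
  have s3 : signedArea u x y = -signedArea x u y := signedArea_swap ..
  -- A positive combination of the three areas at `x` vanishes, so their signs can be neither all
  -- positive nor all negative. The remaining sign patterns tell in which part, or on which segment,
  -- `y` lies.
  have rel : (τ * signedArea v w x) * (τ * signedArea x u y) +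
      (τ * signedArea w u x) * (τ * signedArea x v y) +
      (τ * signedArea u v x) * (τ * signedArea x w y) = 0 := by
    unfold signedArea; ring
  have hτ : τ ≠ 0 := fun e => by simp [e] at h1
  simp only [openTriangle, Set.mem_ofPred_eq, s1, s2, s3, mul_neg, k1, k2, k3, true_and,
    Left.neg_pos_iff]
  have z : ∀ d, τ * d = 0 → d = 0 := fun d h => (mul_eq_zero.1 h).resolve_left hτ
  set e1 := τ * signedArea x u y with he1
  set e2 := τ * signedArea x v y with he2
  set e3 := τ * signedArea x w y with he3
  rcases lt_trichotomy e1 0 with c1 | c1 | c1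
  · by_cases c3 : 0 < e3
    · tauto
    · have c2 : 0 < e2 := by
        by_contra c2
        nlinarith [mul_pos h2 (neg_pos.2 c1), mul_nonneg h3.le (neg_nonneg.2 (not_lt.1 c2)),
          mul_nonneg h1.le (neg_nonneg.2 (not_lt.1 c3))]
      rcases (not_lt.1 c3).lt_or_eq with c3 | c3
      · tauto
      · exact Or.inr (Or.inr (Or.inr (mem_segment_of_boundary h2 k2 c2 (z _ c3))))
  · rcases lt_trichotomy e2 0 with c2 | c2 | c2
    · have c3 : 0 < e3 := by
        by_contra c3
        nlinarith [mul_pos h3 (neg_pos.2 c2), mul_nonneg h1.le (neg_nonneg.2 (not_lt.1 c3))]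
      exact Or.inr (Or.inl (mem_segment_of_boundary h3 k3 c3 (z _ c1)))
    · have z1 := z _ c1
      have z2 := z _ c2
      have : signedArea u v x • (y - x) = 0 := by
        have : signedArea u v x • (y - x) =
            signedArea x u y • (v - x) - signedArea x v y • (u - x) := by
          ext <;> simp [signedArea] <;> ring
        rw [this, z1, z2]; simp
      have h0 : signedArea u v x ≠ 0 := fun e => by simp [e] at h1
      have := (smul_eq_zero.1 this).resolve_left h0
      rw [sub_eq_zero.1 this]
      exact Or.inr (Or.inl (left_mem_segment ..))
    · have c3 : e3 < 0 := by
        by_contra c3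
        nlinarith [mul_pos h3 c2, mul_nonneg h1.le (not_lt.1 c3)]
      tauto
  · rcases lt_trichotomy e2 0 with c2 | c2 | c2
    · tauto
    · exact Or.inr (Or.inr (Or.inl (mem_segment_of_boundary h1 k1 c1 (z _ c2))))
    · have c3 : e3 < 0 := by
        by_contra c3
        nlinarith [mul_pos h2 c1, mul_pos h3 c2, mul_nonneg h1.le (not_lt.1 c3)]
      tauto

end Plane

/-! ## Drawings of stacked triangulations -/

section Drawing

variable {V : Type} {a b c : V} {A : Set V} {F : V → V → V → Prop} {pos : V → ℝ × ℝ}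

/-- All faces are drawn with orientation `σ`. -/
def IsOriented (σ : ℝ) (F : V → V → V → Prop) (pos : V → ℝ × ℝ) : Prop :=
  ∀ p q r, F p q r → 0 < σ * signedArea (pos p) (pos q) (pos r)

/-- The points covered by the drawing of the triangulation. -/
def faceDrawing (A : Set V) (F : V → V → V → Prop) (pos : V → ℝ × ℝ) : Set (ℝ × ℝ) :=
  pos '' A ∪ {q | ∃ u v, FaceAdj F u v ∧ q ∈ segment ℝ (pos u) (pos v)}

/-- A crossing-free drawing of the edges of the faces `F`. -/
structure IsFaceDrawing (A : Set V) (F : V → V → V → Prop) (pos : V → ℝ × ℝ) : Prop where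
  vertex_edge : ∀ u v w, FaceAdj F u v → w ∈ A → w ≠ u → w ≠ v →
    pos w ∉ segment ℝ (pos u) (pos v)
  edge_edge : ∀ u v x y, FaceAdj F u v → FaceAdj F x y → s(u, v) ≠ s(x, y) →
    ∀ q, q ∈ segment ℝ (pos u) (pos v) → q ∈ segment ℝ (pos x) (pos y) →
      ∃ w, w ∈ s(u, v) ∧ w ∈ s(x, y) ∧ q = pos w

theorem IsOriented.of_subdivide {σ : ℝ} {u v w x : V}
    (h : IsOriented σ (subdivide F u v w x) pos) :
    pos x ∈ openTriangle σ (pos u) (pos v) (pos w) :=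
  ⟨h _ _ _ (Or.inr (Or.inl (.refl ..))), h _ _ _ (Or.inr (Or.inr (Or.inl (.refl ..)))),
    h _ _ _ (Or.inr (Or.inr (Or.inr (.refl ..))))⟩

theorem signedArea_of_rotation {u v w p q r : V} (h : IsRotationOf u v w p q r) :
    signedArea (pos p) (pos q) (pos r) = signedArea (pos u) (pos v) (pos w) := by
  rcases h with ⟨rfl, rfl, rfl⟩ | ⟨rfl, rfl, rfl⟩ | ⟨rfl, rfl, rfl⟩
  · rfl
  · exact signedArea_rotate ..
  · rw [signedArea_rotate, signedArea_rotate]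

theorem openTriangle_of_rotation {σ : ℝ} {u v w p q r : V} (h : IsRotationOf u v w p q r) :
    openTriangle σ (pos p) (pos q) (pos r) = openTriangle σ (pos u) (pos v) (pos w) := by
  rcases h with ⟨rfl, rfl, rfl⟩ | ⟨rfl, rfl, rfl⟩ | ⟨rfl, rfl, rfl⟩
  · rfl
  · exact openTriangle_rotate ..
  · rw [openTriangle_rotate, openTriangle_rotate]

/-- Orientation in terms of the coarser triangulation and the position of the new vertex. -/
theorem isOriented_subdivide_iff {σ : ℝ} {u v w x : V} :
    IsOriented σ (subdivide F u v w x) pos ↔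
      IsOriented σ F pos ∧ pos x ∈ openTriangle σ (pos u) (pos v) (pos w) := by
  constructor
  · intro h
    refine ⟨fun p q r hp => ?_, h.of_subdivide⟩
    by_cases hr : IsRotationOf u v w p q r
    · rw [signedArea_of_rotation hr]
      exact pos_of_mem_openTriangle h.of_subdivide
    · exact h p q r (Or.inl ⟨hp, hr⟩)
  · rintro ⟨h, h1, h2, h3⟩ p q r (hp | hp | hp | hp)
    · exact h _ _ _ hp.1
    · rwa [signedArea_of_rotation hp]
    · rwa [signedArea_of_rotation hp]
    · rwa [signedArea_of_rotation hp]

/-- Every inserted vertex lies in the hull of three earlier ones. -/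
theorem IsOriented.mem_convexHull {σ : ℝ} (hab : a ≠ b) (hbc : b ≠ c) (hca : c ≠ a)
    (h : StackedDisc a b c A F)
    (ho : IsOriented σ F pos) {v : V} (hv : v ∈ A) :
    pos v ∈ convexHull ℝ {pos a, pos b, pos c} := by
  unfold StackedDisc at h
  induction h generalizing v with
  | base =>
    apply subset_convexHull
    rcases hv with rfl | rfl | rfl <;> simp
  | @step A F x p q r hs hx hf ih =>
    rw [isOriented_subdivide_iff] at ho
    rcases hv with rfl | hv
    · refine convexHull_min ?_ (convex_convexHull ..) (openTriangle_subset_convexHull ho.2)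
      have fs := Stacked.isFaceSystem (.base hab hbc hca) hs
      rintro z (rfl | rfl | rfl)
      · exact ih ho.1 (fs.mem _ _ _ hf)
      · exact ih ho.1 (fs.mem₂ hf)
      · exact ih ho.1 (fs.mem₃ hf)
    · exact ih ho.1 hv

/-- The full conclusion about oriented drawings, in the form used for induction. -/
structure IsOrientedDrawing (σ : ℝ) (A : Set V) (F : V → V → V → Prop) (pos : V → ℝ × ℝ) : Prop
    extends IsFaceDrawing A F pos where
  injOn : Set.InjOn pos A
  inner : ∀ u v w, F u v w →
    Disjoint (openTriangle σ (pos u) (pos v) (pos w)) (faceDrawing A F pos)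
  disjoint : ∀ u v w p q r, F u v w → F p q r → ¬ IsRotationOf u v w p q r →
    Disjoint (openTriangle σ (pos u) (pos v) (pos w)) (openTriangle σ (pos p) (pos q) (pos r))

/-- Edges with a common end vertex. -/
theorem edge_edge_of_common {B : Set V}
    (hB : ∀ p ∈ B, ∀ q ∈ B, ∀ r ∈ B, p ≠ q → q ≠ r → r ≠ p →
      signedArea (pos p) (pos q) (pos r) ≠ 0)
    {u v x y : V} (hu : u ∈ B) (hv : v ∈ B) (hx : x ∈ B) (hy : y ∈ B)
    (huv : u ≠ v) (hxy : x ≠ y) (hc : u = x ∨ u = y ∨ v = x ∨ v = y) (hne : s(u, v) ≠ s(x, y))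
    {q : ℝ × ℝ} (h1 : q ∈ segment ℝ (pos u) (pos v)) (h2 : q ∈ segment ℝ (pos x) (pos y)) :
    ∃ w, w ∈ s(u, v) ∧ w ∈ s(x, y) ∧ q = pos w := by
  rcases hc with rfl | rfl | rfl | rfl
  · have : v ≠ y := by rintro rfl; exact hne rfl
    exact ⟨u, by simp, by simp, eq_of_mem_segments (hB _ hu _ hv _ hy huv this hxy.symm) h1 h2⟩
  · have : v ≠ x := by rintro rfl; exact hne Sym2.eq_swap
    rw [segment_symm] at h2
    exact ⟨u, by simp, by simp, eq_of_mem_segments (hB _ hu _ hv _ hx huv this hxy) h1 h2⟩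
  · have : u ≠ y := by rintro rfl; exact hne Sym2.eq_swap
    rw [segment_symm] at h1
    exact ⟨v, by simp, by simp, eq_of_mem_segments (hB _ hv _ hu _ hy huv.symm this hxy.symm) h1 h2⟩
  · have : u ≠ x := by rintro rfl; exact hne rfl
    rw [segment_symm] at h1 h2
    exact ⟨v, by simp, by simp, eq_of_mem_segments (hB _ hv _ hu _ hx huv.symm this hxy) h1 h2⟩

theorem signedArea_ne_zero_of_mem {p q r u v w : V}
    (h : signedArea (pos u) (pos v) (pos w) ≠ 0) (hp : p ∈ ({u, v, w} : Set V))
    (hq : q ∈ ({u, v, w} : Set V)) (hr : r ∈ ({u, v, w} : Set V))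
    (n1 : p ≠ q) (n2 : q ≠ r) (n3 : r ≠ p) : signedArea (pos p) (pos q) (pos r) ≠ 0 := by
  have e1 := signedArea_rotate (pos u) (pos v) (pos w)
  have e2 := signedArea_rotate (pos v) (pos w) (pos u)
  have e3 := signedArea_swap (pos u) (pos v) (pos w)
  have e4 := signedArea_swap (pos v) (pos w) (pos u)
  have e5 := signedArea_swap (pos w) (pos u) (pos v)
  simp only [Set.mem_insert_iff, Set.mem_singleton_iff] at hp hq hr
  intro h0
  apply h
  rcases hp with rfl | rfl | rfl <;> rcases hq with rfl | rfl | rfl <;>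
    rcases hr with rfl | rfl | rfl <;> first | contradiction | linarith

theorem FaceAdj.ne (fs : IsFaceSystem A F) {p q : V} (h : FaceAdj F p q) : p ≠ q := by
  obtain ⟨s, hs | hs⟩ := h
  · exact fs.ne _ _ _ hs
  · exact (fs.ne _ _ _ hs).symm

theorem isOrientedDrawing_base {σ : ℝ} (hab : a ≠ b) (hbc : b ≠ c) (hca : c ≠ a)
    (ho : 0 < σ * signedArea (pos b) (pos a) (pos c)) :
    IsOrientedDrawing σ {a, b, c} (IsRotationOf b a c) pos := by
  have fs := IsFaceSystem.base hab hbc hca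
  have hD : signedArea (pos a) (pos b) (pos c) ≠ 0 := fun e => by
    rw [signedArea_swap, e] at ho; simp at ho
  have hB : ∀ p ∈ ({a, b, c} : Set V), ∀ q ∈ ({a, b, c} : Set V), ∀ r ∈ ({a, b, c} : Set V),
      p ≠ q → q ≠ r → r ≠ p → signedArea (pos p) (pos q) (pos r) ≠ 0 :=
    fun p hp q hq r hr => signedArea_ne_zero_of_mem hD hp hq hr
  refine ⟨⟨?_, ?_⟩, ?_, ?_, ?_⟩
  · intro u v w h hw hu hv hseg
    exact hB u (h.symm.mem fs) v (h.mem fs) w hw (h.ne fs) hv.symm hu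
      (signedArea_eq_zero_of_mem_segment hseg)
  · intro u v x y h h' hne q h1 h2
    have m1 := h.symm.mem fs
    have m2 := h.mem fs
    have m3 := h'.symm.mem fs
    have m4 := h'.mem fs
    refine edge_edge_of_common hB m1 m2 m3 m4 (h.ne fs) (h'.ne fs) ?_ hne h1 h2
    have n1 := h.ne fs
    have n2 := h'.ne fs
    simp only [Set.mem_insert_iff, Set.mem_singleton_iff] at m1 m2 m3 m4
    grind
  · intro p hp q hq e
    by_contra hpq
    have : ∃ r ∈ ({a, b, c} : Set V), q ≠ r ∧ r ≠ p := by
      by_contra! hall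
      have h1 := hall a (by simp)
      have h2 := hall b (by simp)
      have h3 := hall c (by simp)
      simp only [Set.mem_insert_iff, Set.mem_singleton_iff] at hp hq
      grind
    obtain ⟨r, hr, h1, h2⟩ := this
    apply hB p hp q hq r hr hpq h1 h2
    rw [e]; simp [signedArea]
  · intro u v w hf
    rw [openTriangle_of_rotation hf, Set.disjoint_left]
    rintro y ⟨y1, y2, y3⟩ (⟨z, hz, rfl⟩ | ⟨p, q, hpq, hy⟩)
    · rcases hz with rfl | rfl | rfl
      · simp [signedArea_right] at y1
      · simp [signedArea_left] at y1
      · simp [signedArea_right] at y2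
    · have e := signedArea_eq_zero_of_mem_segment hy
      have m1 := hpq.symm.mem fs
      have m2 := hpq.mem fs
      have m3 := hpq.ne fs
      have e' : signedArea (pos q) (pos p) y = 0 := by rw [signedArea_swap, e, neg_zero]
      simp only [Set.mem_insert_iff, Set.mem_singleton_iff] at m1 m2
      rcases m1 with rfl | rfl | rfl <;> rcases m2 with rfl | rfl | rfl <;>
        first
        | exact absurd rfl m3
        | (simp [e] at y1)
        | (simp [e'] at y1)
        | (simp [e] at y2)
        | (simp [e'] at y2)
        | (simp [e] at y3)
        | (simp [e'] at y3)
  · intro u v w p q r h1 h2 h3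
    exact absurd (h1.eq ▸ h2) h3

end Drawing

/-! ### Equivalence of correct drawings and uniform orientation -/

section Drawing

variable {V : Type} {a b c : V} {A : Set V} {F : V → V → V → Prop} {pos : V → ℝ × ℝ}

theorem FaceAdj.subdivide_cases (fs : IsFaceSystem A F) {u v w x p q : V} (hx : x ∉ A)
    (hf : F u v w) (h : FaceAdj (subdivide F u v w x) p q) :
    FaceAdj F p q ∨ (x = p ∧ q ∈ ({u, v, w} : Set V)) ∨ (x = q ∧ p ∈ ({u, v, w} : Set V)) := by
  by_cases hp : p = x
  · subst hp
    exact Or.inr (Or.inl ⟨rfl, (faceAdj_subdivide_self_iff fs hx hf q).1 h⟩)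
  by_cases hq : q = x
  · subst hq
    exact Or.inr (Or.inr ⟨rfl, (faceAdj_subdivide_self_iff fs hx hf p).1 h.symm⟩)
  exact Or.inl ((faceAdj_subdivide_iff fs hf hp hq).1 h)

theorem FaceAdj.subdivide {u v w x p q : V} (h : FaceAdj F p q) :
    FaceAdj (subdivide F u v w x) p q := by
  obtain ⟨r, h | h⟩ := h
  · exact (exists_subdivide_of_face h).imp fun _ => Or.inl
  · exact (exists_subdivide_of_face h).imp fun _ => Or.inr

theorem FaceAdj.of_mem_face (fs : IsFaceSystem A F) {u v w y : V} (hf : F u v w)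
    (hy : y ∈ ({u, v, w} : Set V)) : y ∈ A := by
  rcases hy with rfl | rfl | rfl
  · exact fs.mem _ _ _ hf
  · exact fs.mem₂ hf
  · exact fs.mem₃ hf

theorem mem_openTriangle_of_mem_segment' {σ : ℝ} {u v w x y : V} {q : ℝ × ℝ}
    (hT : pos x ∈ openTriangle σ (pos u) (pos v) (pos w)) (hy : y ∈ ({u, v, w} : Set V))
    (hq : q ∈ segment ℝ (pos x) (pos y)) :
    q = pos y ∨ q ∈ openTriangle σ (pos u) (pos v) (pos w) := by
  rcases hy with rfl | rfl | rfl
  · exact mem_openTriangle_of_mem_segment hT hq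
  · rw [← openTriangle_rotate] at hT ⊢
    exact mem_openTriangle_of_mem_segment hT hq
  · rw [← openTriangle_rotate, ← openTriangle_rotate] at hT ⊢
    exact mem_openTriangle_of_mem_segment hT hq

/-- Apart from its old end, each of the three new segments stays in the open triangle, which the old
drawing avoids. Two new segments meet only at `x` because they span a nonzero area there. -/
theorem isFaceDrawing_subdivide {σ : ℝ} (fs : IsFaceSystem A F) {u v w x : V} (hx : x ∉ A)
    (hf : F u v w) (hT : pos x ∈ openTriangle σ (pos u) (pos v) (pos w))
    (h : IsFaceDrawing A F pos) (hinj : Set.InjOn pos A)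
    (hdis : ∀ y ∈ openTriangle σ (pos u) (pos v) (pos w), y ∉ faceDrawing A F pos) :
    IsFaceDrawing (insert x A) (subdivide F u v w x) pos := by
  have new_seg : ∀ y ∈ ({u, v, w} : Set V), ∀ q ∈ segment ℝ (pos x) (pos y),
      q = pos y ∨ q ∈ openTriangle σ (pos u) (pos v) (pos w) :=
    fun y hy q hq => mem_openTriangle_of_mem_segment' hT hy hq
  have hmem : ∀ y ∈ ({u, v, w} : Set V), y ∈ A := fun y hy => FaceAdj.of_mem_face fs hf hy
  have new_vertex : ∀ y ∈ ({u, v, w} : Set V), ∀ z ∈ A, z ≠ y →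
      pos z ∉ segment ℝ (pos x) (pos y) := by
    intro y hy z hz hzy hq
    rcases new_seg y hy _ hq with e | e
    · exact hzy (hinj hz (hmem y hy) e)
    · exact hdis _ e (Or.inl ⟨z, hz, rfl⟩)
  have new_old : ∀ y ∈ ({u, v, w} : Set V), ∀ p r, FaceAdj F p r →
      ∀ q ∈ segment ℝ (pos x) (pos y), q ∈ segment ℝ (pos p) (pos r) →
        (y = p ∨ y = r) ∧ q = pos y := by
    intro y hy p r hpr q hq hq'
    rcases new_seg y hy _ hq with e | e
    · refine ⟨?_, e⟩
      by_contra hn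
      rw [not_or] at hn
      exact h.vertex_edge p r y hpr (hmem y hy) hn.1 hn.2 (e ▸ hq')
    · exact absurd (Or.inr ⟨p, r, hpr, hq'⟩) (hdis _ e)
  have new_new : ∀ y ∈ ({u, v, w} : Set V), ∀ z ∈ ({u, v, w} : Set V), y ≠ z →
      signedArea (pos x) (pos y) (pos z) ≠ 0 := by
    obtain ⟨h1, h2, h3⟩ := hT
    have r1 := signedArea_rotate (pos x) (pos u) (pos v)
    have r2 := signedArea_rotate (pos x) (pos v) (pos w)
    have r3 := signedArea_rotate (pos x) (pos w) (pos u)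
    rw [r1] at h1
    rw [r2] at h2
    rw [r3] at h3
    have s1 := signedArea_swap' (pos x) (pos u) (pos v)
    have s2 := signedArea_swap' (pos x) (pos v) (pos w)
    have s3 := signedArea_swap' (pos x) (pos w) (pos u)
    have nz : ∀ d : ℝ, 0 < σ * d → d ≠ 0 := fun d hd e => by simp [e] at hd
    have h1 := nz _ h1
    have h2 := nz _ h2
    have h3 := nz _ h3
    rintro y (rfl | rfl | rfl) z (rfl | rfl | rfl) hyz <;>
      first
      | contradiction
      | assumption
      | (rw [s1]; exact neg_ne_zero.2 h1)
      | (rw [s2]; exact neg_ne_zero.2 h2)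
      | (rw [s3]; exact neg_ne_zero.2 h3)
  constructor
  · intro p q z hpq hz hp hq hseg
    rcases hpq.subdivide_cases fs hx hf with k | ⟨rfl, k⟩ | ⟨rfl, k⟩
    · rcases hz with rfl | hz
      · exact hdis _ hT (Or.inr ⟨p, q, k, hseg⟩)
      · exact h.vertex_edge p q z k hz hp hq hseg
    · exact new_vertex q k z (hz.resolve_left hp) hq hseg
    · rw [segment_symm] at hseg
      exact new_vertex p k z (hz.resolve_left hq) hp hseg
  · intro p q y z h1 h2 hn s hs1 hs2
    rcases h1.subdivide_cases fs hx hf with k1 | ⟨rfl, k1⟩ | ⟨rfl, k1⟩ <;>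
      rcases h2.subdivide_cases fs hx hf with k2 | ⟨rfl, k2⟩ | ⟨rfl, k2⟩
    · exact h.edge_edge p q y z k1 k2 hn s hs1 hs2
    · obtain ⟨e, rfl⟩ := new_old z k2 p q k1 s hs2 hs1
      exact ⟨z, by simpa using e, by simp, rfl⟩
    · rw [segment_symm] at hs2
      obtain ⟨e, rfl⟩ := new_old y k2 p q k1 s hs2 hs1
      exact ⟨y, by simpa using e, by simp, rfl⟩
    · obtain ⟨e, rfl⟩ := new_old q k1 y z k2 s hs1 hs2
      exact ⟨q, by simp, by simpa using e, rfl⟩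
    · have : q ≠ z := by rintro rfl; exact hn rfl
      exact ⟨x, by simp, by simp, eq_of_mem_segments (new_new q k1 z k2 this) hs1 hs2⟩
    · have : q ≠ y := by rintro rfl; exact hn Sym2.eq_swap
      rw [segment_symm] at hs2
      exact ⟨x, by simp, by simp, eq_of_mem_segments (new_new q k1 y k2 this) hs1 hs2⟩
    · rw [segment_symm] at hs1
      obtain ⟨e, rfl⟩ := new_old p k1 y z k2 s hs1 hs2
      exact ⟨p, by simp, by simpa using e, rfl⟩
    · have : p ≠ z := by rintro rfl; exact hn Sym2.eq_swap
      rw [segment_symm] at hs1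
      exact ⟨x, by simp, by simp, eq_of_mem_segments (new_new p k1 z k2 this) hs1 hs2⟩
    · have : p ≠ y := by rintro rfl; exact hn rfl
      rw [segment_symm] at hs1 hs2
      exact ⟨x, by simp, by simp, eq_of_mem_segments (new_new p k1 y k2 this) hs1 hs2⟩

/-- Treats the part opposite `w`; the other two parts follow by rotating the face. -/
theorem subtriangle_inner {σ : ℝ} (fs : IsFaceSystem A F) {u v w x : V} (hx : x ∉ A)
    (hf : F u v w) (hT : pos x ∈ openTriangle σ (pos u) (pos v) (pos w))
    (hdis : ∀ y ∈ openTriangle σ (pos u) (pos v) (pos w), y ∉ faceDrawing A F pos)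
    {y : ℝ × ℝ} (hy : y ∈ openTriangle σ (pos u) (pos v) (pos x)) :
    y ∉ faceDrawing (insert x A) (subdivide F u v w x) pos := by
  have hyT := subtriangle_subset hT hy
  obtain ⟨k1, k2, k3⟩ := subtriangle_disjoint_segment hT hy
  have k : ∀ z ∈ ({u, v, w} : Set V), y ∉ segment ℝ (pos x) (pos z) := by
    rintro z (rfl | rfl | rfl) <;> assumption
  rintro (⟨z, hz | hz, rfl⟩ | ⟨p, q, hpq, hseg⟩)
  · subst hz
    exact k1 (left_mem_segment ..)
  · exact hdis _ hyT (Or.inl ⟨z, hz, rfl⟩)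
  · rcases hpq.subdivide_cases fs hx hf with hpq | ⟨rfl, hz⟩ | ⟨rfl, hz⟩
    · exact hdis _ hyT (Or.inr ⟨p, q, hpq, hseg⟩)
    · exact k q hz hseg
    · rw [segment_symm] at hseg
      exact k p hz hseg

/-- Disjointness of the open faces belongs to the induction: it is what keeps the new edges out of
the faces that are not being split. -/
theorem IsOrientedDrawing.subdivide {σ : ℝ} (h : IsOrientedDrawing σ A F pos)
    (fs : IsFaceSystem A F) {u v w x : V} (hx : x ∉ A) (hf : F u v w)
    (hT : pos x ∈ openTriangle σ (pos u) (pos v) (pos w)) :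
    IsOrientedDrawing σ (insert x A) (subdivide F u v w x) pos := by
  have hdis : ∀ y ∈ openTriangle σ (pos u) (pos v) (pos w), y ∉ faceDrawing A F pos :=
    fun y hy => Set.disjoint_left.1 (h.inner u v w hf) hy
  have hT2 := hT
  rw [← openTriangle_rotate] at hT2
  have hT3 := hT2
  rw [← openTriangle_rotate] at hT3
  have hf2 := fs.rotate _ _ _ hf
  have hf3 := fs.rotate _ _ _ hf2
  have sub1 := subtriangle_subset hT
  have sub2 := subtriangle_subset hT2
  have sub3 := subtriangle_subset hT3
  rw [openTriangle_rotate σ (pos u)] at sub2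
  rw [openTriangle_rotate σ (pos v), openTriangle_rotate σ (pos u)] at sub3
  -- every new open triangle lies in the old one
  have hsub : ∀ p q r, (IsRotationOf u v x p q r ∨ IsRotationOf v w x p q r ∨
      IsRotationOf w u x p q r) → openTriangle σ (pos p) (pos q) (pos r) ⊆
      openTriangle σ (pos u) (pos v) (pos w) := by
    rintro p q r (h | h | h) <;> rw [openTriangle_of_rotation h] <;> assumption
  refine ⟨isFaceDrawing_subdivide fs hx hf hT h.toIsFaceDrawing h.injOn hdis, ?_, ?_, ?_⟩
  · refine (Set.injOn_insert hx).2 ⟨h.injOn, ?_⟩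
    intro hm
    exact hdis _ hT (Or.inl hm)
  · intro p q r hp
    rw [Set.disjoint_left]
    intro y hy
    rcases hp with ⟨hp, hr⟩ | hp | hp | hp
    · have hyT : y ∉ openTriangle σ (pos u) (pos v) (pos w) :=
        Set.disjoint_right.1 (h.disjoint u v w p q r hf hp hr) hy
      have hyD : y ∉ faceDrawing A F pos := Set.disjoint_left.1 (h.inner p q r hp) hy
      have key : ∀ z ∈ ({u, v, w} : Set V), y ∉ segment ℝ (pos x) (pos z) := by
        intro z hz hq
        rcases mem_openTriangle_of_mem_segment' hT hz hq with e | e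
        · exact hyD (Or.inl ⟨z, FaceAdj.of_mem_face fs hf hz, e.symm⟩)
        · exact hyT e
      rintro (⟨z, hz | hz, rfl⟩ | ⟨s, t, hst, hseg⟩)
      · subst hz; exact hyT hT
      · exact hyD (Or.inl ⟨z, hz, rfl⟩)
      · rcases hst.subdivide_cases fs hx hf with hst | ⟨rfl, hz⟩ | ⟨rfl, hz⟩
        · exact hyD (Or.inr ⟨s, t, hst, hseg⟩)
        · exact key t hz hseg
        · rw [segment_symm] at hseg
          exact key s hz hseg
    · rw [openTriangle_of_rotation hp] at hy
      exact subtriangle_inner fs hx hf hT hdis hy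
    · rw [openTriangle_of_rotation hp] at hy
      have := subtriangle_inner fs hx hf2 hT2
        (by rw [openTriangle_rotate]; exact hdis) hy
      rwa [subdivide_rotate] at this
    · rw [openTriangle_of_rotation hp] at hy
      have := subtriangle_inner fs hx hf3 hT3
        (by rw [openTriangle_rotate, openTriangle_rotate]; exact hdis) hy
      rwa [subdivide_rotate, subdivide_rotate] at this
  · intro p q r p' q' r' h1 h2 hn
    have same : ∀ s t y, IsRotationOf s t y p q r → IsRotationOf s t y p' q' r' → False :=
      fun s t y h h' => hn (h.eq ▸ h')
    rcases h1 with ⟨h1, n1⟩ | h1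
    · rcases h2 with ⟨h2, n2⟩ | h2
      · exact h.disjoint _ _ _ _ _ _ h1 h2 hn
      · exact (h.disjoint _ _ _ _ _ _ hf h1 n1).symm.mono_right (hsub _ _ _ h2)
    · rcases h2 with ⟨h2, n2⟩ | h2
      · exact (h.disjoint _ _ _ _ _ _ hf h2 n2).mono_left (hsub _ _ _ h1)
      · rcases h1 with h1 | h1 | h1 <;> rcases h2 with h2 | h2 | h2 <;>
          first
          | exact (same _ _ _ h1 h2).elim
          | (rw [openTriangle_of_rotation h1, openTriangle_of_rotation h2]
             first
             | exact subtriangles_disjoint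
             | exact subtriangles_disjoint.symm)

theorem StackedDisc.isOrientedDrawing {σ : ℝ} (hab : a ≠ b) (hbc : b ≠ c) (hca : c ≠ a)
    (h : StackedDisc a b c A F) (ho : IsOriented σ F pos) : IsOrientedDrawing σ A F pos := by
  unfold StackedDisc at h
  induction h with
  | base => exact isOrientedDrawing_base hab hbc hca (ho _ _ _ (.refl ..))
  | step x u v w hs hx hf ih =>
    rw [isOriented_subdivide_iff] at ho
    exact (ih ho.1).subdivide (Stacked.isFaceSystem (.base hab hbc hca) hs) hx hf ho.2

/-- Crossing-free drawings in which the inner faces are empty triangles. -/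
structure IsEmptyFaceDrawing (A : Set V) (F : V → V → V → Prop) (pos : V → ℝ × ℝ) : Prop
    extends IsFaceDrawing A F pos where
  inner : ∀ u v w, F u v w →
    Disjoint (interior (convexHull ℝ {pos u, pos v, pos w})) (faceDrawing A F pos)

/-- Collinear positions would put one of three mutually adjacent vertices on the edge between the
other two. -/
theorem IsFaceDrawing.signedArea_ne_zero (h : IsFaceDrawing A F pos) (fs : IsFaceSystem A F)
    {u v w : V} (huv : FaceAdj F u v) (hvw : FaceAdj F v w) (hwu : FaceAdj F w u) :
    signedArea (pos u) (pos v) (pos w) ≠ 0 := by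
  intro h0
  rcases mem_segment_of_signedArea_eq_zero h0 with h1 | h1 | h1
  · exact h.vertex_edge v w u hvw (hwu.mem fs) (huv.ne fs) (hwu.ne fs).symm h1
  · exact h.vertex_edge u w v hwu.symm (huv.mem fs) (huv.ne fs).symm (hvw.ne fs) h1
  · exact h.vertex_edge u v w huv (hvw.mem fs) (hwu.ne fs) (hvw.ne fs).symm h1

/-- Both outcomes of `crossing_or_inside` are forbidden: the edges `u w` and `v x` have no common
end, and the face `(w, u, x)` has to be empty. -/
theorem IsEmptyFaceDrawing.false_of_signs (h : IsEmptyFaceDrawing A F pos)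
    (fs : IsFaceSystem A F) {σ : ℝ} {u v w x : V} (huv : FaceAdj F u v) (hvw : FaceAdj F v w)
    (hwu : FaceAdj F w u) (hxv : FaceAdj F x v) (hux : u ≠ x) (hwx : w ≠ x)
    (hface : F w u x)
    (h1 : 0 < σ * signedArea (pos u) (pos v) (pos x))
    (h2 : 0 < σ * signedArea (pos v) (pos w) (pos x))
    (h3 : σ * signedArea (pos w) (pos u) (pos x) < 0) : False := by
  have hD := h.signedArea_ne_zero fs huv hvw hwu
  have n1 := huv.ne fs
  have n2 := hvw.ne fs
  rcases crossing_or_inside h1 h2 h3 hD with ⟨q, hq1, hq2⟩ | hv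
  · obtain ⟨z, hz1, hz2, -⟩ := h.edge_edge u w v x hwu.symm hxv.symm (by
      intro e
      rw [Sym2.eq_iff] at e
      rcases e with ⟨e, -⟩ | ⟨e, -⟩
      · exact n1 e
      · exact hux e) q hq1 hq2
    simp only [Sym2.mem_iff] at hz1 hz2
    grind
  · exact Set.disjoint_left.1 (h.inner w u x hface) hv (Or.inl ⟨v, huv.mem fs, rfl⟩)

/-- There are eight sign patterns for the three areas at `x`. In each of the six mixed ones a single
sign deviates, and `IsEmptyFaceDrawing.false_of_signs` excludes it after a rotation and for one
choice of `σ`. -/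
theorem IsEmptyFaceDrawing.exists_mem_openTriangle {u v w x : V}
    (h : IsEmptyFaceDrawing (insert x A) (_root_.subdivide F u v w x) pos)
    (fs : IsFaceSystem A F) (hx : x ∉ A) (hf : F u v w) :
    ∃ σ : ℝ, (σ = 1 ∨ σ = -1) ∧ pos x ∈ openTriangle σ (pos u) (pos v) (pos w) := by
  have fs' := fs.subdivide hx hf
  have adj : ∀ p q, FaceAdj F p q → FaceAdj (_root_.subdivide F u v w x) p q := fun _ _ =>
    FaceAdj.subdivide
  have huv := adj u v ⟨w, Or.inl hf⟩
  have hvw := adj v w ⟨u, Or.inl (fs.rotate _ _ _ hf)⟩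
  have hwu := adj w u ⟨v, Or.inl (fs.rotate _ _ _ (fs.rotate _ _ _ hf))⟩
  have adjx := faceAdj_subdivide_self_iff fs hx hf
  have hxu := (adjx u).2 (by simp)
  have hxv := (adjx v).2 (by simp)
  have hxw := (adjx w).2 (by simp)
  have f1 : _root_.subdivide F u v w x u v x := Or.inr (Or.inl (.refl ..))
  have f2 : _root_.subdivide F u v w x v w x := Or.inr (Or.inr (Or.inl (.refl ..)))
  have f3 : _root_.subdivide F u v w x w u x := Or.inr (Or.inr (Or.inr (.refl ..)))
  have d1 := h.signedArea_ne_zero fs' huv hxv.symm hxu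
  have d2 := h.signedArea_ne_zero fs' hvw hxw.symm hxv
  have d3 := h.signedArea_ne_zero fs' hwu hxu.symm hxw
  have n1 := (hxu.ne fs').symm
  have n2 := (hxv.ne fs').symm
  have n3 := (hxw.ne fs').symm
  have k1 := fun σ => h.false_of_signs fs' (σ := σ) huv hvw hwu hxv n1 n3 f3
  have k2 := fun σ => h.false_of_signs fs' (σ := σ) hvw hwu huv hxw n2 n1 f1
  have k3 := fun σ => h.false_of_signs fs' (σ := σ) hwu huv hvw hxu n3 n2 f2
  have k1 := And.intro (k1 1) (k1 (-1))
  have k2 := And.intro (k2 1) (k2 (-1))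
  have k3 := And.intro (k3 1) (k3 (-1))
  simp only [one_mul, neg_mul, Left.neg_pos_iff, Left.neg_neg_iff] at k1 k2 k3
  rcases lt_or_gt_of_ne d1 with d1 | d1 <;> rcases lt_or_gt_of_ne d2 with d2 | d2 <;>
    rcases lt_or_gt_of_ne d3 with d3 | d3
  · exact ⟨-1, Or.inr rfl, by simp [openTriangle, d1, d2, d3]⟩
  · exact (k1.2 d1 d2 d3).elim
  · exact (k3.2 d3 d1 d2).elim
  · exact (k2.1 d2 d3 d1).elim
  · exact (k2.2 d2 d3 d1).elim
  · exact (k3.1 d3 d1 d2).elim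
  · exact (k1.1 d1 d2 d3).elim
  · exact ⟨1, Or.inl rfl, by simp [openTriangle, d1, d2, d3]⟩

/-- Only the emptiness of the merged face is new. By `openTriangle_cover` its points lie in one of
the three parts, which are empty, or on an edge at `x`; such an edge meets the old drawing only at
its old end, which is a corner. -/
theorem IsEmptyFaceDrawing.of_subdivide {σ : ℝ} {u v w x : V}
    (h : IsEmptyFaceDrawing (insert x A) (_root_.subdivide F u v w x) pos)
    (fs : IsFaceSystem A F) (hx : x ∉ A) (hf : F u v w)
    (hT : pos x ∈ openTriangle σ (pos u) (pos v) (pos w)) : IsEmptyFaceDrawing A F pos := by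
  have adj : ∀ p q, FaceAdj F p q → FaceAdj (_root_.subdivide F u v w x) p q := fun _ _ =>
    FaceAdj.subdivide
  have adjx := faceAdj_subdivide_self_iff fs hx hf
  have hsub : faceDrawing A F pos ⊆
      faceDrawing (insert x A) (_root_.subdivide F u v w x) pos := by
    rintro y (⟨z, hz, rfl⟩ | ⟨p, q, hpq, hy⟩)
    · exact Or.inl ⟨z, Or.inr hz, rfl⟩
    · exact Or.inr ⟨p, q, adj p q hpq, hy⟩
  refine ⟨⟨fun p q z hpq hz => h.vertex_edge p q z (adj p q hpq) (Or.inr hz),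
    fun p q y z h1 h2 => h.edge_edge p q y z (adj _ _ h1) (adj _ _ h2)⟩, ?_⟩
  intro p q r hp
  by_cases hr : IsRotationOf u v w p q r
  · have hD : 0 < σ * signedArea (pos p) (pos q) (pos r) := by
      rw [signedArea_of_rotation hr]; exact pos_of_mem_openTriangle hT
    rw [interior_convexHull_triangle hD, openTriangle_of_rotation hr, Set.disjoint_left]
    intro y hy hyD
    have corner : ∀ z ∈ ({u, v, w} : Set V), y ≠ pos z := by
      obtain ⟨y1, y2, y3⟩ := hy
      rintro z (rfl | rfl | rfl) rfl
      · simp [signedArea_left] at y1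
      · simp [signedArea_right] at y1
      · simp [signedArea_right] at y2
    have face : ∀ p q r, _root_.subdivide F u v w x p q r →
        0 < σ * signedArea (pos p) (pos q) (pos r) →
        y ∉ openTriangle σ (pos p) (pos q) (pos r) := by
      intro p q r hp hD hy'
      rw [← interior_convexHull_triangle hD] at hy'
      exact Set.disjoint_left.1 (h.inner p q r hp) hy' (hsub hyD)
    have edge : ∀ z ∈ ({u, v, w} : Set V), y ∉ segment ℝ (pos x) (pos z) := by
      intro z hz hseg
      have hxz := (adjx z).2 hz
      rcases hyD with ⟨s, hs, rfl⟩ | ⟨s, t, hst, hy'⟩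
      · refine h.vertex_edge x z s hxz (Or.inr hs) ?_ ?_ hseg
        · rintro rfl; exact hx hs
        · rintro rfl; exact corner _ hz rfl
      · have s1 : x ≠ s := fun e => hx (e ▸ hst.symm.mem fs)
        have s2 : x ≠ t := fun e => hx (e ▸ hst.mem fs)
        obtain ⟨z', m1, m2, e⟩ := h.edge_edge x z s t hxz (adj _ _ hst) (by
          intro e
          rw [Sym2.eq_iff] at e
          rcases e with ⟨e, -⟩ | ⟨e, -⟩
          · exact s1 e
          · exact s2 e) y hseg hy'
        simp only [Sym2.mem_iff] at m1 m2
        rcases m1 with rfl | rfl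
        · rcases m2 with e | e
          · exact s1 e
          · exact s2 e
        · exact corner _ hz e
    rcases openTriangle_cover hT hy with (k | k | k) | (k | k | k)
    · exact face u v x (Or.inr (Or.inl (.refl ..))) hT.1 k
    · exact face v w x (Or.inr (Or.inr (Or.inl (.refl ..)))) hT.2.1 k
    · exact face w u x (Or.inr (Or.inr (Or.inr (.refl ..)))) hT.2.2 k
    · exact edge u (by simp) k
    · exact edge v (by simp) k
    · exact edge w (by simp) k
  · exact (h.inner p q r (Or.inl ⟨hp, hr⟩)).mono_right hsub

theorem StackedDisc.exists_isOriented (hab : a ≠ b) (hbc : b ≠ c) (hca : c ≠ a)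
    (h : StackedDisc a b c A F) (hd : IsEmptyFaceDrawing A F pos) :
    ∃ σ : ℝ, (σ = 1 ∨ σ = -1) ∧ IsOriented σ F pos := by
  unfold StackedDisc at h
  induction h with
  | base =>
    have fs := IsFaceSystem.base hab hbc hca
    have f : IsRotationOf b a c b a c := .refl ..
    have hD := hd.signedArea_ne_zero fs (u := b) (v := a) (w := c) ⟨c, Or.inl f⟩
      ⟨b, Or.inl f.rotate⟩ ⟨a, Or.inl f.rotate.rotate⟩
    rcases lt_or_gt_of_ne hD with hD | hD
    · refine ⟨-1, Or.inr rfl, fun p q r hp => ?_⟩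
      rw [signedArea_of_rotation hp]; linarith
    · refine ⟨1, Or.inl rfl, fun p q r hp => ?_⟩
      rw [signedArea_of_rotation hp]; linarith
  | step x u v w hs hx hf ih =>
    have fs := Stacked.isFaceSystem (.base hab hbc hca) hs
    obtain ⟨τ, hτ, hT⟩ := hd.exists_mem_openTriangle fs hx hf
    obtain ⟨σ, hσ, ho⟩ := ih (hd.of_subdivide fs hx hf hT)
    have h1 := ho _ _ _ hf
    have h2 := pos_of_mem_openTriangle hT
    -- Both signs describe the orientation of the face that receives the vertex.
    obtain rfl : σ = τ := by
      rcases hσ with rfl | rfl <;> rcases hτ with rfl | rfl <;> first | rfl | (exfalso; linarith)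
    exact ⟨σ, hσ, isOriented_subdivide_iff.2 ⟨ho, hT⟩⟩

end Drawing

/-- Adjacency can be read off from the inner faces. -/
theorem RotationSystem.IsTriangulated.faceAdj_iff {V : Type} {G : RotationSystem V}
    (hG : G.IsTriangulated) {a b c : V} (hf : G.IsFacialTriangle a b c) {p q : V} :
    FaceAdj (fun p q r => G.IsFacialTriangle p q r ∧ ¬ IsRotationOf a b c p q r) p q ↔
      G.graph.Adj p q := by
  have fs := hG.isFaceSystem
  have hab := fs.ne _ _ _ hf
  have hbc := fs.ne₂ hf
  have hca := fs.ne₃ hf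
  constructor
  · rintro ⟨r, hr | hr⟩
    · exact hr.1.1
    · exact hr.1.1.symm
  · intro hpq
    have h1 := hG.face p q hpq
    have h2 := hG.face q p hpq.symm
    -- Every edge has a face on each side, and they are not both the outer one: the outer boundary
    -- runs along each of its sides in one direction only.
    by_cases hr : IsRotationOf a b c p q (G.rot q p)
    · refine ⟨_, Or.inr ⟨h2, fun hr2 => ?_⟩⟩
      rcases hr with ⟨e1, e2, -⟩ | ⟨e1, e2, -⟩ | ⟨e1, e2, -⟩ <;>
        rcases hr2 with ⟨e3, e4, -⟩ | ⟨e3, e4, -⟩ | ⟨e3, e4, -⟩ <;> grind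
    · exact ⟨_, Or.inl ⟨h1, hr⟩⟩

/-- A triangulated plane graph that is stacked into its outer triangle is drawn correctly if and
only if all inner faces have the same orientation. -/
theorem isStraightLineDrawing_iff {V : Type} {G : RotationSystem V} (hG : G.IsTriangulated)
    {a b c : V} (hf : G.IsFacialTriangle a b c)
    (h : StackedDisc a b c Set.univ
      (fun p q r => G.IsFacialTriangle p q r ∧ ¬ IsRotationOf a b c p q r)) (pos : V → ℝ × ℝ) :
    IsStraightLineDrawing G a b c pos ↔ ∃ σ : ℝ, (σ = 1 ∨ σ = -1) ∧
      IsOriented σ (fun p q r => G.IsFacialTriangle p q r ∧ ¬ IsRotationOf a b c p q r) pos := by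
  have fs := hG.isFaceSystem
  have hab := fs.ne _ _ _ hf
  have hbc := fs.ne₂ hf
  have hca := fs.ne₃ hf
  set F := fun p q r => G.IsFacialTriangle p q r ∧ ¬ IsRotationOf a b c p q r with hF
  have fsF := h.isFaceSystem hab hbc hca
  have adjF : ∀ p q, FaceAdj F p q ↔ G.graph.Adj p q := fun p q => hG.faceAdj_iff hf
  have hdraw : faceDrawing Set.univ F pos = drawingSet G.graph pos := by
    simp only [faceDrawing, drawingSet, Set.image_univ, adjF]
  constructor
  · intro hd
    refine h.exists_isOriented hab hbc hca ⟨⟨?_, ?_⟩, ?_⟩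
    · exact fun u v w huv _ h1 h2 => hd.crossingFree.vertex_edge u v w ((adjF _ _).1 huv) h1 h2
    · exact fun u v x y h1 h2 => hd.crossingFree.edge_edge u v x y ((adjF _ _).1 h1)
        ((adjF _ _).1 h2)
    · rintro u v w ⟨h1, h2⟩
      rw [hdraw]
      -- A facial triangle is determined by one of its directed edges, so barring three directed
      -- edges is the same as barring the outer face.
      have key : ∀ p q r, IsRotationOf a b c p q r → (u, v) ≠ (p, q) := by
        intro p q r hr e
        simp only [Prod.mk.injEq] at e
        obtain ⟨rfl, rfl⟩ := e
        have := (fs.of_rotation hr hf).2.1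
        rw [h1.2.1] at this
        exact h2 (this ▸ hr)
      exact hd.inner u v w h1 (key _ _ _ (.refl ..)) (key _ _ _ (IsRotationOf.refl ..).rotate)
        (key _ _ _ (IsRotationOf.refl ..).rotate.rotate)
  · rintro ⟨σ, hσ, ho⟩
    have hd := h.isOrientedDrawing hab hbc hca ho
    refine ⟨⟨fun p q e => hd.injOn trivial trivial e, ?_, ?_⟩, ?_, ?_⟩
    · exact fun u v w huv h1 h2 => hd.vertex_edge u v w ((adjF _ _).2 huv) trivial h1 h2
    · exact fun u v x y h1 h2 => hd.edge_edge u v x y ((adjF _ _).2 h1) ((adjF _ _).2 h2)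
    · have hm : ∀ v, pos v ∈ convexHull ℝ {pos a, pos b, pos c} := fun v =>
        ho.mem_convexHull hab hbc hca h trivial
      rintro q (⟨v, rfl⟩ | ⟨u, v, -, hq⟩)
      · exact hm v
      · exact (convex_convexHull ..).segment_subset (hm u) (hm v) hq
    · intro u v w h1 n1 n2 n3
      have hF : F u v w := by
        refine ⟨h1, ?_⟩
        rintro (⟨rfl, rfl, -⟩ | ⟨rfl, rfl, -⟩ | ⟨rfl, rfl, -⟩)
        · exact n1 rfl
        · exact n2 rfl
        · exact n3 rfl
      rw [interior_convexHull_triangle (ho _ _ _ hF), ← hdraw]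
      exact hd.inner u v w hF

/-! ## Reasoning about programs of the real RAM -/

section Programs

namespace RAMState

/-- Assignment to a word register. -/
def setI (σ : RAMState) (d v : ℕ) : RAMState := { σ with I := Function.update σ.I d v }

/-- Assignment to a real register. -/
noncomputable def setR (σ : RAMState) (d : ℕ) (v : ℝ) : RAMState :=
  { σ with R := Function.update σ.R d v }

/-- Assignment to a cell of word memory. -/
def setM (σ : RAMState) (d v : ℕ) : RAMState := { σ with M := Function.update σ.M d v }

variable (σ : RAMState) (d v r : ℕ) (x : ℝ)

@[simp] theorem setI_I : (σ.setI d v).I r = if r = d then v else σ.I r :=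
  Function.update_apply ..
@[simp] theorem setI_R : (σ.setI d v).R = σ.R := rfl
@[simp] theorem setI_M : (σ.setI d v).M = σ.M := rfl
@[simp] theorem setI_X : (σ.setI d v).X = σ.X := rfl
@[simp] theorem setR_I : (σ.setR d x).I = σ.I := rfl
@[simp] theorem setR_M : (σ.setR d x).M = σ.M := rfl
@[simp] theorem setR_R : (σ.setR d x).R r = if r = d then x else σ.R r :=
  Function.update_apply ..
@[simp] theorem setR_X : (σ.setR d x).X = σ.X := rfl
@[simp] theorem setM_I : (σ.setM d v).I = σ.I := rfl
@[simp] theorem setM_M : (σ.setM d v).M r = if r = d then v else σ.M r :=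
  Function.update_apply ..
@[simp] theorem setM_X : (σ.setM d v).X = σ.X := rfl

theorem ext' {σ τ : RAMState} (hI : ∀ r, σ.I r = τ.I r) (hR : σ.R = τ.R) (hM : σ.M = τ.M)
    (hX : σ.X = τ.X) : σ = τ := by
  cases σ; cases τ
  obtain rfl := funext hI
  simp only at hR hM hX
  subst hR hM hX
  rfl

end RAMState

namespace RAMInstr

variable (σ : RAMState) (d a b s c : ℕ)

@[simp] theorem exec_const : (const d c).exec σ = σ.setI d c := rfl
@[simp] theorem exec_add : (add d a b).exec σ = σ.setI d (σ.I a + σ.I b) := rfl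
@[simp] theorem exec_sub : (sub d a b).exec σ = σ.setI d (σ.I a - σ.I b) := rfl
@[simp] theorem exec_load : (load d a).exec σ = σ.setI d (σ.M (σ.I a)) := rfl
@[simp] theorem exec_store : (store a s).exec σ = σ.setM (σ.I a) (σ.I s) := rfl
@[simp] theorem exec_rsub : (rsub d a b).exec σ = σ.setR d (σ.R a - σ.R b) := rfl
@[simp] theorem exec_rmul : (rmul d a b).exec σ = σ.setR d (σ.R a * σ.R b) := rfl
@[simp] theorem exec_rload : (rload d a).exec σ = σ.setR d (σ.X (σ.I a)) := rfl

end RAMInstr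

/-- Started in `σ`, the program `P` halts within `T` steps in a state that satisfies `Q`. -/
def HaltsWithin (P : RAMProg) (T : ℕ) (Q : RAMState → Prop) (σ : RAMState) : Prop :=
  ∃ τ t, RAMRun P σ τ t ∧ t ≤ T ∧ Q τ

/-- Straight-line code. -/
def RAMProg.block : RAMInstr → List RAMInstr → RAMProg
  | i, [] => .instr i
  | i, j :: l => .seq (.instr i) (RAMProg.block j l)

namespace HaltsWithin

variable {P P' : RAMProg} {T T' : ℕ} {Q Q' : RAMState → Prop} {σ : RAMState}

theorem mono (h : HaltsWithin P T Q σ) (hT : T ≤ T') (hQ : ∀ τ, Q τ → Q' τ) :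
    HaltsWithin P T' Q' σ := by
  obtain ⟨τ, t, hr, ht, hq⟩ := h
  exact ⟨τ, t, hr, ht.trans hT, hQ τ hq⟩

theorem instr {i : RAMInstr} (h : Q (i.exec σ)) (hT : 1 ≤ T) :
    HaltsWithin (.instr i) T Q σ :=
  ⟨_, 1, .instr i σ, hT, h⟩

theorem seq (h : HaltsWithin P T (HaltsWithin P' T' Q) σ) :
    HaltsWithin (.seq P P') (T + T') Q σ := by
  obtain ⟨τ, t, hr, ht, τ', t', hr', ht', hq⟩ := h
  exact ⟨τ', t + t', .seq hr hr', by omega, hq⟩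

theorem ite {b : RAMTest} (h1 : b.Holds σ → HaltsWithin P T Q σ)
    (h2 : ¬ b.Holds σ → HaltsWithin P' T Q σ) : HaltsWithin (.ite b P P') (1 + T) Q σ := by
  by_cases hb : b.Holds σ
  · obtain ⟨τ, t, hr, ht, hq⟩ := h1 hb
    exact ⟨τ, 1 + t, .ite_true hb hr, by omega, hq⟩
  · obtain ⟨τ, t, hr, ht, hq⟩ := h2 hb
    exact ⟨τ, 1 + t, .ite_false hb hr, by omega, hq⟩

theorem block {i : RAMInstr} {l : List RAMInstr}
    (h : Q ((i :: l).foldl (fun s i => i.exec s) σ)) :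
    HaltsWithin (.block i l) (l.length + 1) Q σ := by
  induction l generalizing i σ with
  | nil => exact instr h le_rfl
  | cons j l ih =>
    have := seq (T := 1) (instr (i := i) (Q := HaltsWithin (.block j l) (l.length + 1) Q)
      (ih h) le_rfl)
    exact this.mono (by simp; omega) fun _ => id

/-- The invariant is indexed by the number of completed iterations. It must imply the test before
`N` and refute it at `N`, so the number of iterations is exact. -/
theorem while_of_invariant {b : RAMTest} {N : ℕ} (Inv : ℕ → RAMState → Prop)
    (hstep : ∀ j < N, ∀ τ, Inv j τ → b.Holds τ ∧ HaltsWithin P T (Inv (j + 1)) τ)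
    (hend : ∀ τ, Inv N τ → ¬ b.Holds τ ∧ Q τ) {j : ℕ} (hj : j ≤ N) (h : Inv j σ) :
    HaltsWithin (.while b P) ((N - j) * (T + 1) + 1) Q σ := by
  obtain ⟨m, rfl⟩ := Nat.exists_eq_add_of_le hj
  induction m generalizing j σ with
  | zero => exact ⟨σ, 1, .while_false (hend σ h).1, by simp, (hend σ h).2⟩
  | succ m ih =>
    obtain ⟨hb, τ, t, hr, ht, hτ⟩ := hstep j (by omega) σ h
    obtain ⟨τ', t', hr', ht', hq⟩ := ih (σ := τ) (j := j + 1) hτ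
      (by rwa [show j + 1 + m = j + (m + 1) by omega])
      (by rwa [show j + 1 + m = j + (m + 1) by omega]) (by omega)
    refine ⟨τ', _, .while_true hb hr hr', ?_, hq⟩
    rw [show j + 1 + m - (j + 1) = m by omega] at ht'
    rw [show j + (m + 1) - j = m + 1 by omega, Nat.add_mul]
    omega

end HaltsWithin

/-- Counting loop: register `i` runs from `0` to the value of register `ν`; register `6` holds
the constant `1`. -/
def RAMProg.for (i ν : ℕ) (P : RAMProg) : RAMProg :=
  .seq (.instr (.const i 0)) (.while (.lt i ν) (.seq P (.instr (.add i i 6))))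

/-- Each iteration pays two extra steps, for the test and the increment; the final two steps are the
initialisation and the failing test. The invariant has to be insensitive to the counter, which the
loop itself rewrites. -/
theorem HaltsWithin.for {i ν N T T' : ℕ} {P : RAMProg} {Q : RAMState → Prop} {σ : RAMState}
    (Inv : ℕ → RAMState → Prop) (hνi : ν ≠ i) (hi6 : 6 ≠ i)
    (hstable : ∀ j τ v, Inv j τ → Inv j (τ.setI i v)) (hν : σ.I ν = N) (h6 : σ.I 6 = 1)
    (h0 : Inv 0 σ)
    (hbody : ∀ j < N, ∀ τ, τ.I i = j → τ.I ν = N → τ.I 6 = 1 → Inv j τ →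
      HaltsWithin P T (fun τ' => τ'.I i = j ∧ τ'.I ν = N ∧ τ'.I 6 = 1 ∧ Inv (j + 1) τ') τ)
    (hQ : ∀ τ, τ.I ν = N → τ.I 6 = 1 → Inv N τ → Q τ) (hT : N * (T + 2) + 2 ≤ T') :
    HaltsWithin (.for i ν P) T' Q σ := by
  have := HaltsWithin.seq (P := .instr (.const i 0)) (T := 1)
    (P' := .while (.lt i ν) (.seq P (.instr (.add i i 6)))) (T' := (N - 0) * (T + 1 + 1) + 1)
    (Q := Q) (σ := σ) (HaltsWithin.instr ?_ le_rfl)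
  · exact this.mono (by rw [Nat.sub_zero, show T + 1 + 1 = T + 2 from rfl]; omega) fun _ => id
  · apply HaltsWithin.while_of_invariant
      (fun j τ => τ.I i = j ∧ τ.I ν = N ∧ τ.I 6 = 1 ∧ Inv j τ)
    · rintro j hj τ ⟨h1, h2, h3, h4⟩
      refine ⟨by simpa [RAMTest.Holds, h1, h2] using hj, ?_⟩
      refine HaltsWithin.seq ((hbody j hj τ h1 h2 h3 h4).mono le_rfl ?_)
      rintro τ' ⟨h1, h2, h3, h4⟩
      refine HaltsWithin.instr ?_ le_rfl
      simp only [RAMInstr.exec_add, RAMState.setI_I, h1, h2, h3, if_neg hνi, if_neg hi6,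
        if_true, true_and]
      exact hstable _ _ _ h4
    · rintro τ ⟨h1, h2, h3, h4⟩
      exact ⟨by simp [RAMTest.Holds, h1, h2], hQ τ h2 h3 h4⟩
    · exact Nat.zero_le _
    · simp only [RAMInstr.exec_const, RAMState.setI_I, if_true, if_neg hνi, if_neg hi6, hν, h6,
        true_and]
      exact hstable _ _ _ h0

/-! ### Addresses -/

/-- The value of the digits `l` after the leading digit `t`, in base `B`. -/
def hornerValue (B t : ℕ) (l : List ℕ) : ℕ := l.foldl (fun acc d => acc * B + d) t

theorem hornerValue_cons (B t d : ℕ) (l : List ℕ) :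
    hornerValue B t (d :: l) = hornerValue B (t * B + d) l := rfl

/-- Uniqueness of base-`B` expansions. The leading digit is not bounded, so tags need not be smaller
than the base. -/
theorem hornerValue_inj {B : ℕ} {l l' : List ℕ} (hlen : l.length = l'.length)
    (hl : ∀ d ∈ l, d < B) (hl' : ∀ d ∈ l', d < B) {t t' : ℕ} :
    hornerValue B t l = hornerValue B t' l' ↔ t = t' ∧ l = l' := by
  refine ⟨fun h => ?_, by rintro ⟨rfl, rfl⟩; rfl⟩
  induction l generalizing l' t t' with
  | nil =>
    obtain rfl := List.length_eq_zero_iff.1 hlen.symm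
    exact ⟨h, rfl⟩
  | cons d l ih =>
    obtain ⟨d', l', rfl⟩ : ∃ d' m, l' = d' :: m := by
      cases l' with
      | nil => simp at hlen
      | cons d' m => exact ⟨d', m, rfl⟩
    obtain ⟨h1, rfl⟩ := ih (l' := l') (by simpa using hlen)
      (fun e he => hl e (by simp [he])) (fun e he => hl' e (by simp [he])) h
    have hd : d < B := hl d (by simp)
    have hd' : d' < B := hl' d' (by simp)
    have e1 := congrArg (· / B) h1
    have e2 := congrArg (· % B) h1
    have hB : 0 < B := by omega
    simp only [Nat.mul_comm _ B, Nat.mul_add_div hB, Nat.div_eq_of_lt hd, Nat.div_eq_of_lt hd',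
      Nat.mul_add_mod, Nat.mod_eq_of_lt hd, Nat.mod_eq_of_lt hd', add_zero] at e1 e2
    simp [e1, e2]

/-- With a positive tag and six digits, an address is at least `k ^ 6` and hence outside the
adjacency matrix. -/
theorem le_hornerValue (B t : ℕ) (l : List ℕ) : t * B ^ l.length ≤ hornerValue B t l := by
  induction l generalizing t with
  | nil => simp [hornerValue]
  | cons d l ih =>
    rw [hornerValue_cons, List.length_cons, pow_succ', ← mul_assoc]
    exact (Nat.mul_le_mul_right _ (Nat.le_add_right _ _)).trans (ih _)

/-- Varying the last digit costs one addition; this is what makes the innermost loop body constant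
time. -/
theorem hornerValue_concat (B t d : ℕ) (l : List ℕ) :
    hornerValue B t (l ++ [d]) = hornerValue B t (l ++ [0]) + d := by
  simp [hornerValue]

/-- One step of Horner's rule: register `7` is multiplied by register `ρ` and register `e` is
added. -/
def hornerStep (ρ e : ℕ) : RAMProg :=
  .seq (.block (.const 8 0) [.add 9 e 5]) <|
  -- Multiplication by repeated addition, with as many iterations as the base.
  .seq (.while (.lt 8 ρ) (.block (.add 9 9 7) [.add 8 8 6])) <|
  .instr (.add 7 9 5)

/-- Horner's rule with leading digit in register `7` and the further digits in registers `l`. -/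
def hornerLoop (ρ d : ℕ) : List ℕ → RAMProg
  -- Register `5` is zero, so the addition copies. Clearing the scratch registers restores `IsTidy`
  -- for the next address.
  | [] => .block (.add d 7 5) [.const 7 0, .const 8 0, .const 9 0]
  | e :: l => .seq (hornerStep ρ e) (hornerLoop ρ d l)

/-- Computes an address in register `d`: the digits are the constant `t` and the contents of the
registers `l`, the base is the content of register `ρ`.  Registers `7`, `8`, `9` are scratch. -/
def addressTo (ρ d t : ℕ) (l : List ℕ) : RAMProg :=
  .seq (.instr (.const 7 t)) (hornerLoop ρ d l)

/-- Registers `5`, `6` hold constants, and the scratch registers `7`, `8`, `9` are cleared. -/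
structure IsTidy (σ : RAMState) : Prop where
  h5 : σ.I 5 = 0
  h6 : σ.I 6 = 1
  h7 : σ.I 7 = 0
  h8 : σ.I 8 = 0
  h9 : σ.I 9 = 0

theorem IsTidy.of_eq {σ τ : RAMState} (h : IsTidy σ) (he : ∀ r < 10, τ.I r = σ.I r) :
    IsTidy τ := by
  obtain ⟨h5, h6, h7, h8, h9⟩ := h
  constructor <;> rw [he _ (by norm_num)] <;> assumption

/-- Scratch registers are allowed to differ. -/
def EqUpToScratch (σ τ : RAMState) : Prop :=
  (∀ r, r ≠ 7 → r ≠ 8 → r ≠ 9 → τ.I r = σ.I r) ∧ τ.R = σ.R ∧ τ.M = σ.M ∧ τ.X = σ.X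

theorem EqUpToScratch.setI {σ τ : RAMState} (h : EqUpToScratch σ τ) {d v : ℕ}
    (hd : d = 7 ∨ d = 8 ∨ d = 9) : EqUpToScratch σ (τ.setI d v) := by
  refine ⟨fun r h7 h8 h9 => ?_, h.2⟩
  rw [RAMState.setI_I, if_neg (by omega)]
  exact h.1 r h7 h8 h9

theorem haltsWithin_hornerStep {ρ e : ℕ} {Q : RAMState → Prop} {σ₀ σ : RAMState}
    (h : IsTidy σ₀) (hσ : EqUpToScratch σ₀ σ) (hρ : ρ < 7 ∨ 10 ≤ ρ) (he : e < 7 ∨ 10 ≤ e)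
    (hQ : ∀ τ, EqUpToScratch σ₀ τ → τ.I 7 = σ.I 7 * σ₀.I ρ + σ₀.I e → Q τ) :
    HaltsWithin (hornerStep ρ e) (3 * σ₀.I ρ + 4) Q σ := by
  have key : ∀ {τ}, EqUpToScratch σ₀ τ → τ.I 5 = 0 ∧ τ.I 6 = 1 ∧ τ.I ρ = σ₀.I ρ ∧
      τ.I e = σ₀.I e := fun hτ =>
    ⟨(hτ.1 5 (by omega) (by omega) (by omega)).trans h.h5,
      (hτ.1 6 (by omega) (by omega) (by omega)).trans h.h6,
      hτ.1 ρ (by omega) (by omega) (by omega), hτ.1 e (by omega) (by omega) (by omega)⟩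
  have h1 : HaltsWithin (.while (.lt 8 ρ) (.block (.add 9 9 7) [.add 8 8 6]))
      ((σ₀.I ρ - 0) * (2 + 1) + 1) (HaltsWithin (.instr (.add 7 9 5)) 1 Q)
      ((σ.setI 8 0).setI 9 (σ₀.I e)) := by
    apply HaltsWithin.while_of_invariant (fun j τ => EqUpToScratch σ₀ τ ∧ τ.I 7 = σ.I 7 ∧
      τ.I 8 = j ∧ τ.I 9 = σ.I 7 * j + σ₀.I e)
    · rintro j hj τ ⟨hτ, h7, h8, h9⟩
      obtain ⟨k5, k6, kρ, ke⟩ := key hτ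
      refine ⟨by simpa [RAMTest.Holds, h8, kρ] using hj, HaltsWithin.block ?_⟩
      refine ⟨(hτ.setI (by simp)).setI (by simp), ?_, ?_, ?_⟩
      · simp [h7]
      · simp [h8, k6]
      · simp [h9, h7]; ring
    · rintro τ ⟨hτ, h7, h8, h9⟩
      obtain ⟨k5, k6, kρ, ke⟩ := key hτ
      refine ⟨by simp [RAMTest.Holds, h8, kρ], HaltsWithin.instr ?_ le_rfl⟩
      refine hQ _ (hτ.setI (by simp)) ?_
      simp [h9, k5]
    · exact Nat.zero_le _
    · exact ⟨(hσ.setI (by simp)).setI (by simp), by simp⟩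
  obtain ⟨k5, k6, kρ, ke⟩ := key hσ
  refine (HaltsWithin.seq (HaltsWithin.block (HaltsWithin.seq ?_))).mono
    (T := 2 + ((σ₀.I ρ - 0) * (2 + 1) + 1 + 1)) (by omega) fun _ => id
  have he8 : e ≠ 8 := by omega
  simpa [he8, ke, k5] using h1

/-- As the scratch registers are cleared at the end, the final state equals `σ₀` except in register
`d`, and later reasoning can forget the scratch work. -/
theorem haltsWithin_hornerLoop {ρ d : ℕ} {l : List ℕ} {Q : RAMState → Prop} {σ₀ σ : RAMState}
    (h : IsTidy σ₀) (hσ : EqUpToScratch σ₀ σ) (hρ : ρ < 7 ∨ 10 ≤ ρ) (hd : 10 ≤ d)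
    (hl : ∀ e ∈ l, e < 7 ∨ 10 ≤ e)
    (hQ : Q (σ₀.setI d (hornerValue (σ₀.I ρ) (σ.I 7) (l.map σ₀.I)))) :
    HaltsWithin (hornerLoop ρ d l) (l.length * (3 * σ₀.I ρ + 4) + 4) Q σ := by
  induction l generalizing σ with
  | nil =>
    refine (HaltsWithin.block ?_).mono (by simp) fun _ => id
    convert hQ using 1
    apply RAMState.ext'
    · intro r
      have h5 := (hσ.1 5 (by omega) (by omega) (by omega)).trans h.h5
      simp only [List.foldl_cons, List.foldl_nil, RAMInstr.exec_add, RAMInstr.exec_const,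
        RAMState.setI_I, h5, hornerValue, List.map_nil, add_zero]
      by_cases h9 : r = 9
      · simp [h9, h.h9]; omega
      by_cases h8 : r = 8
      · simp [h8, h.h8]; omega
      by_cases h7 : r = 7
      · simp [h7, h.h7]; omega
      simp only [h9, h8, h7, if_false]
      rw [hσ.1 r h7 h8 h9]
    · exact hσ.2.1
    · exact hσ.2.2.1
    · exact hσ.2.2.2
  | cons e l ih =>
    refine (HaltsWithin.seq (haltsWithin_hornerStep h hσ hρ (hl e (by simp)) ?_)).mono
      (T := 3 * σ₀.I ρ + 4 + (l.length * (3 * σ₀.I ρ + 4) + 4))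
      (by rw [List.length_cons, Nat.add_mul]; omega) fun _ => id
    intro τ hτ h7
    refine ih hτ (fun e he => hl e (by simp [he])) ?_
    rw [h7]
    exact hQ

theorem haltsWithin_addressTo {ρ d t T : ℕ} {l : List ℕ} {Q : RAMState → Prop} {σ : RAMState}
    (h : IsTidy σ) (hρ : ρ < 7 ∨ 10 ≤ ρ) (hd : 10 ≤ d) (hl : ∀ e ∈ l, e < 7 ∨ 10 ≤ e)
    (hT : l.length * (3 * σ.I ρ + 4) + 5 ≤ T)
    (hQ : Q (σ.setI d (hornerValue (σ.I ρ) t (l.map σ.I)))) :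
    HaltsWithin (addressTo ρ d t l) T Q σ := by
  refine (HaltsWithin.seq (HaltsWithin.instr ?_ le_rfl)).mono
    (T := 1 + (l.length * (3 * σ.I ρ + 4) + 4)) (by omega) fun _ => id
  refine haltsWithin_hornerLoop h ⟨fun r h7 _ _ => ?_, rfl, rfl, rfl⟩ hρ hd hl ?_
  · simp [h7]
  · simpa using hQ

/-! ### Three nested loops -/

/-- Loops over all triples of numbers less than register `1`, in registers `16`, `17`, `18`. -/
def RAMProg.forTriples (P : RAMProg) : RAMProg := .for 16 1 (.for 17 1 (.for 18 1 P))

/-- The triples of numbers less than `k` that precede `(p, q, r)`. -/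
def triplesBefore (k p q r : ℕ) : Set (ℕ × ℕ × ℕ) :=
  {x | x.1 < k ∧ x.2.1 < k ∧ x.2.2 < k ∧
    (x.1 < p ∨ x.1 = p ∧ (x.2.1 < q ∨ x.2.1 = q ∧ x.2.2 < r))}

/-- The invariant depends only on the set of places treated so far, not on the loop structure;
`triplesBefore` supplies this set in lexicographic order and shows that each place is new when it is
reached. -/
theorem HaltsWithin.forTriples {k T T' : ℕ} {P : RAMProg} {Q : RAMState → Prop} {σ : RAMState}
    (Inv : Set (ℕ × ℕ × ℕ) → RAMState → Prop)
    (hstable : ∀ S τ d v, d = 16 ∨ d = 17 ∨ d = 18 → Inv S τ → Inv S (τ.setI d v))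
    (hk : σ.I 1 = k) (h6 : σ.I 6 = 1) (h0 : Inv ∅ σ)
    (hbody : ∀ S p q r, p < k → q < k → r < k → (p, q, r) ∉ S → ∀ τ, τ.I 16 = p → τ.I 17 = q →
      τ.I 18 = r → Inv S τ → HaltsWithin P T
        (fun τ' => (∀ r < 19, τ'.I r = τ.I r) ∧ Inv (insert (p, q, r) S) τ') τ)
    (hQ : ∀ τ, Inv {x | x.1 < k ∧ x.2.1 < k ∧ x.2.2 < k} τ → Q τ)
    (hT : k * (k * (k * (T + 2) + 4) + 4) + 2 ≤ T') :
    HaltsWithin (.forTriples P) T' Q σ := by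
  have e0 : triplesBefore k 0 0 0 = ∅ := by ext ⟨x, y, z⟩; simp [triplesBefore]
  have e1 : ∀ p q r, p < k → q < k → r < k →
      insert (p, q, r) (triplesBefore k p q r) = triplesBefore k p q (r + 1) := by
    intro p q r hp hq hr
    ext ⟨x, y, z⟩
    simp only [triplesBefore, Set.mem_insert_iff, Set.mem_ofPred_eq, Prod.mk.injEq]
    omega
  have e2 : ∀ p q, triplesBefore k p q k = triplesBefore k p (q + 1) 0 := by
    intro p q
    ext ⟨x, y, z⟩
    simp only [triplesBefore, Set.mem_ofPred_eq]
    omega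
  have e3 : ∀ p, triplesBefore k p k 0 = triplesBefore k (p + 1) 0 0 := by
    intro p
    ext ⟨x, y, z⟩
    simp only [triplesBefore, Set.mem_ofPred_eq]
    omega
  have e4 : triplesBefore k k 0 0 = {x | x.1 < k ∧ x.2.1 < k ∧ x.2.2 < k} := by
    ext ⟨x, y, z⟩
    simp only [triplesBefore, Set.mem_ofPred_eq]
    omega
  refine HaltsWithin.for (N := k) (T := k * (k * (T + 2) + 4) + 2)
    (fun p τ => Inv (triplesBefore k p 0 0) τ) (by norm_num) (by norm_num)
    (fun _ _ _ h => hstable _ _ _ _ (by simp) h) hk h6 (by rwa [e0]) ?_ ?_ hT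
  · intro p hp τ h16 h1 h6 h
    refine HaltsWithin.for (N := k) (T := k * (T + 2) + 2)
      (fun q τ => τ.I 16 = p ∧ Inv (triplesBefore k p q 0) τ) (by norm_num) (by norm_num)
      (fun _ _ _ h => ⟨by simpa using h.1, hstable _ _ _ _ (by simp) h.2⟩) h1 h6 ⟨h16, h⟩ ?_ ?_
      (by rw [show k * (T + 2) + 2 + 2 = k * (T + 2) + 4 by omega])
    · rintro q hq τ h17 h1 h6 ⟨h16, h⟩
      refine HaltsWithin.for (N := k) (T := T)
        (fun r τ => τ.I 16 = p ∧ τ.I 17 = q ∧ Inv (triplesBefore k p q r) τ) (by norm_num)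
        (by norm_num)
        (fun _ _ _ h => ⟨by simpa using h.1, by simpa using h.2.1,
          hstable _ _ _ _ (by simp) h.2.2⟩) h1 h6 ⟨h16, h17, h⟩ ?_ ?_ le_rfl
      · rintro r hr τ h18 h1 h6 ⟨h16, h17, h⟩
        refine (hbody _ p q r hp hq hr (by simp [triplesBefore]) τ h16 h17 h18 h).mono le_rfl ?_
        rintro τ' ⟨hf, h'⟩
        rw [hf 18 (by norm_num), hf 16 (by norm_num), hf 17 (by norm_num), hf 1 (by norm_num),
          hf 6 (by norm_num)]
        exact ⟨h18, h1, h6, h16, h17, by rwa [e1 p q r hp hq hr] at h'⟩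
      · rintro τ h1 h6 ⟨h16, h17, h⟩
        exact ⟨h17, h1, h6, h16, by rwa [e2] at h⟩
    · rintro τ h1 h6 ⟨h16, h⟩
      exact ⟨h16, h1, h6, by rwa [e3] at h⟩
  · intro τ _ _ h
    exact hQ τ (by rwa [e4] at h)

end Programs

/-! ## The tables of the dynamic program -/

section Tables

/-- The cell with the answer for the face `(u, v, w)` placed at `(p, q, r)`. -/
def faceCell (k u v w p q r : ℕ) : ℕ := hornerValue k 1 [u, v, w, p, q, r]

/-- The cell with the position of the vertex `x` when its triangle is placed at `(p, q, r)`. -/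
def witnessCell (k x p q r : ℕ) : ℕ := hornerValue k 2 [x, p, q, r, 0, 0]

/-- The cell that marks the vertex `x` as removed. -/
def removedCell (k x : ℕ) : ℕ := hornerValue k 3 [x, 0, 0, 0, 0, 0]

/-- The cells that record the vertex removed in round `t` and its three neighbours. -/
def recordCell (k i t : ℕ) : ℕ := hornerValue k (4 + i) [t, 0, 0, 0, 0, 0]

/-- The cells that belong to the triangle `u v w` placed at `(p, q, r)`. -/
def faceCells (k u v w p q r : ℕ) : List ℕ :=
  [faceCell k u v w p q r, faceCell k v w u q r p, faceCell k w u v r p q,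
    faceCell k v u w q p r, faceCell k u w v p r q, faceCell k w v u r q p]

/-- `s` lies strictly inside the triangle `p q r`, in either orientation. -/
def StrictlyInside (p q r s : ℝ × ℝ) : Prop :=
  (0 < signedArea p q s ∧ 0 < signedArea q r s ∧ 0 < signedArea r p s) ∨
    (signedArea p q s < 0 ∧ signedArea q r s < 0 ∧ signedArea r p s < 0)

/-- `s` is a possible position for `x` when its neighbours `u, v, w` are placed at `p, q, r`. -/
def IsWitness (k : ℕ) (pt : ℕ → ℝ × ℝ) (M : ℕ → ℕ) (x u v w p q r s : ℕ) : Prop :=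
  StrictlyInside (pt p) (pt q) (pt r) (pt s) ∧ M (faceCell k u v x p q s) = 0 ∧
    M (faceCell k v w x q r s) = 0 ∧ M (faceCell k w u x r p s) = 0

/-- The memory `M'` contains the entries for the triangle `u v w` at the place `(p, q, r)`. -/
def IsEntry (k : ℕ) (pt : ℕ → ℝ × ℝ) (M M' : ℕ → ℕ) (x u v w p q r : ℕ) : Prop :=
  ∃ flag, (∀ α ∈ faceCells k u v w p q r, M' α = flag) ∧ M' (witnessCell k x p q r) < k ∧
    ((flag = 0 ∧ IsWitness k pt M x u v w p q r (M' (witnessCell k x p q r))) ∨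
      (flag = 1 ∧ ∀ s < k, ¬ IsWitness k pt M x u v w p q r s))

/-- `M'` results from `M` by entering the tables for `x` at the places in `S`. -/
structure IsTableUpdate (k : ℕ) (pt : ℕ → ℝ × ℝ) (M M' : ℕ → ℕ) (x u v w : ℕ)
    (S : Set (ℕ × ℕ × ℕ)) : Prop where
  entry : ∀ p q r, (p, q, r) ∈ S → IsEntry k pt M M' x u v w p q r
  other : ∀ α, (∀ p q r, (p, q, r) ∈ S →
    α ∉ faceCells k u v w p q r ∧ α ≠ witnessCell k x p q r) → M' α = M α

/-- The positions of all vertices, from those of the vertices left after `t` rounds. -/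
def reconstruct (k : ℕ) (M : ℕ → ℕ) : ℕ → (ℕ → ℕ) → ℕ → ℕ
  | 0, f => f
  | t + 1, f => reconstruct k M t (Function.update f (M (recordCell k 0 t))
      (M (witnessCell k (M (recordCell k 0 t)) (f (M (recordCell k 1 t)))
        (f (M (recordCell k 2 t))) (f (M (recordCell k 3 t))))))

/-- The placement `f` is compatible with the faces `F` and the tables. -/
def IsAdmissible (k : ℕ) (pt : ℕ → ℝ × ℝ) (M : ℕ → ℕ) (F : ℕ → ℕ → ℕ → Prop) (σ : ℝ)
    (f : ℕ → ℕ) : Prop :=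
  IsOriented σ F (fun v => pt (f v)) ∧ ∀ u v w, F u v w → M (faceCell k u v w (f u) (f v) (f w)) = 0

/-- The state of the computation after `t` vertices have been removed. -/
structure IsReduction (n k : ℕ) (pt : ℕ → ℝ × ℝ) (a b c : ℕ) (F₀ : ℕ → ℕ → ℕ → Prop)
    (M : ℕ → ℕ) (t : ℕ) (A : Set ℕ) (F : ℕ → ℕ → ℕ → Prop) : Prop where
  disc : StackedDisc a b c A F
  card : A.ncard + t = n
  lt : ∀ v ∈ A, v < n
  removed : ∀ v < n, M (removedCell k v) = 0 ↔ v ∈ A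
  adj : ∀ p ∈ A, ∀ q ∈ A, FaceAdj F p q ↔ FaceAdj F₀ p q
  swap : ∀ u < k, ∀ v < k, ∀ w < k, ∀ p < k, ∀ q < k, ∀ r < k,
    M (faceCell k v u w q p r) = M (faceCell k u v w p q r)
  rotate : ∀ u < k, ∀ v < k, ∀ w < k, ∀ p < k, ∀ q < k, ∀ r < k,
    M (faceCell k v w u q r p) = M (faceCell k u v w p q r)
  witness : ∀ x < k, ∀ p < k, ∀ q < k, ∀ r < k, M (witnessCell k x p q r) < k
  record : ∀ j < t, ∀ i < 4, M (recordCell k i j) < n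
  record_removed : ∀ j < t, M (recordCell k 0 j) ∉ A
  complete : ∀ σ f, (∀ v, f v < k) → IsOriented σ F₀ (fun v => pt (f v)) →
    IsAdmissible k pt M F σ f
  sound : ∀ σ f, (∀ v, f v < k) → IsAdmissible k pt M F σ f →
    IsOriented σ F₀ (fun v => pt (reconstruct k M t f v))

variable {k : ℕ} {pt : ℕ → ℝ × ℝ} {M M' : ℕ → ℕ}

/-! ### Table addresses and their permutations -/

theorem cell_inj {t t' a b c d e f a' b' c' d' e' f' : ℕ} (ha : a < k) (hb : b < k) (hc : c < k)
    (hd : d < k) (he : e < k) (hf : f < k) (ha' : a' < k) (hb' : b' < k) (hc' : c' < k)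
    (hd' : d' < k) (he' : e' < k) (hf' : f' < k) :
    hornerValue k t [a, b, c, d, e, f] = hornerValue k t' [a', b', c', d', e', f'] ↔
      t = t' ∧ a = a' ∧ b = b' ∧ c = c' ∧ d = d' ∧ e = e' ∧ f = f' := by
  rw [hornerValue_inj (by simp) (by simp [*]) (by simp [*])]
  simp

theorem faceCell_inj {u v w p q r u' v' w' p' q' r' : ℕ} (ha : u < k) (hb : v < k) (hc : w < k)
    (hd : p < k) (he : q < k) (hf : r < k) (ha' : u' < k) (hb' : v' < k) (hc' : w' < k)
    (hd' : p' < k) (he' : q' < k) (hf' : r' < k) :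
    faceCell k u v w p q r = faceCell k u' v' w' p' q' r' ↔
      u = u' ∧ v = v' ∧ w = w' ∧ p = p' ∧ q = q' ∧ r = r' := by
  rw [faceCell, faceCell, cell_inj ha hb hc hd he hf ha' hb' hc' hd' he' hf']
  simp

theorem witnessCell_inj {x p q r x' p' q' r' : ℕ} (ha : x < k) (hb : p < k) (hc : q < k)
    (hd : r < k) (ha' : x' < k) (hb' : p' < k) (hc' : q' < k) (hd' : r' < k) :
    witnessCell k x p q r = witnessCell k x' p' q' r' ↔ x = x' ∧ p = p' ∧ q = q' ∧ r = r' := by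
  have h0 : 0 < k := by omega
  rw [witnessCell, witnessCell, cell_inj ha hb hc hd h0 h0 ha' hb' hc' hd' h0 h0]
  simp

/-- Cells with another tag than those of the tables. -/
theorem tag_ne_of_mem_faceCells {u v w p q r t α : ℕ} {l : List ℕ} (hu : u < k) (hv : v < k)
    (hw : w < k) (hp : p < k) (hq : q < k) (hr : r < k) (hlen : l.length = 6)
    (hl : ∀ d ∈ l, d < k) (ht : t ≠ 1) (hα : α = hornerValue k t l) :
    α ∉ faceCells k u v w p q r := by
  intro h
  subst hα
  simp only [faceCells, faceCell, List.mem_cons, List.not_mem_nil, or_false] at h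
  rcases h with h | h | h | h | h | h <;>
    (rw [hornerValue_inj (by simp [hlen]) hl (by simp [*])] at h; exact ht h.1)

/-- `(p, q, r)` is a permutation of `(u, v, w)`. -/
def IsPermutationOf (u v w p q r : ℕ) : Prop :=
  IsRotationOf u v w p q r ∨ IsRotationOf v u w p q r

/-- Writing an entry for `u v w` can only disturb faces on the same three vertices. -/
theorem isPermutationOf_of_mem_faceCells {u v w p q r u' v' w' p' q' r' : ℕ}
    (hu : u < k) (hv : v < k)
    (hw : w < k) (hp : p < k) (hq : q < k) (hr : r < k) (hu' : u' < k) (hv' : v' < k)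
    (hw' : w' < k) (hp' : p' < k) (hq' : q' < k) (hr' : r' < k)
    (h : faceCell k u' v' w' p' q' r' ∈ faceCells k u v w p q r) :
    IsPermutationOf u v w u' v' w' := by
  simp only [faceCells, List.mem_cons, List.not_mem_nil, or_false] at h
  unfold IsPermutationOf IsRotationOf
  rcases h with h | h | h | h | h | h <;>
    (rw [faceCell_inj (by assumption) (by assumption) (by assumption) (by assumption)
        (by assumption) (by assumption) (by assumption) (by assumption) (by assumption)
        (by assumption) (by assumption) (by assumption)] at h
     simp [h.1, h.2.1, h.2.2.1])

/-- A cell for a permuted triple belongs to the entry at the correspondingly permuted place. Its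
swapped and rotated companions belong to the same entry, so all carry one flag and the tables stay
symmetric. -/
theorem exists_place_of_isPermutationOf {u v w u' v' w' p' q' r' : ℕ}
    (h : IsPermutationOf u v w u' v' w') (hp : p' < k) (hq : q' < k) (hr : r' < k) :
    ∃ p q r, p < k ∧ q < k ∧ r < k ∧ faceCell k u' v' w' p' q' r' ∈ faceCells k u v w p q r ∧
      faceCell k v' u' w' q' p' r' ∈ faceCells k u v w p q r ∧
      faceCell k v' w' u' q' r' p' ∈ faceCells k u v w p q r := by
  rcases h with (⟨rfl, rfl, rfl⟩ | ⟨rfl, rfl, rfl⟩ | ⟨rfl, rfl, rfl⟩) |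
    (⟨rfl, rfl, rfl⟩ | ⟨rfl, rfl, rfl⟩ | ⟨rfl, rfl, rfl⟩)
  · exact ⟨p', q', r', hp, hq, hr, by simp [faceCells], by simp [faceCells], by simp [faceCells]⟩
  · exact ⟨r', p', q', hr, hp, hq, by simp [faceCells], by simp [faceCells], by simp [faceCells]⟩
  · exact ⟨q', r', p', hq, hr, hp, by simp [faceCells], by simp [faceCells], by simp [faceCells]⟩
  · exact ⟨q', p', r', hq, hp, hr, by simp [faceCells], by simp [faceCells], by simp [faceCells]⟩
  · exact ⟨p', r', q', hp, hr, hq, by simp [faceCells], by simp [faceCells], by simp [faceCells]⟩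
  · exact ⟨r', q', p', hr, hq, hp, by simp [faceCells], by simp [faceCells], by simp [faceCells]⟩

theorem faceCell_mem_of_isPermutationOf {u v w u' v' w' : ℕ} (f : ℕ → ℕ)
    (h : IsPermutationOf u v w u' v' w') :
    faceCell k u' v' w' (f u') (f v') (f w') ∈ faceCells k u v w (f u) (f v) (f w) := by
  rcases h with (⟨rfl, rfl, rfl⟩ | ⟨rfl, rfl, rfl⟩ | ⟨rfl, rfl, rfl⟩) |
    (⟨rfl, rfl, rfl⟩ | ⟨rfl, rfl, rfl⟩ | ⟨rfl, rfl, rfl⟩) <;> simp [faceCells]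

theorem IsPermutationOf.swap_rotate {u v w p q r : ℕ} (h : IsPermutationOf u v w p q r) :
    IsPermutationOf u v w q p r ∧ IsPermutationOf u v w q r p := by
  unfold IsPermutationOf at *
  refine ⟨?_, h.imp (·.rotate) (·.rotate)⟩
  rcases h with (⟨rfl, rfl, rfl⟩ | ⟨rfl, rfl, rfl⟩ | ⟨rfl, rfl, rfl⟩) |
    (⟨rfl, rfl, rfl⟩ | ⟨rfl, rfl, rfl⟩ | ⟨rfl, rfl, rfl⟩) <;> simp [IsRotationOf]

theorem strictlyInside_of_mem_openTriangle {σ : ℝ} {u v w x : ℝ × ℝ}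
    (h : x ∈ openTriangle σ u v w) : StrictlyInside u v w x := by
  obtain ⟨h1, h2, h3⟩ := h
  rcases lt_trichotomy σ 0 with hσ | rfl | hσ
  · exact Or.inr ⟨(neg_iff_neg_of_mul_pos h1).1 hσ, (neg_iff_neg_of_mul_pos h2).1 hσ,
      (neg_iff_neg_of_mul_pos h3).1 hσ⟩
  · simp at h1
  · exact Or.inl ⟨(pos_iff_pos_of_mul_pos h1).1 hσ, (pos_iff_pos_of_mul_pos h2).1 hσ,
      (pos_iff_pos_of_mul_pos h3).1 hσ⟩

/-- The program's test ignores orientation. The three areas add up to that of the triangle, so the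
orientation of the triangle fixes theirs. -/
theorem StrictlyInside.mem_openTriangle {σ : ℝ} {u v w x : ℝ × ℝ} (h : StrictlyInside u v w x)
    (hD : 0 < σ * signedArea u v w) : x ∈ openTriangle σ u v w := by
  have e := signedArea_split u v w x
  rcases h with ⟨h1, h2, h3⟩ | ⟨h1, h2, h3⟩
  · have hσ : 0 < σ := (pos_iff_pos_of_mul_pos hD).2 (by linarith)
    exact ⟨mul_pos hσ h1, mul_pos hσ h2, mul_pos hσ h3⟩
  · have hσ : σ < 0 := (neg_iff_neg_of_mul_pos hD).2 (by linarith)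
    exact ⟨mul_pos_of_neg_of_neg hσ h1, mul_pos_of_neg_of_neg hσ h2,
      mul_pos_of_neg_of_neg hσ h3⟩

theorem StrictlyInside.swap {u v w x : ℝ × ℝ} (h : StrictlyInside u v w x) :
    StrictlyInside v u w x := by
  unfold StrictlyInside at *
  rw [signedArea_swap u v x, signedArea_swap w u x, signedArea_swap v w x]
  simp only [Left.neg_pos_iff, Left.neg_neg_iff]
  tauto

theorem reconstruct_lt {t : ℕ} {f : ℕ → ℕ} {n : ℕ} (hn : n ≤ k) (hf : ∀ v, f v < k)
    (hrec : ∀ j < t, M (recordCell k 0 j) < n)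
    (hw : ∀ x < k, ∀ p < k, ∀ q < k, ∀ r < k, M (witnessCell k x p q r) < k) :
    ∀ v, reconstruct k M t f v < k := by
  induction t generalizing f with
  | zero => exact hf
  | succ t ih =>
    refine ih (fun v => ?_) (fun j hj => hrec j (by omega))
    rw [Function.update_apply]
    split_ifs
    · exact hw _ ((hrec t (by omega)).trans_le hn) _ (hf _) _ (hf _) _ (hf _)
    · exact hf v

/-- Reconstruction reads only the records and the witnesses of the recorded vertices, so later
rounds may overwrite everything else. -/
theorem reconstruct_congr {t : ℕ} {f : ℕ → ℕ} {n : ℕ} (hn : n ≤ k) (hf : ∀ v, f v < k)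
    (hrec : ∀ j < t, M (recordCell k 0 j) < n)
    (hw : ∀ x < k, ∀ p < k, ∀ q < k, ∀ r < k, M (witnessCell k x p q r) < k)
    (h1 : ∀ j < t, ∀ i < 4, M' (recordCell k i j) = M (recordCell k i j))
    (h2 : ∀ j < t, ∀ p < k, ∀ q < k, ∀ r < k, M' (witnessCell k (M (recordCell k 0 j)) p q r) =
      M (witnessCell k (M (recordCell k 0 j)) p q r)) :
    reconstruct k M' t f = reconstruct k M t f := by
  induction t generalizing f with
  | zero => rfl
  | succ t ih =>
    simp only [reconstruct]
    rw [h1 t (by omega) 0 (by omega), h1 t (by omega) 1 (by omega), h1 t (by omega) 2 (by omega),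
      h1 t (by omega) 3 (by omega), h2 t (by omega) _ (hf _) _ (hf _) _ (hf _)]
    refine ih (fun v => ?_) (fun j hj => hrec j (by omega)) (fun j hj => h1 j (by omega))
      (fun j hj => h2 j (by omega))
    rw [Function.update_apply]
    split_ifs
    · exact hw _ ((hrec t (by omega)).trans_le hn) _ (hf _) _ (hf _) _ (hf _)
    · exact hf v

theorem IsOriented.congr {σ : ℝ} {A : Set ℕ} {F : ℕ → ℕ → ℕ → Prop} (fs : IsFaceSystem A F)
    {pos pos' : ℕ → ℝ × ℝ} (h : ∀ v ∈ A, pos v = pos' v) (ho : IsOriented σ F pos) :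
    IsOriented σ F pos' := fun p q r hp => by
  rw [← h p (fs.mem _ _ _ hp), ← h q (fs.mem₂ hp), ← h r (fs.mem₃ hp)]
  exact ho p q r hp

/-! ### One round preserves completeness and soundness -/

/-- The memory after a round: tables, removal mark and record. -/
structure IsRound (n k : ℕ) (pt : ℕ → ℝ × ℝ) (M M' : ℕ → ℕ) (t x u v w : ℕ) : Prop where
  entry : ∀ p < k, ∀ q < k, ∀ r < k, IsEntry k pt M M' x u v w p q r
  face : ∀ u' < k, ∀ v' < k, ∀ w' < k, ∀ p < k, ∀ q < k, ∀ r < k,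
    ¬ IsPermutationOf u v w u' v' w' →
      M' (faceCell k u' v' w' p q r) = M (faceCell k u' v' w' p q r)
  witness : ∀ x' < k, ∀ p < k, ∀ q < k, ∀ r < k, x' ≠ x →
    M' (witnessCell k x' p q r) = M (witnessCell k x' p q r)
  removed : ∀ v < n, M' (removedCell k v) = if v = x then 1 else M (removedCell k v)
  record : ∀ j < t, ∀ i < 4, M' (recordCell k i j) = M (recordCell k i j)
  record₀ : M' (recordCell k 0 t) = x
  record₁ : M' (recordCell k 1 t) = u
  record₂ : M' (recordCell k 2 t) = v
  record₃ : M' (recordCell k 3 t) = w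

variable {n a b c t : ℕ} {F₀ F : ℕ → ℕ → ℕ → Prop} {A : Set ℕ}

theorem IsRound.face_eq_zero {x u v w : ℕ} (h : IsRound n k pt M M' t x u v w) {f : ℕ → ℕ}
    (hf : ∀ v, f v < k) (hw : IsWitness k pt M x u v w (f u) (f v) (f w) (f x))
    {u' v' w' : ℕ} (hp : IsPermutationOf u v w u' v' w') :
    M' (faceCell k u' v' w' (f u') (f v') (f w')) = 0 := by
  obtain ⟨flag, hc, -, h⟩ := h.entry _ (hf u) _ (hf v) _ (hf w)
  rw [hc _ (faceCell_mem_of_isPermutationOf f hp)]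
  rcases h with h | h
  · exact h.1
  · exact absurd hw (h.2 _ (hf x))

theorem IsRound.isWitness {x u v w : ℕ} (h : IsRound n k pt M M' t x u v w) {f : ℕ → ℕ}
    (hf : ∀ v, f v < k) {u' v' w' : ℕ} (hp : IsPermutationOf u v w u' v' w')
    (h0 : M' (faceCell k u' v' w' (f u') (f v') (f w')) = 0) :
    IsWitness k pt M x u v w (f u) (f v) (f w) (M' (witnessCell k x (f u) (f v) (f w))) := by
  obtain ⟨flag, hc, -, h⟩ := h.entry _ (hf u) _ (hf v) _ (hf w)
  rw [hc _ (faceCell_mem_of_isPermutationOf f hp)] at h0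
  rcases h with h | h
  · exact h.2
  · omega

/-- Completeness is preserved when `x` is removed. -/
theorem IsRound.isAdmissible {x u v w : ℕ} (h : IsRound n k pt M M' t x u v w)
    {F' : ℕ → ℕ → ℕ → Prop} (fs' : IsFaceSystem (A \ {x}) F') {y z : ℕ}
    (hAk : ∀ v ∈ A, v < k)
    (hperm : ∀ p q r, IsRotationOf y z w p q r → IsPermutationOf u v w p q r)
    {σ : ℝ} {f : ℕ → ℕ} (hf : ∀ v, f v < k)
    (hadm : IsAdmissible k pt M (subdivide F' y z w x) σ f)
    (hw : IsWitness k pt M x u v w (f u) (f v) (f w) (f x)) :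
    IsAdmissible k pt M' F' σ f := by
  obtain ⟨ho, ht⟩ := hadm
  refine ⟨(isOriented_subdivide_iff.1 ho).1, fun p q r hp => ?_⟩
  -- Faces on the vertices `u`, `v`, `w` read the new flag, which is `0` because `f x` is a witness.
  -- The flags of all other faces are unchanged.
  by_cases hpp : IsPermutationOf u v w p q r
  · exact h.face_eq_zero hf hw hpp
  · rw [h.face p (hAk p (fs'.mem _ _ _ hp).1) q (hAk q (fs'.mem₂ hp).1) r
      (hAk r (fs'.mem₃ hp).1) _ (hf p) _ (hf q) _ (hf r) hpp]
    exact ht p q r (Or.inl ⟨hp, fun hr => hpp (hperm _ _ _ hr)⟩)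

/-- Soundness is preserved when `x` is removed. -/
theorem IsRound.isAdmissible_update {x u v w : ℕ} (h : IsRound n k pt M M' t x u v w)
    {F' : ℕ → ℕ → ℕ → Prop} (fs' : IsFaceSystem (A \ {x}) F') {y z : ℕ}
    (hAk : ∀ v ∈ A, v < k)
    (hperm : ∀ p q r, IsPermutationOf u v w p q r → IsRotationOf y z w p q r ∨
      IsRotationOf z y w p q r)
    (hF' : F' y z w)
    (hrot : ∀ u < k, ∀ v < k, ∀ w < k, ∀ p < k, ∀ q < k, ∀ r < k,
      M (faceCell k v w u q r p) = M (faceCell k u v w p q r))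
    {σ : ℝ} {f : ℕ → ℕ} (hf : ∀ v, f v < k) (hxk : x < k) {s : ℕ} (hs : s < k)
    (hadm : IsAdmissible k pt M' F' σ f)
    (hw : IsWitness k pt M x y z w (f y) (f z) (f w) s) :
    IsAdmissible k pt M (subdivide F' y z w x) σ (Function.update f x s) := by
  obtain ⟨ho, ht⟩ := hadm
  have hne : ∀ v ∈ A \ {x}, Function.update f x s v = f v := fun v hv => by
    exact Function.update_of_ne (fun e => hv.2 e) ..
  have ey := hne y (fs'.mem _ _ _ hF')
  have ez := hne z (fs'.mem₂ hF')
  have ew := hne w (fs'.mem₃ hF')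
  have ex : Function.update f x s x = s := by simp
  have hy := hAk y (fs'.mem _ _ _ hF').1
  have hz := hAk z (fs'.mem₂ hF').1
  have hwk := hAk w (fs'.mem₃ hF').1
  constructor
  · rw [isOriented_subdivide_iff]
    refine ⟨ho.congr fs' (fun v hv => by rw [hne v hv]), ?_⟩
    simp only [ex, ey, ez, ew]
    -- The merged face has orientation `σ`, and the point chosen for `x` inherits it.
    exact hw.1.mem_openTriangle (ho _ _ _ hF')
  · have rot : ∀ p q, p < k → q < k → Function.update f x s p = f p →
        Function.update f x s q = f q → M (faceCell k p q x (f p) (f q) s) = 0 →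
        ∀ p' q' r', IsRotationOf p q x p' q' r' → M (faceCell k p' q' r'
          (Function.update f x s p') (Function.update f x s q') (Function.update f x s r')) = 0 := by
      intro p q hp hq ep eq h0 p' q' r' hr
      rcases hr with ⟨rfl, rfl, rfl⟩ | ⟨rfl, rfl, rfl⟩ | ⟨rfl, rfl, rfl⟩
      · rwa [ep, eq, ex]
      · rw [ep, eq, ex, hrot _ hp _ hq _ hxk _ (hf _) _ (hf _) _ hs]; exact h0
      · rw [ep, eq, ex, hrot _ hq _ hxk _ hp _ (hf _) _ hs _ (hf _),
          hrot _ hp _ hq _ hxk _ (hf _) _ (hf _) _ hs]; exact h0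
    rintro p q r (⟨hp, hn⟩ | hr | hr | hr)
    · have m1 := fs'.mem _ _ _ hp
      have m2 := fs'.mem₂ hp
      have m3 := fs'.mem₃ hp
      rw [hne p m1, hne q m2, hne r m3,
        ← h.face p (hAk p m1.1) q (hAk q m2.1) r (hAk r m3.1) _ (hf p) _ (hf q) _ (hf r)]
      · exact ht p q r hp
      · intro hpp
        rcases hperm _ _ _ hpp with hr | hr
        · exact hn hr
        -- A face on the same three vertices with the opposite direction cannot also have a positive
        -- area for `σ`.
        · have o1 := ho _ _ _ hp
          have o2 := ho _ _ _ hF'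
          rw [signedArea_of_rotation (pos := fun v => pt (f v)) hr] at o1
          have := signedArea_swap (pt (f y)) (pt (f z)) (pt (f w))
          rw [this] at o1
          linarith
    · exact rot y z hy hz ey ez hw.2.1 _ _ _ hr
    · exact rot z w hz hwk ez ew hw.2.2.1 _ _ _ hr
    · exact rot w y hwk hy ew ey hw.2.2.2 _ _ _ hr

theorem IsWitness.swap {x u v w p q r s : ℕ}
    (hswap : ∀ u < k, ∀ v < k, ∀ w < k, ∀ p < k, ∀ q < k, ∀ r < k,
      M (faceCell k v u w q p r) = M (faceCell k u v w p q r))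
    (hx : x < k) (hu : u < k) (hv : v < k) (hw : w < k) (hp : p < k) (hq : q < k) (hr : r < k)
    (hs : s < k) (h : IsWitness k pt M x u v w p q r s) : IsWitness k pt M x v u w q p r s := by
  obtain ⟨h1, h2, h3, h4⟩ := h
  refine ⟨h1.swap, ?_, ?_, ?_⟩
  · rwa [hswap _ hu _ hv _ hx _ hp _ hq _ hs]
  · rwa [hswap _ hw _ hu _ hx _ hr _ hp _ hs]
  · rwa [hswap _ hv _ hw _ hx _ hq _ hr _ hs]

/-- The program knows the neighbours of `x` only as an unoriented list `u`, `v`, `w`. The names `y`,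
`z` are `u`, `v` in the order in which they occur in the merged face; symmetry of the tables bridges
the difference. -/
theorem IsReduction.step_aux (hn : n ≤ k) (hab : a ≠ b) (hbc : b ≠ c) (hca : c ≠ a)
    (hI : IsReduction n k pt a b c F₀ M t A F) {x u v w : ℕ} (hx : x ∈ A)
    (huA : u ∈ A) (hvA : v ∈ A) (hwA : w ∈ A)
    (h : IsRound n k pt M M' t x u v w) {F' : ℕ → ℕ → ℕ → Prop}
    (hD : StackedDisc a b c (A \ {x}) F') {y z : ℕ}
    (hyz : (y = u ∧ z = v) ∨ (y = v ∧ z = u)) (hF' : F' y z w)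
    (hF : F = subdivide F' y z w x) :
    IsReduction n k pt a b c F₀ M' (t + 1) (A \ {x}) F' := by
  have fs' := hD.isFaceSystem hab hbc hca
  have hfin : A.Finite := (Set.finite_lt_nat n).subset hI.lt
  have hAk : ∀ v ∈ A, v < k := fun v hv => (hI.lt v hv).trans_le hn
  have hxA' : x ∉ A \ {x} := fun h => h.2 rfl
  have hxk := hAk x hx
  have huk := hAk u huA
  have hvk := hAk v hvA
  have hwk := hAk w hwA
  have hperm : ∀ p q r, IsPermutationOf u v w p q r ↔ IsRotationOf y z w p q r ∨
      IsRotationOf z y w p q r := by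
    intro p q r
    rcases hyz with ⟨rfl, rfl⟩ | ⟨rfl, rfl⟩
    · rfl
    · exact or_comm
  have hwit : ∀ {p q r s : ℕ}, p < k → q < k → r < k → s < k →
      (IsWitness k pt M x u v w p q r s → IsWitness k pt M x v u w q p r s) :=
    fun hp hq hr hs => IsWitness.swap hI.swap hxk huk hvk hwk hp hq hr hs
  have hwit' : ∀ {p q r s : ℕ}, p < k → q < k → r < k → s < k →
      (IsWitness k pt M x v u w q p r s → IsWitness k pt M x u v w p q r s) :=
    fun hp hq hr hs => IsWitness.swap hI.swap hxk hvk huk hwk hq hp hr hs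
  have sym : ∀ u' < k, ∀ v' < k, ∀ w' < k, ∀ p < k, ∀ q < k, ∀ r < k,
      M' (faceCell k v' u' w' q p r) = M' (faceCell k u' v' w' p q r) ∧
      M' (faceCell k v' w' u' q r p) = M' (faceCell k u' v' w' p q r) := by
    intro u' hu v' hv w' hw p hp q hq r hr
    by_cases hpp : IsPermutationOf u v w u' v' w'
    · obtain ⟨p₁, q₁, r₁, hp₁, hq₁, hr₁, m1, m2, m3⟩ :=
        exists_place_of_isPermutationOf hpp hp hq hr
      obtain ⟨flag, hc, -⟩ := h.entry _ hp₁ _ hq₁ _ hr₁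
      rw [hc _ m1, hc _ m2, hc _ m3]
      simp
    · have n1 : ¬ IsPermutationOf u v w v' u' w' := fun e => hpp e.swap_rotate.1
      have n2 : ¬ IsPermutationOf u v w v' w' u' := fun e =>
        hpp e.swap_rotate.2.swap_rotate.2
      rw [h.face _ hu _ hv _ hw _ hp _ hq _ hr hpp, h.face _ hv _ hu _ hw _ hq _ hp _ hr n1,
        h.face _ hv _ hw _ hu _ hq _ hr _ hp n2]
      exact ⟨hI.swap _ hu _ hv _ hw _ hp _ hq _ hr, hI.rotate _ hu _ hv _ hw _ hp _ hq _ hr⟩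
  have hwitlt : ∀ x' < k, ∀ p < k, ∀ q < k, ∀ r < k, M' (witnessCell k x' p q r) < k := by
    intro x' hx' p hp q hq r hr
    by_cases e : x' = x
    · subst e
      obtain ⟨_, -, h, -⟩ := h.entry _ hp _ hq _ hr
      exact h
    · rw [h.witness _ hx' _ hp _ hq _ hr e]
      exact hI.witness _ hx' _ hp _ hq _ hr
  refine ⟨hD, ?_, fun v hv => hI.lt v hv.1, ?_, ?_, fun u hu v hv w hw p hp q hq r hr =>
    (sym u hu v hv w hw p hp q hq r hr).1, fun u hu v hv w hw p hp q hq r hr =>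
    (sym u hu v hv w hw p hp q hq r hr).2, hwitlt, ?_, ?_, ?_, ?_⟩
  · have := Set.ncard_sdiff_singleton_add_one hx hfin
    have := hI.card
    omega
  · intro v hv
    rw [h.removed v hv]
    split_ifs with e
    · simp [e]
    · rw [hI.removed v hv]
      simp [e]
  · intro p hp q hq
    rw [← hI.adj p hp.1 q hq.1, hF, faceAdj_subdivide_iff fs' hF' hp.2 hq.2]
  · intro j hj i hi
    rcases Nat.lt_succ_iff_lt_or_eq.1 hj with hj | rfl
    · rw [h.record j hj i hi]
      exact hI.record j hj i hi
    · interval_cases i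
      · rw [h.record₀]; exact hI.lt _ hx
      · rw [h.record₁]; exact hI.lt _ huA
      · rw [h.record₂]; exact hI.lt _ hvA
      · rw [h.record₃]; exact hI.lt _ hwA
  · intro j hj
    rcases Nat.lt_succ_iff_lt_or_eq.1 hj with hj | rfl
    · rw [h.record j hj 0 (by omega)]
      exact fun e => hI.record_removed j hj e.1
    · rw [h.record₀]; exact hxA'
  -- Completeness: in a given drawing, the position of `x` is itself a witness at the place of its
  -- neighbours.
  · intro σ f hf ho
    have hadm := hI.complete σ f hf ho
    rw [hF] at hadm
    refine h.isAdmissible fs' hAk (fun p q r hr => (hperm p q r).2 (Or.inl hr)) hf hadm ?_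
    have hT := (isOriented_subdivide_iff.1 hadm.1).2
    have hw : IsWitness k pt M x y z w (f y) (f z) (f w) (f x) :=
      ⟨strictlyInside_of_mem_openTriangle hT,
        hadm.2 _ _ _ (Or.inr (Or.inl (.refl ..))),
        hadm.2 _ _ _ (Or.inr (Or.inr (Or.inl (.refl ..)))),
        hadm.2 _ _ _ (Or.inr (Or.inr (Or.inr (.refl ..))))⟩
    rcases hyz with ⟨rfl, rfl⟩ | ⟨rfl, rfl⟩
    · exact hw
    · exact hwit' (hf _) (hf _) (hf _) (hf _) hw
  -- Soundness: the stored witness extends the placement to `x`, and the earlier reconstruction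
  -- takes over from there.
  · intro σ f hf hadm
    set s := M' (witnessCell k x (f u) (f v) (f w)) with hs
    have hsk : s < k := hwitlt _ hxk _ (hf _) _ (hf _) _ (hf _)
    have hw : IsWitness k pt M x u v w (f u) (f v) (f w) s :=
      h.isWitness hf ((hperm y z w).2 (Or.inl (.refl ..))) (hadm.2 _ _ _ hF')
    have hw' : IsWitness k pt M x y z w (f y) (f z) (f w) s := by
      rcases hyz with ⟨rfl, rfl⟩ | ⟨rfl, rfl⟩
      · exact hw
      · exact hwit (hf _) (hf _) (hf _) hsk hw
    have := h.isAdmissible_update fs' hAk (fun p q r => (hperm p q r).1) hF' hI.rotate hf hxk hsk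
      hadm hw'
    rw [← hF] at this
    have hf' : ∀ v, Function.update f x s v < k := fun v => by
      rw [Function.update_apply]; split_ifs
      · exact hsk
      · exact hf v
    have hso := hI.sound σ _ hf' this
    simp only [reconstruct, h.record₀, h.record₁, h.record₂, h.record₃]
    -- Vertices recorded earlier have left `A`, so they differ from `x` and their witnesses survived
    -- this round.
    rw [← hs, reconstruct_congr hn hf' (fun j hj => hI.record j hj 0 (by omega)) hI.witness
      h.record (fun j hj p hp q hq r hr => h.witness _
        ((hI.record j hj 0 (by omega)).trans_le hn) _ hp _ hq _ hr
          (fun e => hI.record_removed j hj (e ▸ hx)))]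
    exact hso

theorem IsReduction.step (hn : n ≤ k) (hab : a ≠ b) (hbc : b ≠ c) (hca : c ≠ a)
    (hI : IsReduction n k pt a b c F₀ M t A F) {x u v w : ℕ} (hx : x ∈ A)
    (hxo : x ∉ ({a, b, c} : Set ℕ)) (hN : ∀ y, FaceAdj F x y ↔ y = u ∨ y = v ∨ y = w)
    (h : IsRound n k pt M M' t x u v w) :
    ∃ F', IsReduction n k pt a b c F₀ M' (t + 1) (A \ {x}) F' := by
  have fs := hI.disc.isFaceSystem hab hbc hca
  have hu := ((hN u).2 (by simp)).mem fs
  have hv := ((hN v).2 (by simp)).mem fs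
  have hw := ((hN w).2 (by simp)).mem fs
  obtain ⟨F', hD, ⟨hF', hF⟩ | ⟨hF', hF⟩⟩ := hI.disc.exists_remove hab hbc hca hx hxo hN
  · exact ⟨F', hI.step_aux hn hab hbc hca hx hu hv hw h hD (Or.inl ⟨rfl, rfl⟩) hF' hF⟩
  · exact ⟨F', hI.step_aux hn hab hbc hca hx hu hv hw h hD (Or.inr ⟨rfl, rfl⟩) hF' hF⟩

end Tables

/-! ## The program: selecting a vertex of degree three -/

section SelectVertex

namespace HaltsWithin

variable {P P' : RAMProg} {T T' T'' : ℕ} {Q : RAMState → Prop} {σ : RAMState}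

theorem seq' (h : HaltsWithin P T (HaltsWithin P' T' Q) σ) (hT : T + T' ≤ T'') :
    HaltsWithin (.seq P P') T'' Q σ :=
  h.seq.mono hT fun _ => id

theorem instr_seq {i : RAMInstr} (h : HaltsWithin P' T' Q (i.exec σ)) (hT : 1 + T' ≤ T'') :
    HaltsWithin (.seq (.instr i) P') T'' Q σ :=
  seq' (instr h le_rfl) hT

theorem block_seq {i : RAMInstr} {l : List RAMInstr}
    (h : HaltsWithin P' T' Q ((i :: l).foldl (fun s i => i.exec s) σ))
    (hT : l.length + 1 + T' ≤ T'') : HaltsWithin (.seq (.block i l) P') T'' Q σ :=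
  seq' (block h) hT

theorem block' {i : RAMInstr} {l : List RAMInstr}
    (h : Q ((i :: l).foldl (fun s i => i.exec s) σ)) (hT : l.length + 1 ≤ T) :
    HaltsWithin (.block i l) T Q σ :=
  (block h).mono hT fun _ => id

theorem ite' {b : RAMTest} (h1 : b.Holds σ → HaltsWithin P T Q σ)
    (h2 : ¬ b.Holds σ → HaltsWithin P' T Q σ) (hT : 1 + T ≤ T') :
    HaltsWithin (.ite b P P') T' Q σ :=
  (ite h1 h2).mono hT fun _ => id

theorem addressTo_seq {ρ d t : ℕ} {l : List ℕ} (h : IsTidy σ) (hρ : ρ < 7 ∨ 10 ≤ ρ)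
    (hd : 10 ≤ d) (hl : ∀ e ∈ l, e < 7 ∨ 10 ≤ e)
    (hQ : HaltsWithin P' T' Q (σ.setI d (hornerValue (σ.I ρ) t (l.map σ.I))))
    (hT : l.length * (3 * σ.I ρ + 4) + 5 + T' ≤ T'') :
    HaltsWithin (.seq (addressTo ρ d t l) P') T'' Q σ :=
  seq' (haltsWithin_addressTo h hρ hd hl le_rfl hQ) hT

end HaltsWithin

/-- The neighbours `y < j` of `x` that have not been removed, in descending order. -/
def remainingNeighbors (n k : ℕ) (M : ℕ → ℕ) (x j : ℕ) : List ℕ :=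
  ((List.range j).filter (fun y => M (x * n + y) ≠ 0 ∧ M (removedCell k y) = 0)).reverse

theorem remainingNeighbors_succ (n k : ℕ) (M : ℕ → ℕ) (x j : ℕ) :
    remainingNeighbors n k M x (j + 1) =
      if M (x * n + j) ≠ 0 ∧ M (removedCell k j) = 0 then j :: remainingNeighbors n k M x j
      else remainingNeighbors n k M x j := by
  unfold remainingNeighbors
  rw [List.range_succ, List.filter_append, List.reverse_append]
  split_ifs with h <;> simp [h]

theorem mem_remainingNeighbors {n k : ℕ} {M : ℕ → ℕ} {x j y : ℕ} :
    y ∈ remainingNeighbors n k M x j ↔ y < j ∧ M (x * n + y) ≠ 0 ∧ M (removedCell k y) = 0 := by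
  simp [remainingNeighbors]

theorem nodup_remainingNeighbors (n k : ℕ) (M : ℕ → ℕ) (x j : ℕ) :
    (remainingNeighbors n k M x j).Nodup :=
  List.nodup_reverse.2 (List.nodup_range.filter _)

/-- Appends the vertex in register `17` to the list in registers `18` (length), `19`, `20`, `21`
if it is a remaining neighbour of the vertex in register `16`. -/
def neighborStep : RAMProg :=
  .seq (addressTo 0 22 0 [16, 17]) <| .seq (.instr (.load 22 22)) <|
  -- Resetting the scratch register `22` plays the role of an empty program.
  .ite (.eq 22 5) (.instr (.const 22 0)) <|
  .seq (addressTo 1 22 3 [17, 5, 5, 5, 5, 5]) <| .seq (.instr (.load 22 22)) <|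
  -- The entries are shifted by one place. More than three neighbours push the oldest ones out, but
  -- register `18` still counts them all.
  .ite (.eq 22 5) (.block (.add 21 20 5) [.add 20 19 5, .add 19 17 5, .add 18 18 6])
    (.instr (.const 22 0))

/-- Lists the remaining neighbours of the vertex in register `16`. -/
def listNeighbors : RAMProg :=
  .seq (.block (.const 18 0) [.const 19 0, .const 20 0, .const 21 0]) (.for 17 0 neighborStep)

/-- Registers `18` to `21` hold the length and the first entries of `l`. -/
def HoldsList (σ : RAMState) (l : List ℕ) : Prop :=
  σ.I 18 = l.length ∧ σ.I 19 = l.getD 0 0 ∧ σ.I 20 = l.getD 1 0 ∧ σ.I 21 = l.getD 2 0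

/-- Memory, real memory, the real registers and the word registers below `m` are unchanged. -/
def SameBelow (m : ℕ) (σ τ : RAMState) : Prop :=
  (∀ r < m, τ.I r = σ.I r) ∧ τ.R = σ.R ∧ τ.M = σ.M ∧ τ.X = σ.X

theorem SameBelow.refl (m : ℕ) (σ : RAMState) : SameBelow m σ σ :=
  ⟨fun _ _ => rfl, rfl, rfl, rfl⟩

theorem SameBelow.trans {m m' : ℕ} {σ τ υ : RAMState} (h : SameBelow m σ τ)
    (h' : SameBelow m' τ υ) (hm : m ≤ m') : SameBelow m σ υ :=
  ⟨fun r hr => (h'.1 r (hr.trans_le hm)).trans (h.1 r hr), h'.2.1.trans h.2.1,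
    h'.2.2.1.trans h.2.2.1, h'.2.2.2.trans h.2.2.2⟩

theorem SameBelow.setI {m : ℕ} {σ τ : RAMState} (h : SameBelow m σ τ) {d : ℕ} (v : ℕ)
    (hd : m ≤ d) : SameBelow m σ (τ.setI d v) := by
  refine ⟨fun r hr => ?_, h.2⟩
  rw [RAMState.setI_I, if_neg (by omega)]
  exact h.1 r hr

theorem SameBelow.isTidy {m : ℕ} {σ τ : RAMState} (h : SameBelow m σ τ) (hm : 10 ≤ m)
    (hσ : IsTidy σ) : IsTidy τ :=
  hσ.of_eq fun r hr => h.1 r (by omega)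

theorem HoldsList.setI {σ : RAMState} {l : List ℕ} (h : HoldsList σ l) {d : ℕ} (v : ℕ)
    (hd : d < 18 ∨ 21 < d) : HoldsList (σ.setI d v) l := by
  obtain ⟨h1, h2, h3, h4⟩ := h
  refine ⟨?_, ?_, ?_, ?_⟩ <;> rw [RAMState.setI_I, if_neg (by omega)] <;> assumption

theorem haltsWithin_neighborStep {n k x y : ℕ} {l : List ℕ} {σ : RAMState} {Q : RAMState → Prop}
    (ht : IsTidy σ) (h0 : σ.I 0 = n) (h1 : σ.I 1 = k) (hn : n ≤ k) (h16 : σ.I 16 = x)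
    (h17 : σ.I 17 = y) (hl : HoldsList σ l)
    (hQ : ∀ τ, SameBelow 18 σ τ → HoldsList τ
      (if σ.M (x * n + y) ≠ 0 ∧ σ.M (removedCell k y) = 0 then y :: l else l) → Q τ) :
    HaltsWithin neighborStep (24 * k + 60) Q σ := by
  have hs := SameBelow.refl 18 σ
  refine HaltsWithin.addressTo_seq (T' := 18 * k + 40) ht (by norm_num) (by norm_num)
    (by simp) ?_ (by simp only [List.length_cons, List.length_nil, h0]; omega)
  refine HaltsWithin.instr_seq (T' := 18 * k + 39) ?_ (by omega)
  have e : hornerValue (σ.I 0) 0 ([16, 17].map σ.I) = x * n + y := by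
    simp [hornerValue, h0, h16, h17]
  rw [e]
  simp only [RAMInstr.exec_load, RAMState.setI_I, if_true, RAMState.setI_M]
  refine HaltsWithin.ite' (T := 18 * k + 38) (fun hb => ?_) (fun hb => ?_) (by omega)
  · simp only [RAMTest.Holds, RAMState.setI_I, if_true] at hb
    simp only [show (5 : ℕ) ≠ 22 by norm_num, if_false, ht.h5] at hb
    refine HaltsWithin.instr (hQ _ (((hs.setI _ (by norm_num)).setI _ (by norm_num)).setI _
      (by norm_num)) ?_) (by omega)
    rw [if_neg (by simp [hb])]
    exact ((hl.setI _ (by norm_num)).setI _ (by norm_num)).setI _ (by norm_num)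
  · simp only [RAMTest.Holds, RAMState.setI_I, if_true] at hb
    simp only [show (5 : ℕ) ≠ 22 by norm_num, if_false, ht.h5] at hb
    set τ := (σ.setI 22 (x * n + y)).setI 22 (σ.M (x * n + y)) with hτ
    have hsτ : SameBelow 18 σ τ := (hs.setI _ (by norm_num)).setI _ (by norm_num)
    have hlτ : HoldsList τ l := (hl.setI _ (by norm_num)).setI _ (by norm_num)
    have ht' := hsτ.isTidy (by norm_num) ht
    have e1 : τ.I 1 = k := (hsτ.1 1 (by norm_num)).trans h1
    have e17 : τ.I 17 = y := (hsτ.1 17 (by norm_num)).trans h17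
    refine HaltsWithin.addressTo_seq (T' := 9) ht' (by norm_num) (by norm_num)
      (by simp) ?_ (by simp only [List.length_cons, List.length_nil, e1]; omega)
    refine HaltsWithin.instr_seq (T' := 8) ?_ (by omega)
    have e : hornerValue (τ.I 1) 3 ([17, 5, 5, 5, 5, 5].map τ.I) = removedCell k y := by
      simp [removedCell, e17, e1, ht'.h5]
    rw [e]
    simp only [RAMInstr.exec_load, RAMState.setI_I, if_true, RAMState.setI_M]
    rw [hsτ.2.2.1]
    refine HaltsWithin.ite' (T := 4) (fun hb' => ?_) (fun hb' => ?_) (by omega)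
    · simp only [RAMTest.Holds, RAMState.setI_I, if_true] at hb'
      simp only [show (5 : ℕ) ≠ 22 by norm_num, if_false, ht'.h5] at hb'
      refine HaltsWithin.block' (hQ _ ?_ ?_) (by simp)
      · simp only [List.foldl_cons, List.foldl_nil, RAMInstr.exec_add]
        exact (((((hsτ.setI _ (by norm_num)).setI _ (by norm_num)).setI _
          (by norm_num)).setI _ (by norm_num)).setI _ (by norm_num)).setI _ (by norm_num)
      · rw [if_pos ⟨hb, hb'⟩]
        obtain ⟨l1, l2, l3, l4⟩ := hlτ
        simp [HoldsList, l1, l2, l3, ht'.h5, ht'.h6, e17]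
    · simp only [RAMTest.Holds, RAMState.setI_I, if_true] at hb'
      simp only [show (5 : ℕ) ≠ 22 by norm_num, if_false, ht'.h5] at hb'
      refine HaltsWithin.instr (hQ _ (((hsτ.setI _ (by norm_num)).setI _ (by norm_num)).setI _
        (by norm_num)) ?_) (by omega)
      rw [if_neg (by simp [hb'])]
      exact ((hlτ.setI _ (by norm_num)).setI _ (by norm_num)).setI _ (by norm_num)

theorem haltsWithin_listNeighbors {n k x : ℕ} {σ : RAMState} {Q : RAMState → Prop}
    (ht : IsTidy σ) (h0 : σ.I 0 = n) (h1 : σ.I 1 = k) (hn : n ≤ k) (h16 : σ.I 16 = x)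
    (hQ : ∀ τ, SameBelow 17 σ τ → HoldsList τ (remainingNeighbors n k σ.M x n) → Q τ) :
    HaltsWithin listNeighbors (n * (24 * k + 62) + 6) Q σ := by
  refine HaltsWithin.block_seq (T' := n * (24 * k + 62) + 2) ?_
    (by simp only [List.length_cons, List.length_nil]; omega)
  simp only [List.foldl_cons, List.foldl_nil, RAMInstr.exec_const]
  set τ₀ := (((σ.setI 18 0).setI 19 0).setI 20 0).setI 21 0
  have hs₀ : SameBelow 17 σ τ₀ := ((((SameBelow.refl 17 σ).setI _ (by norm_num)).setI _
    (by norm_num)).setI _ (by norm_num)).setI _ (by norm_num)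
  refine HaltsWithin.for (N := n) (T := 24 * k + 60)
    (fun j τ => SameBelow 17 σ τ ∧ HoldsList τ (remainingNeighbors n k σ.M x j)) (by norm_num)
    (by norm_num)
    (fun j τ v h => ⟨h.1.setI _ (by norm_num), h.2.setI _ (by norm_num)⟩)
    ((hs₀.1 0 (by norm_num)).trans h0) ((hs₀.1 6 (by norm_num)).trans ht.h6)
    ⟨hs₀, by simp [HoldsList, τ₀, remainingNeighbors]⟩ ?_ (fun τ _ _ h => hQ τ h.1 h.2) le_rfl
  rintro j hj τ h17 h0' h6 ⟨hs, hl⟩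
  refine haltsWithin_neighborStep (x := x) (hs.isTidy (by norm_num) ht) h0'
    ((hs.1 1 (by norm_num)).trans h1) hn ((hs.1 16 (by norm_num)).trans h16) h17 hl ?_
  intro τ' hs' hl'
  refine ⟨(hs'.1 17 (by norm_num)).trans h17, (hs'.1 0 (by norm_num)).trans h0',
    (hs'.1 6 (by norm_num)).trans h6, hs.trans hs' (by norm_num), ?_⟩
  rw [remainingNeighbors_succ]
  rwa [hs.2.2.1] at hl'

/-- If the vertex in register `16` is an inner vertex with three remaining neighbours, it is
copied to register `12` and its neighbours to registers `13`, `14`, `15`. -/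
def selectStep : RAMProg :=
  .seq listNeighbors <| .seq (addressTo 1 22 3 [16, 5, 5, 5, 5, 5]) <|
  .seq (.block (.load 22 22) [.const 23 3]) <|
  .ite (.eq 22 5) (.ite (.eq 16 2) (.instr (.const 22 0)) <|
    .ite (.eq 16 3) (.instr (.const 22 0)) <| .ite (.eq 16 4) (.instr (.const 22 0)) <|
    .ite (.eq 18 23) (.block (.add 12 16 5) [.add 13 19 5, .add 14 20 5, .add 15 21 5])
      (.instr (.const 22 0)))
    (.instr (.const 22 0))

/-- Selects a removable vertex. -/
def selectVertex : RAMProg := .for 16 0 selectStep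

/-- `x` is an inner vertex with exactly three remaining neighbours, and not removed itself. -/
def IsRemovable (n k a b c : ℕ) (M : ℕ → ℕ) (x : ℕ) : Prop :=
  M (removedCell k x) = 0 ∧ x ≠ a ∧ x ≠ b ∧ x ≠ c ∧ (remainingNeighbors n k M x n).length = 3

/-- Registers `12` to `15` hold a removable vertex and its neighbours. -/
def HoldsRemovable (n k a b c : ℕ) (M : ℕ → ℕ) (σ : RAMState) : Prop :=
  σ.I 12 < n ∧ IsRemovable n k a b c M (σ.I 12) ∧
    remainingNeighbors n k M (σ.I 12) n = [σ.I 13, σ.I 14, σ.I 15]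

theorem HoldsRemovable.of_eq {n k a b c : ℕ} {M : ℕ → ℕ} {σ τ : RAMState}
    (h : HoldsRemovable n k a b c M σ) (h12 : τ.I 12 = σ.I 12) (h13 : τ.I 13 = σ.I 13)
    (h14 : τ.I 14 = σ.I 14) (h15 : τ.I 15 = σ.I 15) : HoldsRemovable n k a b c M τ := by
  unfold HoldsRemovable
  rwa [h12, h13, h14, h15]

theorem haltsWithin_selectStep {n k a b c x : ℕ} {σ : RAMState} {Q : RAMState → Prop}
    (ht : IsTidy σ) (h0 : σ.I 0 = n) (h1 : σ.I 1 = k) (h2 : σ.I 2 = a) (h3 : σ.I 3 = b)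
    (h4 : σ.I 4 = c) (hn : n ≤ k) (h16 : σ.I 16 = x) (hx : x < n)
    (hyes : ∀ τ, SameBelow 12 σ τ → τ.I 16 = x → HoldsRemovable n k a b c σ.M τ → Q τ)
    (hno : ¬ IsRemovable n k a b c σ.M x → ∀ τ, SameBelow 17 σ τ → Q τ) :
    HaltsWithin selectStep (n * (24 * k + 62) + 18 * k + 60) Q σ := by
  refine HaltsWithin.seq' (T' := 18 * k + 54) (haltsWithin_listNeighbors ht h0 h1 hn h16 ?_)
    (by omega)
  intro τ hs hl
  have ht' := hs.isTidy (by norm_num) ht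
  have e1 : τ.I 1 = k := (hs.1 1 (by norm_num)).trans h1
  have e16 : τ.I 16 = x := (hs.1 16 (by norm_num)).trans h16
  refine HaltsWithin.addressTo_seq (T' := 25) ht' (by norm_num) (by norm_num)
    (by simp) ?_ (by simp only [List.length_cons, List.length_nil, e1]; omega)
  have e : hornerValue (τ.I 1) 3 ([16, 5, 5, 5, 5, 5].map τ.I) = removedCell k x := by
    simp [removedCell, e16, e1, ht'.h5]
  rw [e]
  refine HaltsWithin.block_seq (T' := 23) ?_ (by simp)
  simp only [List.foldl_cons, List.foldl_nil, RAMInstr.exec_load, RAMInstr.exec_const,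
    RAMState.setI_I, if_true, RAMState.setI_M]
  set τ₁ := ((τ.setI 22 (removedCell k x)).setI 22 (τ.M (removedCell k x))).setI 23 3 with hτ₁
  have hs₁ : SameBelow 17 σ τ₁ := ((hs.setI _ (by norm_num)).setI _ (by norm_num)).setI _
    (by norm_num)
  have hl₁ : HoldsList τ₁ (remainingNeighbors n k σ.M x n) :=
    ((hl.setI _ (by norm_num)).setI _ (by norm_num)).setI _ (by norm_num)
  have g2 : τ₁.I 2 = a := (hs₁.1 2 (by norm_num)).trans h2
  have g3 : τ₁.I 3 = b := (hs₁.1 3 (by norm_num)).trans h3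
  have g4 : τ₁.I 4 = c := (hs₁.1 4 (by norm_num)).trans h4
  have g5 : τ₁.I 5 = 0 := (hs₁.1 5 (by norm_num)).trans ht.h5
  have g16 : τ₁.I 16 = x := (hs₁.1 16 (by norm_num)).trans h16
  have g22 : τ₁.I 22 = σ.M (removedCell k x) := by simp [hτ₁, hs.2.2.1]
  have g23 : τ₁.I 23 = 3 := by simp [hτ₁]
  have skip : ¬ IsRemovable n k a b c σ.M x → ∀ {T}, 1 ≤ T →
      HaltsWithin (.instr (.const 22 0)) T Q τ₁ := fun hn T hT =>
    HaltsWithin.instr (hno hn _ (hs₁.setI _ (by norm_num))) hT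
  refine HaltsWithin.ite' (T := 20) (fun hb => ?_) (fun hb => skip ?_ (by omega)) (by omega)
  · refine HaltsWithin.ite' (T := 19) (fun hba => skip ?_ (by omega)) (fun hba => ?_) (by omega)
    · simp only [RAMTest.Holds, g16, g2] at hba; exact fun h => h.2.1 hba
    refine HaltsWithin.ite' (T := 18) (fun hbb => skip ?_ (by omega)) (fun hbb => ?_) (by omega)
    · simp only [RAMTest.Holds, g16, g3] at hbb; exact fun h => h.2.2.1 hbb
    refine HaltsWithin.ite' (T := 17) (fun hbc => skip ?_ (by omega)) (fun hbc => ?_) (by omega)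
    · simp only [RAMTest.Holds, g16, g4] at hbc; exact fun h => h.2.2.2.1 hbc
    refine HaltsWithin.ite' (T := 16) (fun hbd => ?_) (fun hbd => skip ?_ (by omega)) (by omega)
    · simp only [RAMTest.Holds, g16, g2, g3, g4, g5, g22, g23] at hb hba hbb hbc hbd
      obtain ⟨l1, l2, l3, l4⟩ := hl₁
      rw [hbd] at l1
      refine HaltsWithin.block' (hyes _ ?_ ?_ ?_) (by simp)
      · simp only [List.foldl_cons, List.foldl_nil, RAMInstr.exec_add]
        exact (((SameBelow.trans (SameBelow.refl 12 σ) hs₁ (by norm_num)).setI _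
          (by norm_num)).setI _ (by norm_num)).setI _ (by norm_num) |>.setI _ (by norm_num)
      · simp [g16]
      · obtain ⟨p, q, r, hpqr⟩ := List.length_eq_three.1 l1.symm
        rw [hpqr] at l2 l3 l4
        simp only [List.foldl_cons, List.foldl_nil, RAMInstr.exec_add, HoldsRemovable,
          RAMState.setI_I]
        simp only [g16, g5]
        norm_num
        refine ⟨hx, ⟨hb, hba, hbb, hbc, l1.symm⟩, ?_⟩
        rw [hpqr, l2, l3, l4]
        simp
    · simp only [RAMTest.Holds, g23, hl₁.1] at hbd; exact fun h => hbd h.2.2.2.2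
  · simp only [RAMTest.Holds, g22, g5] at hb; exact fun h => hb h.1

/-- The scan has no early exit: every removable vertex overwrites the previous choice, and any
choice will do. Its `O(n ^ 2 * k)` steps are negligible against `k ^ 4`. -/
theorem haltsWithin_selectVertex {n k a b c : ℕ} {σ : RAMState} {Q : RAMState → Prop}
    (ht : IsTidy σ) (h0 : σ.I 0 = n) (h1 : σ.I 1 = k) (h2 : σ.I 2 = a) (h3 : σ.I 3 = b)
    (h4 : σ.I 4 = c) (hn : n ≤ k) (hex : ∃ x < n, IsRemovable n k a b c σ.M x)
    (hQ : ∀ τ, SameBelow 12 σ τ → HoldsRemovable n k a b c σ.M τ → Q τ) :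
    HaltsWithin selectVertex (n * (n * (24 * k + 62) + 18 * k + 62) + 2) Q σ := by
  refine HaltsWithin.for (N := n) (T := n * (24 * k + 62) + 18 * k + 60)
    (fun j τ => SameBelow 12 σ τ ∧ ((∃ x < j, IsRemovable n k a b c σ.M x) →
      HoldsRemovable n k a b c σ.M τ)) (by norm_num) (by norm_num)
    (fun j τ v h => ⟨h.1.setI _ (by norm_num), fun hx => (h.2 hx).of_eq (by simp) (by simp)
      (by simp) (by simp)⟩) h0 ht.h6 ⟨.refl _ _, by simp⟩ ?_
    (fun τ _ _ h => hQ τ h.1 (h.2 hex)) le_rfl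
  rintro j hj τ h16 h0' h6 ⟨hs, hr⟩
  refine haltsWithin_selectStep (a := a) (b := b) (c := c) (hs.isTidy (by norm_num) ht) h0'
    ((hs.1 1 (by norm_num)).trans h1) ((hs.1 2 (by norm_num)).trans h2)
    ((hs.1 3 (by norm_num)).trans h3) ((hs.1 4 (by norm_num)).trans h4) hn h16 hj ?_ ?_
  · intro τ' hs' h16' hr'
    refine ⟨h16', (hs'.1 0 (by norm_num)).trans h0', (hs'.1 6 (by norm_num)).trans h6,
      hs.trans hs' le_rfl, fun _ => ?_⟩
    rwa [hs.2.2.1] at hr'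
  · intro hno τ' hs'
    refine ⟨(hs'.1 16 (by norm_num)).trans h16, (hs'.1 0 (by norm_num)).trans h0',
      (hs'.1 6 (by norm_num)).trans h6, hs.trans hs' (by norm_num), ?_⟩
    rintro ⟨x, hx, hxr⟩
    rw [hs.2.2.1] at hno
    have hxj : x < j := by
      rcases Nat.lt_succ_iff_lt_or_eq.1 hx with h | rfl
      · exact h
      · exact absurd hxr hno
    exact (hr ⟨x, hxj, hxr⟩).of_eq (hs'.1 12 (by norm_num)) (hs'.1 13 (by norm_num))
      (hs'.1 14 (by norm_num)) (hs'.1 15 (by norm_num))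

end SelectVertex

/-! ## The program: the tables of a round -/

section Tables

/-- Twice the signed area of the triangle whose vertices have their coordinates in registers
`p`, `p + 1` and so on, computed in register `d`. -/
def areaTo (d p q s : ℕ) : RAMProg :=
  .block (.rsub 9 q p) [.rsub 10 (s + 1) (p + 1), .rmul 9 9 10, .rsub 10 (q + 1) (p + 1),
    .rsub 11 s p, .rmul 10 10 11, .rsub d 9 10]

/-- The point with coordinates in the real registers `r` and `r + 1`. -/
def RAMState.point (σ : RAMState) (r : ℕ) : ℝ × ℝ := (σ.R r, σ.R (r + 1))

/-- The bounds on `p`, `q`, `s` keep the operands clear of the scratch registers `9`, `10`, `11`. -/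
theorem HaltsWithin.areaTo_seq {d p q s T' T'' : ℕ} {P' : RAMProg} {Q : RAMState → Prop}
    {σ : RAMState} (hp : p < 8) (hq : q < 8) (hs : s < 8) (hT : 7 + T' ≤ T'')
    (h : ∀ τ, τ.I = σ.I → τ.M = σ.M → τ.X = σ.X → (∀ r, r < 9 ∨ 12 ≤ r → r ≠ d → τ.R r = σ.R r) →
      τ.R d = signedArea (σ.point p) (σ.point q) (σ.point s) → HaltsWithin P' T' Q τ) :
    HaltsWithin (.seq (areaTo d p q s) P') T'' Q σ := by
  refine HaltsWithin.block_seq (T' := T') (h _ ?_ ?_ ?_ ?_ ?_)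
    (by simpa using hT)
  · simp
  · simp
  · simp
  · intro r hr hd
    have h9 : r ≠ 9 := by omega
    have h10 : r ≠ 10 := by omega
    have h11 : r ≠ 11 := by omega
    simp [hd, h9, h10, h11]
  · have k : ∀ r, r < 9 → r ≠ 9 ∧ r ≠ 10 ∧ r ≠ 11 := fun r hr => by omega
    obtain ⟨a1, a2, a3⟩ := k p (by omega)
    obtain ⟨b1, b2, b3⟩ := k (p + 1) (by omega)
    obtain ⟨d1, d2, d3⟩ := k (q + 1) (by omega)
    obtain ⟨e1, e2, e3⟩ := k s (by omega)
    obtain ⟨f1, f2, f3⟩ := k (s + 1) (by omega)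
    simp only [List.foldl_cons, List.foldl_nil, RAMInstr.exec_rsub, RAMInstr.exec_rmul,
      RAMState.setR_R, if_true, a1, a2, b1, b2, d1, d2, e1, e2, f1, if_false]
    norm_num
    rfl

/-- Loads the point whose index is in word register `i` into the real registers `r`, `r + 1`. -/
def loadPoint (r i : ℕ) : RAMProg :=
  .block (.add 25 i i) [.rload r 25, .add 25 25 6, .rload (r + 1) 25]

/-- The `i`-th point of the input. -/
def RAMState.inputPoint (σ : RAMState) (i : ℕ) : ℝ × ℝ := (σ.X (i + i), σ.X (i + i + 1))

theorem HaltsWithin.loadPoint_seq {r i T' T'' : ℕ} {P' : RAMProg} {Q : RAMState → Prop}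
    {σ : RAMState} (h6 : σ.I 6 = 1) (hT : 4 + T' ≤ T'')
    (h : ∀ τ, (∀ e, e ≠ 25 → τ.I e = σ.I e) → τ.M = σ.M → τ.X = σ.X →
      (∀ e, e ≠ r → e ≠ r + 1 → τ.R e = σ.R e) → τ.point r = σ.inputPoint (σ.I i) →
      HaltsWithin P' T' Q τ) :
    HaltsWithin (.seq (loadPoint r i) P') T'' Q σ := by
  refine HaltsWithin.block_seq (T' := T') (h _ ?_ ?_ ?_ ?_ ?_) (by simpa using hT)
  · intro e he; simp [he]
  · simp
  · simp
  · intro e he1 he2; simp [he1, he2]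
  · simp [RAMState.point, RAMState.inputPoint, h6]

/-- Tests whether the three signed areas in registers `12`, `13`, `14` have the same strict sign;
real register `0` holds zero. -/
def ifSameSign (P : RAMProg) : RAMProg :=
  .ite (.rlt 0 12) (.ite (.rlt 0 13) (.ite (.rlt 0 14) P (.instr (.const 25 0)))
      (.instr (.const 25 0)))
    (.ite (.rlt 12 0) (.ite (.rlt 13 0) (.ite (.rlt 14 0) P (.instr (.const 25 0)))
      (.instr (.const 25 0))) (.instr (.const 25 0)))

theorem HaltsWithin.ifSameSign {P : RAMProg} {T : ℕ} {Q : RAMState → Prop} {σ : RAMState}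
    {p q r s : ℝ × ℝ} (h0 : σ.R 0 = 0) (h12 : σ.R 12 = signedArea p q s)
    (h13 : σ.R 13 = signedArea q r s) (h14 : σ.R 14 = signedArea r p s) (hT : 1 ≤ T)
    (hyes : StrictlyInside p q r s → HaltsWithin P T Q σ)
    (hno : ¬ StrictlyInside p q r s → Q (σ.setI 25 0)) :
    HaltsWithin (ifSameSign P) (T + 4) Q σ := by
  have skip : ¬ StrictlyInside p q r s → ∀ {T}, 1 ≤ T →
      HaltsWithin (.instr (.const 25 0)) T Q σ := fun h T hT => HaltsWithin.instr (hno h) hT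
  have yes : StrictlyInside p q r s → ∀ {T'}, T ≤ T' → HaltsWithin P T' Q σ := fun h T' hT =>
    (hyes h).mono hT fun _ => id
  unfold StrictlyInside at *
  refine HaltsWithin.ite' (T := T + 3) (fun h1 => ?_) (fun h1 => ?_) (by omega)
  · simp only [RAMTest.Holds, h0, h12] at h1
    refine HaltsWithin.ite' (T := T + 2) (fun h2 => ?_) (fun h2 => skip ?_ (by omega)) (by omega)
    · simp only [RAMTest.Holds, h0, h13] at h2
      refine HaltsWithin.ite' (T := T) (fun h3 => ?_) (fun h3 => skip ?_ (by omega)) (by omega)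
      · simp only [RAMTest.Holds, h0, h14] at h3
        exact yes (Or.inl ⟨h1, h2, h3⟩) (by omega)
      · simp only [RAMTest.Holds, h0, h14] at h3
        rintro (h | h)
        · exact h3 h.2.2
        · linarith [h.1]
    · simp only [RAMTest.Holds, h0, h13] at h2
      rintro (h | h)
      · exact h2 h.2.1
      · linarith [h.1]
  · simp only [RAMTest.Holds, h0, h12] at h1
    refine HaltsWithin.ite' (T := T + 2) (fun h1' => ?_) (fun h1' => skip ?_ (by omega)) (by omega)
    · simp only [RAMTest.Holds, h0, h12] at h1'
      refine HaltsWithin.ite' (T := T + 1) (fun h2 => ?_) (fun h2 => skip ?_ (by omega)) (by omega)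
      · simp only [RAMTest.Holds, h0, h13] at h2
        refine HaltsWithin.ite' (T := T) (fun h3 => ?_) (fun h3 => skip ?_ (by omega)) (by omega)
        · simp only [RAMTest.Holds, h0, h14] at h3
          exact yes (Or.inr ⟨h1', h2, h3⟩) (by omega)
        · simp only [RAMTest.Holds, h0, h14] at h3
          rintro (h | h)
          · exact h1 h.1
          · exact h3 h.2.2
      · simp only [RAMTest.Holds, h0, h13] at h2
        rintro (h | h)
        · exact h1 h.1
        · exact h2 h.2.1
    · simp only [RAMTest.Holds, h0, h12] at h1'
      rintro (h | h)
      · exact h1 h.1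
      · exact h1' h.1

/-- Tries the point in register `19` as position of the vertex: registers `22`, `23`, `24` hold the
base addresses of the tables of the three parts, and the outcome goes to registers `20`, `21`. -/
def tryPoint : RAMProg :=
  .seq (loadPoint 7 19) <| .seq (areaTo 12 1 3 7) <| .seq (areaTo 13 3 5 7) <|
  .seq (areaTo 14 5 1 7) <|
  .seq (.block (.add 25 22 19) [.load 25 25, .add 26 23 19, .load 26 26, .add 27 24 19,
    .load 27 27]) <|
  .ite (.eq 25 5) (.ite (.eq 26 5) (.ite (.eq 27 5)
    (ifSameSign (.block (.const 20 0) [.add 21 19 5]))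
    (.instr (.const 25 0))) (.instr (.const 25 0))) (.instr (.const 25 0))

/-- What `tryPoint` leaves alone. -/
def SameForTry (σ τ : RAMState) : Prop :=
  (∀ r < 19, τ.I r = σ.I r) ∧ τ.I 22 = σ.I 22 ∧ τ.I 23 = σ.I 23 ∧ τ.I 24 = σ.I 24 ∧
    (∀ r < 7, τ.R r = σ.R r) ∧ τ.M = σ.M ∧ τ.X = σ.X

theorem SameForTry.trans {σ τ υ : RAMState} (h : SameForTry σ τ) (h' : SameForTry τ υ) :
    SameForTry σ υ := by
  obtain ⟨h1, h2, h3, h4, h5, h6, h7⟩ := h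
  obtain ⟨k1, k2, k3, k4, k5, k6, k7⟩ := h'
  exact ⟨fun r hr => (k1 r hr).trans (h1 r hr), k2.trans h2, k3.trans h3, k4.trans h4,
    fun r hr => (k5 r hr).trans (h5 r hr), k6.trans h6, k7.trans h7⟩

theorem SameForTry.setI {σ τ : RAMState} (h : SameForTry σ τ) {d : ℕ} (v : ℕ)
    (hd : 19 ≤ d) (hd' : d < 22 ∨ 24 < d) : SameForTry σ (τ.setI d v) := by
  obtain ⟨h1, h2, h3, h4, h5⟩ := h
  refine ⟨fun r hr => ?_, ?_, ?_, ?_, h5⟩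
  · rw [RAMState.setI_I, if_neg (by omega)]; exact h1 r hr
  · rwa [RAMState.setI_I, if_neg (by omega)]
  · rwa [RAMState.setI_I, if_neg (by omega)]
  · rwa [RAMState.setI_I, if_neg (by omega)]

/-- The bound does not depend on `k`, because the base addresses are already in registers. -/
theorem haltsWithin_tryPoint {σ : RAMState} {s : ℕ} {p q r : ℝ × ℝ} {Q : RAMState → Prop}
    (h5 : σ.I 5 = 0) (h6 : σ.I 6 = 1) (h19 : σ.I 19 = s) (hR : σ.R 0 = 0)
    (hp : σ.point 1 = p) (hq : σ.point 3 = q) (hr : σ.point 5 = r)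
    (hyes : StrictlyInside p q r (σ.inputPoint s) → σ.M (σ.I 22 + s) = 0 →
      σ.M (σ.I 23 + s) = 0 → σ.M (σ.I 24 + s) = 0 → ∀ τ, SameForTry σ τ → τ.I 19 = s →
        τ.I 20 = 0 → τ.I 21 = s → Q τ)
    (hno : ¬ (StrictlyInside p q r (σ.inputPoint s) ∧ σ.M (σ.I 22 + s) = 0 ∧
      σ.M (σ.I 23 + s) = 0 ∧ σ.M (σ.I 24 + s) = 0) → ∀ τ, SameForTry σ τ → τ.I 19 = s →
        τ.I 20 = σ.I 20 → τ.I 21 = σ.I 21 → Q τ) :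
    HaltsWithin tryPoint 50 Q σ := by
  refine HaltsWithin.loadPoint_seq (T' := 46) h6 (by norm_num) ?_
  intro τ₁ i1 m1 x1 r1 p1
  have a1 : τ₁.point 1 = p := by
    rw [← hp]; simp [RAMState.point, r1]
  have a2 : τ₁.point 3 = q := by
    rw [← hq]; simp [RAMState.point, r1]
  have a3 : τ₁.point 5 = r := by
    rw [← hr]; simp [RAMState.point, r1]
  refine HaltsWithin.areaTo_seq (T' := 39) (by norm_num) (by norm_num) (by norm_num)
    (by norm_num) ?_
  intro τ₂ i2 m2 x2 r2 d2
  have b1 : τ₂.point 1 = p := by rw [← a1]; simp [RAMState.point, r2]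
  have b2 : τ₂.point 3 = q := by rw [← a2]; simp [RAMState.point, r2]
  have b3 : τ₂.point 5 = r := by rw [← a3]; simp [RAMState.point, r2]
  have b4 : τ₂.point 7 = τ₁.point 7 := by simp [RAMState.point, r2]
  refine HaltsWithin.areaTo_seq (T' := 32) (by norm_num) (by norm_num) (by norm_num)
    (by norm_num) ?_
  intro τ₃ i3 m3 x3 r3 d3
  have c1 : τ₃.point 1 = p := by rw [← b1]; simp [RAMState.point, r3]
  have c3 : τ₃.point 5 = r := by rw [← b3]; simp [RAMState.point, r3]
  have c4 : τ₃.point 7 = τ₁.point 7 := by rw [← b4]; simp [RAMState.point, r3]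
  refine HaltsWithin.areaTo_seq (T' := 25) (by norm_num) (by norm_num) (by norm_num)
    (by norm_num) ?_
  intro τ₄ i4 m4 x4 r4 d4
  rw [a1, a2, p1, h19] at d2
  rw [b2, b3, b4, p1, h19] at d3
  rw [c3, c1, c4, p1, h19] at d4
  have iI : ∀ e, e ≠ 25 → τ₄.I e = σ.I e := fun e he => by rw [i4, i3, i2, i1 e he]
  have mM : τ₄.M = σ.M := by rw [m4, m3, m2, m1]
  have e12 : τ₄.R 12 = signedArea p q (σ.inputPoint s) := by
    rw [r4 12 (by norm_num) (by norm_num), r3 12 (by norm_num) (by norm_num), d2]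
  have e13 : τ₄.R 13 = signedArea q r (σ.inputPoint s) := by
    rw [r4 13 (by norm_num) (by norm_num), d3]
  have rR : ∀ e < 7, τ₄.R e = σ.R e := fun e he => by
    rw [r4 e (by omega) (by omega), r3 e (by omega) (by omega), r2 e (by omega) (by omega),
      r1 e (by omega) (by omega)]
  have hs₄ : SameForTry σ τ₄ := ⟨fun e he => iI e (by omega), iI _ (by norm_num),
    iI _ (by norm_num), iI _ (by norm_num), rR, mM, by rw [x4, x3, x2, x1]⟩
  refine HaltsWithin.block_seq (T' := 19) ?_ (by simp)
  simp only [List.foldl_cons, List.foldl_nil, RAMInstr.exec_add, RAMInstr.exec_load]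
  set τ := (((((τ₄.setI 25 _).setI 25 _).setI 26 _).setI 26 _).setI 27 _).setI 27 _ with hτ
  have hs : SameForTry σ τ := (((((hs₄.setI _ (by norm_num) (by norm_num)).setI _ (by norm_num)
    (by norm_num)).setI _ (by norm_num) (by norm_num)).setI _ (by norm_num) (by norm_num)).setI _
    (by norm_num) (by norm_num)).setI _ (by norm_num) (by norm_num)
  have f5 : τ.I 5 = 0 := (hs.1 5 (by norm_num)).trans h5
  have f19 : τ.I 19 = s := by simp [hτ, iI, h19]
  have f20 : τ.I 20 = σ.I 20 := by simp [hτ, iI]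
  have f21 : τ.I 21 = σ.I 21 := by simp [hτ, iI]
  have f25 : τ.I 25 = σ.M (σ.I 22 + s) := by simp [hτ, iI, h19, mM]
  have f26 : τ.I 26 = σ.M (σ.I 23 + s) := by simp [hτ, iI, h19, mM]
  have f27 : τ.I 27 = σ.M (σ.I 24 + s) := by simp [hτ, iI, h19, mM]
  have no : ¬ (StrictlyInside p q r (σ.inputPoint s) ∧ σ.M (σ.I 22 + s) = 0 ∧
      σ.M (σ.I 23 + s) = 0 ∧ σ.M (σ.I 24 + s) = 0) → Q (τ.setI 25 0) := fun h =>
    hno h _ (hs.setI _ (by norm_num) (by norm_num)) (by simp [f19]) (by simp [f20])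
      (by simp [f21])
  refine HaltsWithin.ite' (T := 18) (fun k1 => ?_) (fun k1 => HaltsWithin.instr (no ?_)
    (by norm_num)) (by norm_num)
  · simp only [RAMTest.Holds, f5, f25] at k1
    refine HaltsWithin.ite' (T := 17) (fun k2 => ?_) (fun k2 => HaltsWithin.instr (no ?_)
      (by norm_num)) (by norm_num)
    · simp only [RAMTest.Holds, f5, f26] at k2
      refine HaltsWithin.ite' (T := 6) (fun k3 => ?_) (fun k3 => HaltsWithin.instr (no ?_)
        (by norm_num)) (by norm_num)
      · simp only [RAMTest.Holds, f5, f27] at k3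
        refine HaltsWithin.ifSameSign (T := 2) (p := p) (q := q) (r := r)
          (s := σ.inputPoint s) ?_ e12 e13 d4 (by norm_num) (fun hin => ?_)
          (fun hin => no fun h => hin h.1)
        · exact (hs.2.2.2.2.1 0 (by norm_num)).trans hR
        · refine HaltsWithin.block' (hyes hin k1 k2 k3 _ ((hs.setI _ (by norm_num)
            (by norm_num)).setI _ (by norm_num) (by norm_num)) ?_ ?_ ?_) (by simp)
          · simp [f19]
          · simp
          · simp [f19, f5]
      · simp only [RAMTest.Holds, f5, f27] at k3; exact fun h => k3 h.2.2.2
    · simp only [RAMTest.Holds, f5, f26] at k2; exact fun h => k2 h.2.2.1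
  · simp only [RAMTest.Holds, f5, f25] at k1; exact fun h => k1 h.2.1

/-! ### Writing several cells -/

/-- Each item `(t, l, s)` asks to store register `s` in the cell with tag `t` and digits `l`. -/
def storeAll : List (ℕ × List ℕ × ℕ) → RAMProg
  | [] => .instr (.const 22 0)
  | e :: l => .seq (addressTo 1 22 e.1 e.2.1) (.seq (.instr (.store 22 e.2.2)) (storeAll l))

/-- The memory after the items have been stored. -/
def storedMemory (I : ℕ → ℕ) : List (ℕ × List ℕ × ℕ) → (ℕ → ℕ) → ℕ → ℕ
  | [], M => M
  | e :: l, M => storedMemory I l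
      (Function.update M (hornerValue (I 1) e.1 (e.2.1.map I)) (I e.2.2))

theorem storedMemory_congr {I J : ℕ → ℕ} {l : List (ℕ × List ℕ × ℕ)} {M : ℕ → ℕ}
    (h1 : J 1 = I 1) (h : ∀ e ∈ l, (∀ r ∈ e.2.1, J r = I r) ∧ J e.2.2 = I e.2.2) :
    storedMemory J l M = storedMemory I l M := by
  induction l generalizing M with
  | nil => rfl
  | cons e l ih =>
    simp only [storedMemory]
    rw [ih fun e he => h e (by simp [he]), h1, (h e (by simp)).2,
      List.map_congr_left (h e (by simp)).1]

theorem haltsWithin_storeAll {l : List (ℕ × List ℕ × ℕ)} {k : ℕ} {σ : RAMState}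
    {Q : RAMState → Prop} (ht : IsTidy σ) (h1 : σ.I 1 = k)
    (hl : ∀ e ∈ l, e.2.1.length = 6 ∧ (∀ r ∈ e.2.1, (r < 7 ∨ 10 ≤ r) ∧ r ≠ 22) ∧ e.2.2 ≠ 22)
    (hQ : ∀ τ, (∀ r, r ≠ 22 → τ.I r = σ.I r) → τ.R = σ.R → τ.X = σ.X →
      τ.M = storedMemory σ.I l σ.M → Q τ) :
    HaltsWithin (storeAll l) (l.length * (18 * k + 30) + 1) Q σ := by
  induction l generalizing σ with
  | nil =>
    refine HaltsWithin.instr (hQ _ ?_ rfl rfl rfl) (by simp)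
    intro r hr; simp [hr]
  | cons e l ih =>
    obtain ⟨e1, e2, e3⟩ := hl e (by simp)
    refine HaltsWithin.addressTo_seq (T' := 1 + (l.length * (18 * k + 30) + 1)) ht (by norm_num)
      (by norm_num) (fun r hr => (e2 r hr).1) ?_
      (by rw [e1, h1, List.length_cons, Nat.add_mul]; omega)
    refine HaltsWithin.instr_seq (T' := l.length * (18 * k + 30) + 1) ?_ le_rfl
    simp only [RAMInstr.exec_store, RAMState.setI_I, if_true, if_neg e3]
    set α := hornerValue (σ.I 1) e.1 (e.2.1.map σ.I) with hα
    have hI : ∀ r, r ≠ 22 → ((σ.setI 22 α).setM α (σ.I e.2.2)).I r = σ.I r := fun r hr => by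
      simp [hr]
    refine ih (ht.of_eq fun r hr => hI r (by omega)) ((hI 1 (by norm_num)).trans h1)
      (fun e he => hl e (by simp [he])) ?_
    intro τ t1 t2 t3 t4
    refine hQ τ (fun r hr => (t1 r hr).trans (hI r hr)) t2 t3 ?_
    rw [t4, storedMemory_congr (hI 1 (by norm_num)) fun e he =>
      ⟨fun r hr => hI r ((hl e (by simp [he])).2.1 r hr).2, hI _ (hl e (by simp [he])).2.2⟩]
    rfl

/-- Fills in the table entries for the place in registers `16`, `17`, `18`; the vertex and its
neighbours are in registers `12` to `15`. -/
def fillEntry : RAMProg :=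
  .seq (loadPoint 1 16) <| .seq (loadPoint 3 17) <| .seq (loadPoint 5 18) <|
  -- Register `5` leaves the last digit of each base address zero, to be filled by adding the number
  -- of the candidate point.
  .seq (addressTo 1 22 1 [13, 14, 12, 16, 17, 5]) <|
  .seq (addressTo 1 23 1 [14, 15, 12, 17, 18, 5]) <|
  .seq (addressTo 1 24 1 [15, 13, 12, 18, 16, 5]) <|
  -- The flag starts as "impossible". The default witness `0` is meaningless but is a valid point
  -- index.
  .seq (.block (.const 20 1) [.const 21 0]) <|
  .seq (.for 19 1 tryPoint) <|
  -- All six orders of the triangle are stored, so that any order can be looked up later.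
  storeAll [(1, [13, 14, 15, 16, 17, 18], 20), (1, [14, 15, 13, 17, 18, 16], 20),
    (1, [15, 13, 14, 18, 16, 17], 20), (1, [14, 13, 15, 17, 16, 18], 20),
    (1, [13, 15, 14, 16, 18, 17], 20), (1, [15, 14, 13, 18, 17, 16], 20),
    (2, [12, 16, 17, 18, 5, 5], 21)]

theorem faceCell_add (k u v w p q s : ℕ) :
    faceCell k u v w p q 0 + s = faceCell k u v w p q s := by
  unfold faceCell
  exact (hornerValue_concat k 1 s [u, v, w, p, q]).symm

/-- The memory after an entry has been written. -/
theorem storedMemory_entry (k x u v w p q r flag wit : ℕ) (M : ℕ → ℕ) (I : ℕ → ℕ)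
    (h1 : I 1 = k) (h5 : I 5 = 0) (h12 : I 12 = x) (h13 : I 13 = u) (h14 : I 14 = v)
    (h15 : I 15 = w) (h16 : I 16 = p) (h17 : I 17 = q) (h18 : I 18 = r) (h20 : I 20 = flag)
    (h21 : I 21 = wit) (α : ℕ) :
    storedMemory I [(1, [13, 14, 15, 16, 17, 18], 20), (1, [14, 15, 13, 17, 18, 16], 20),
      (1, [15, 13, 14, 18, 16, 17], 20), (1, [14, 13, 15, 17, 16, 18], 20),
      (1, [13, 15, 14, 16, 18, 17], 20), (1, [15, 14, 13, 18, 17, 16], 20),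
      (2, [12, 16, 17, 18, 5, 5], 21)] M α =
    if α = witnessCell k x p q r then wit else
      if α ∈ faceCells k u v w p q r then flag else M α := by
  simp only [storedMemory, List.map_cons, List.map_nil, h1, h5, h12, h13, h14, h15, h16, h17, h18,
    h20, h21, Function.update_apply]
  unfold faceCells faceCell witnessCell
  simp only [List.mem_cons, List.not_mem_nil, or_false]
  split_ifs <;> tauto

/-- Linear in `k`: three base addresses and seven stores at `O(k)` each, and `k` candidates at
constant cost. -/
theorem haltsWithin_fillEntry {k x u v w p q r : ℕ} {σ : RAMState} {Q : RAMState → Prop}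
    (ht : IsTidy σ) (h1 : σ.I 1 = k) (hR : σ.R 0 = 0) (h12 : σ.I 12 = x) (h13 : σ.I 13 = u)
    (h14 : σ.I 14 = v) (h15 : σ.I 15 = w) (h16 : σ.I 16 = p) (h17 : σ.I 17 = q)
    (h18 : σ.I 18 = r) (hk : 0 < k)
    (hQ : ∀ τ flag wit, (∀ e < 19, τ.I e = σ.I e) → τ.R 0 = 0 → τ.X = σ.X →
      (∀ α, τ.M α = if α = witnessCell k x p q r then wit else
        if α ∈ faceCells k u v w p q r then flag else σ.M α) → wit < k →
      ((flag = 0 ∧ IsWitness k σ.inputPoint σ.M x u v w p q r wit) ∨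
        (flag = 1 ∧ ∀ s < k, ¬ IsWitness k σ.inputPoint σ.M x u v w p q r s)) → Q τ) :
    HaltsWithin fillEntry (300 * k + 400) Q σ := by
  refine HaltsWithin.loadPoint_seq (T' := 300 * k + 396) ht.h6 (by omega) ?_
  intro τ₁ i1 m1 x1 r1 p1
  refine HaltsWithin.loadPoint_seq (T' := 300 * k + 392) ((i1 6 (by norm_num)).trans ht.h6)
    (by omega) ?_
  intro τ₂ i2 m2 x2 r2 p2
  refine HaltsWithin.loadPoint_seq (T' := 300 * k + 388)
    (((i2 6 (by norm_num)).trans (i1 6 (by norm_num))).trans ht.h6) (by omega) ?_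
  intro τ₃ i3 m3 x3 r3 p3
  have hI : ∀ e, e ≠ 25 → τ₃.I e = σ.I e := fun e he => by rw [i3 e he, i2 e he, i1 e he]
  have hM : τ₃.M = σ.M := by rw [m3, m2, m1]
  have hX : τ₃.X = σ.X := by rw [x3, x2, x1]
  have hR0 : τ₃.R 0 = 0 := by
    rw [r3 0 (by norm_num) (by norm_num), r2 0 (by norm_num) (by norm_num),
      r1 0 (by norm_num) (by norm_num), hR]
  have hin : ∀ τ : RAMState, τ.X = σ.X → τ.inputPoint = σ.inputPoint := fun τ h => by
    funext i; simp [RAMState.inputPoint, h]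
  have q1 : τ₃.point 1 = σ.inputPoint p := by
    rw [← h16, ← p1]; simp [RAMState.point, r3, r2]
  have q2 : τ₃.point 3 = σ.inputPoint q := by
    rw [i1 17 (by norm_num), h17, hin _ x1] at p2
    rw [← p2]; simp [RAMState.point, r3]
  have q3 : τ₃.point 5 = σ.inputPoint r := by
    rw [i2 18 (by norm_num), i1 18 (by norm_num), h18, hin _ (x2.trans x1)] at p3
    exact p3
  have t3 : IsTidy τ₃ := ht.of_eq fun e he => hI e (by omega)
  have k1 : τ₃.I 1 = k := (hI 1 (by norm_num)).trans h1
  refine HaltsWithin.addressTo_seq (T' := 280 * k + 350) t3 (by norm_num) (by norm_num)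
    (by simp) ?_ (by simp only [List.length_cons, List.length_nil, k1]; omega)
  rw [show hornerValue (τ₃.I 1) 1 ([13, 14, 12, 16, 17, 5].map τ₃.I) = faceCell k u v x p q 0 by
    simp [faceCell, hI, h1, h12, h13, h14, h16, h17, ht.h5]]
  set τ₄ := τ₃.setI 22 (faceCell k u v x p q 0) with hτ₄
  have hI4 : ∀ e, e ≠ 25 → e ≠ 22 → τ₄.I e = σ.I e := fun e he he' => by simp [hτ₄, he', hI e he]
  refine HaltsWithin.addressTo_seq (T' := 260 * k + 320)
    (ht.of_eq fun e he => hI4 e (by omega) (by omega)) (by norm_num) (by norm_num)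
    (by simp) ?_ (by
      simp only [List.length_cons, List.length_nil, hI4 1 (by norm_num) (by norm_num), h1]; omega)
  rw [show hornerValue (τ₄.I 1) 1 ([14, 15, 12, 17, 18, 5].map τ₄.I) = faceCell k v w x q r 0 by
    simp [faceCell, hI4, h1, h12, h14, h15, h17, h18, ht.h5]]
  set τ₅ := τ₄.setI 23 (faceCell k v w x q r 0) with hτ₅
  have hI5 : ∀ e, e ≠ 25 → e ≠ 22 → e ≠ 23 → τ₅.I e = σ.I e := fun e he he' he'' => by
    simp [hτ₅, he'', hI4 e he he']
  refine HaltsWithin.addressTo_seq (T' := 240 * k + 290)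
    (ht.of_eq fun e he => hI5 e (by omega) (by omega) (by omega)) (by norm_num) (by norm_num)
    (by simp) ?_ (by
      simp only [List.length_cons, List.length_nil,
        hI5 1 (by norm_num) (by norm_num) (by norm_num), h1]; omega)
  rw [show hornerValue (τ₅.I 1) 1 ([15, 13, 12, 18, 16, 5].map τ₅.I) = faceCell k w u x r p 0 by
    simp [faceCell, hI5, h1, h12, h13, h15, h16, h18, ht.h5]]
  refine HaltsWithin.block_seq (T' := 240 * k + 280) ?_
    (by simp only [List.length_cons, List.length_nil]; omega)
  simp only [List.foldl_cons, List.foldl_nil, RAMInstr.exec_const]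
  set τ₀ := ((τ₅.setI 24 (faceCell k w u x r p 0)).setI 20 1).setI 21 0 with hτ₀
  have hI0 : ∀ e < 20, τ₀.I e = σ.I e := fun e he => by
    rw [hτ₀]
    simp only [RAMState.setI_I]
    rw [if_neg (by omega), if_neg (by omega), if_neg (by omega), hI5 e (by omega) (by omega)
      (by omega)]
  have a22 : τ₀.I 22 = faceCell k u v x p q 0 := by simp [hτ₀, hτ₅, hτ₄]
  have a23 : τ₀.I 23 = faceCell k v w x q r 0 := by simp [hτ₀, hτ₅]
  have a24 : τ₀.I 24 = faceCell k w u x r p 0 := by simp [hτ₀]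
  have hR' : τ₀.R = τ₃.R := rfl
  have hM' : τ₀.M = σ.M := hM
  have hX' : τ₀.X = σ.X := hX
  have wit_iff : ∀ τ, SameForTry τ₀ τ → ∀ s, (StrictlyInside (σ.inputPoint p) (σ.inputPoint q)
      (σ.inputPoint r) (τ.inputPoint s) ∧ τ.M (τ.I 22 + s) = 0 ∧ τ.M (τ.I 23 + s) = 0 ∧
      τ.M (τ.I 24 + s) = 0) ↔ IsWitness k σ.inputPoint σ.M x u v w p q r s := by
    rintro τ ⟨-, b22, b23, b24, -, bM, bX⟩ s
    rw [b22, b23, b24, a22, a23, a24, faceCell_add, faceCell_add, faceCell_add, bM, hM',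
      hin τ (bX.trans hX')]
    rfl
  refine HaltsWithin.seq' (T := k * (50 + 2) + 2) (T' := 7 * (18 * k + 30) + 1) ?_ (by omega)
  -- Either some witness has been found, and it stays one even if a later candidate replaces it, or
  -- none of the first `j` points is a witness.
  refine HaltsWithin.for (N := k) (T := 50) (fun j τ => SameForTry τ₀ τ ∧
      τ.I 21 < k ∧ ((τ.I 20 = 0 ∧ IsWitness k σ.inputPoint σ.M x u v w p q r (τ.I 21)) ∨
        (τ.I 20 = 1 ∧ ∀ s < j, ¬ IsWitness k σ.inputPoint σ.M x u v w p q r s)))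
    (by norm_num) (by norm_num) ?_ ((hI0 1 (by norm_num)).trans h1)
    ((hI0 6 (by norm_num)).trans ht.h6) ?_ ?_ ?_ le_rfl
  · rintro j τ s ⟨hs, h⟩
    exact ⟨hs.setI _ (by norm_num) (by norm_num), by simpa using h⟩
  · refine ⟨⟨fun _ _ => rfl, rfl, rfl, rfl, fun _ _ => rfl, rfl, rfl⟩, ?_, Or.inr ⟨?_, by simp⟩⟩
    · simpa [hτ₀] using hk
    · simp [hτ₀]
  · rintro j hj τ j19 j1 j6 ⟨hs, hlt, hd⟩
    have hs' := hs
    obtain ⟨bI, -, -, -, bR, bM, bX⟩ := hs'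
    refine haltsWithin_tryPoint (s := j) (p := σ.inputPoint p) (q := σ.inputPoint q)
      (r := σ.inputPoint r) ?_ j6 j19 ?_ ?_ ?_ ?_ ?_ ?_
    · rw [bI 5 (by norm_num), hI0 5 (by norm_num), ht.h5]
    · rw [bR 0 (by norm_num), hR', hR0]
    · rw [← q1]; simp [RAMState.point, bR, hR']
    · rw [← q2]; simp [RAMState.point, bR, hR']
    · rw [← q3]; simp [RAMState.point, bR, hR']
    · intro w1 w2 w3 w4 τ' hs' g19 g20 g21
      refine ⟨g19, (hs'.1 1 (by norm_num)).trans j1, (hs'.1 6 (by norm_num)).trans j6,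
        hs.trans hs', by rwa [g21], Or.inl ⟨g20, ?_⟩⟩
      rw [g21]
      exact (wit_iff τ hs j).1 ⟨w1, w2, w3, w4⟩
    · intro hno τ' hs' g19 g20 g21
      rw [wit_iff τ hs j] at hno
      refine ⟨g19, (hs'.1 1 (by norm_num)).trans j1, (hs'.1 6 (by norm_num)).trans j6,
        hs.trans hs', by rwa [g21], ?_⟩
      rw [g20, g21]
      refine hd.imp id fun hd => ⟨hd.1, fun s hs => ?_⟩
      rcases Nat.lt_succ_iff_lt_or_eq.1 hs with h | rfl
      · exact hd.2 s h
      · exact hno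
  · rintro τ j1 j6 ⟨hs, hlt, hd⟩
    have hI6 : ∀ e < 19, τ.I e = σ.I e := fun e he => (hs.1 e he).trans (hI0 e (by omega))
    refine haltsWithin_storeAll (k := k) (ht.of_eq fun e he => hI6 e (by omega)) j1
      (by simp) ?_
    intro τ' t1 t2 t3 t4
    refine hQ τ' (τ.I 20) (τ.I 21) (fun e he => (t1 e (by omega)).trans (hI6 e he)) ?_ ?_ ?_ hlt hd
    · rw [t2, hs.2.2.2.2.1 0 (by norm_num), hR', hR0]
    · rw [t3, hs.2.2.2.2.2.2, hX']
    · intro α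
      rw [t4, storedMemory_entry k x u v w p q r (τ.I 20) (τ.I 21) τ.M τ.I j1
        ((hI6 5 (by norm_num)).trans ht.h5) ((hI6 12 (by norm_num)).trans h12)
        ((hI6 13 (by norm_num)).trans h13) ((hI6 14 (by norm_num)).trans h14)
        ((hI6 15 (by norm_num)).trans h15) ((hI6 16 (by norm_num)).trans h16)
        ((hI6 17 (by norm_num)).trans h17) ((hI6 18 (by norm_num)).trans h18) rfl rfl,
        hs.2.2.2.2.2.1, hM']

end Tables

/-! ## The program: one round -/

section Round

theorem cell_eq {k t t' : ℕ} {l l' : List ℕ} (hl : l.length = 6 ∧ ∀ d ∈ l, d < k)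
    (hl' : l'.length = 6 ∧ ∀ d ∈ l', d < k) (h : hornerValue k t l = hornerValue k t' l') :
    t = t' ∧ l = l' :=
  (hornerValue_inj (hl.1.trans hl'.1.symm) hl.2 hl'.2).1 h

/-- The three vertices are distinct, so the order in which they occur in a cell reveals the
permutation, and with it the place. Entries at different places use disjoint cells. -/
theorem place_eq_of_mem_faceCells {k u v w p q r p' q' r' α : ℕ} (hu : u < k) (hv : v < k)
    (hw : w < k) (huv : u ≠ v) (hvw : v ≠ w) (hwu : w ≠ u) (hp : p < k) (hq : q < k) (hr : r < k)
    (hp' : p' < k) (hq' : q' < k) (hr' : r' < k) (h : α ∈ faceCells k u v w p q r)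
    (h' : α ∈ faceCells k u v w p' q' r') : p = p' ∧ q = q' ∧ r = r' := by
  have key : ∀ {β}, β ∈ faceCells k u v w p q r → faceCell k u v w p' q' r' = β →
      p = p' ∧ q = q' ∧ r = r' := by
    rintro β h rfl
    simp only [faceCells, List.mem_cons, List.not_mem_nil, or_false] at h
    rcases h with h | h | h | h | h | h <;>
      (rw [faceCell_inj (by assumption) (by assumption) (by assumption) (by assumption)
        (by assumption) (by assumption) (by assumption) (by assumption) (by assumption)
        (by assumption) (by assumption) (by assumption)] at h; omega)
  simp only [faceCells, List.mem_cons, List.not_mem_nil, or_false] at h h'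
  rcases h with rfl | rfl | rfl | rfl | rfl | rfl <;> rcases h' with h | h | h | h | h | h <;>
    (rw [faceCell_inj (by assumption) (by assumption) (by assumption) (by assumption)
        (by assumption) (by assumption) (by assumption) (by assumption) (by assumption)
        (by assumption) (by assumption) (by assumption)] at h; omega)

variable {k : ℕ} {pt : ℕ → ℝ × ℝ} {M M' M'' : ℕ → ℕ} {x u v w : ℕ} {S : Set (ℕ × ℕ × ℕ)}

theorem witnessCell_notMem_faceCells {x p q r u v w p' q' r' : ℕ} (hx : x < k) (hp : p < k)
    (hq : q < k) (hr : r < k) (hu : u < k) (hv : v < k) (hw : w < k) (hp' : p' < k) (hq' : q' < k)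
    (hr' : r' < k) : witnessCell k x p q r ∉ faceCells k u v w p' q' r' :=
  tag_ne_of_mem_faceCells hu hv hw hp' hq' hr' (t := 2) (l := [x, p, q, r, 0, 0]) rfl
    (by have : 0 < k := by omega
        simp [*]) (by norm_num) rfl

theorem IsEntry.congr {p q r : ℕ} (h : IsEntry k pt M M' x u v w p q r)
    (h1 : ∀ α ∈ faceCells k u v w p q r, M'' α = M' α)
    (h2 : M'' (witnessCell k x p q r) = M' (witnessCell k x p q r)) :
    IsEntry k pt M M'' x u v w p q r := by
  obtain ⟨flag, hc, hd⟩ := h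
  exact ⟨flag, fun α hα => (h1 α hα).trans (hc α hα), by rwa [h2]⟩

theorem IsTableUpdate.empty : IsTableUpdate k pt M M x u v w ∅ :=
  ⟨by simp, fun _ _ => rfl⟩

/-- A round reads flags of triples that contain `x`, but writes flags of triples on `u`, `v`, `w`
and cells with another tag. Reading during the update is therefore the same as reading before it. -/
theorem IsTableUpdate.isWitness_iff (h : IsTableUpdate k pt M M' x u v w S)
    (hS : ∀ p q r, (p, q, r) ∈ S → p < k ∧ q < k ∧ r < k) (hx : x < k) (hu : u < k) (hv : v < k)
    (hw : w < k) (hxu : x ≠ u) (hxv : x ≠ v) (hxw : x ≠ w) {p q r s : ℕ} (hp : p < k) (hq : q < k)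
    (hr : r < k) (hs : s < k) :
    IsWitness k pt M' x u v w p q r s ↔ IsWitness k pt M x u v w p q r s := by
  have key : ∀ y z p q, y < k → z < k → p < k → q < k →
      M' (faceCell k y z x p q s) = M (faceCell k y z x p q s) := by
    intro y z p q hy hz hp hq
    refine h.other _ fun p' q' r' hm => ⟨fun hf => ?_, fun hf => ?_⟩
    · obtain ⟨hp', hq', hr'⟩ := hS _ _ _ hm
      have := isPermutationOf_of_mem_faceCells hu hv hw hp' hq' hr' hy hz hx hp hq hs hf
      unfold IsPermutationOf IsRotationOf at this
      omega
    · obtain ⟨hp', hq', hr'⟩ := hS _ _ _ hm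
      have h0 : 0 < k := by omega
      have := (cell_eq (l := [y, z, x, p, q, s]) (l' := [x, p', q', r', 0, 0])
        ⟨rfl, by simp [*]⟩ ⟨rfl, by simp [*]⟩ hf).1
      omega
  unfold IsWitness
  rw [key u v p q hu hv hp hq, key v w q r hv hw hq hr, key w u r p hw hu hr hp]

theorem IsTableUpdate.insert (h : IsTableUpdate k pt M M' x u v w S)
    (hS : ∀ p q r, (p, q, r) ∈ S → p < k ∧ q < k ∧ r < k) (hx : x < k) (hu : u < k) (hv : v < k)
    (hw : w < k) (hxu : x ≠ u) (hxv : x ≠ v) (hxw : x ≠ w) (huv : u ≠ v) (hvw : v ≠ w)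
    (hwu : w ≠ u) {p q r flag wit : ℕ} (hp : p < k) (hq : q < k) (hr : r < k)
    (hn : (p, q, r) ∉ S) (hM : ∀ α, M'' α = if α = witnessCell k x p q r then wit else
        if α ∈ faceCells k u v w p q r then flag else M' α) (hwit : wit < k)
    (hd : (flag = 0 ∧ IsWitness k pt M' x u v w p q r wit) ∨
        (flag = 1 ∧ ∀ s < k, ¬ IsWitness k pt M' x u v w p q r s)) :
    IsTableUpdate k pt M M'' x u v w (insert (p, q, r) S) := by
  constructor
  · rintro p' q' r' (e | hm)
    · obtain ⟨rfl, rfl, rfl⟩ : p' = p ∧ q' = q ∧ r' = r := by simpa using e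
      have ew : M'' (witnessCell k x p' q' r') = wit := by simp [hM]
      refine ⟨flag, fun α hα => ?_, by rwa [ew], ?_⟩
      · rw [hM, if_neg, if_pos hα]
        rintro rfl
        exact witnessCell_notMem_faceCells hx hp hq hr hu hv hw hp hq hr hα
      · rw [ew]
        have key : ∀ s < k, (IsWitness k pt M' x u v w p' q' r' s ↔
            IsWitness k pt M x u v w p' q' r' s) := fun s hs =>
          h.isWitness_iff hS hx hu hv hw hxu hxv hxw hp hq hr hs
        exact hd.imp (fun hd => ⟨hd.1, (key _ hwit).1 hd.2⟩)
          fun hd => ⟨hd.1, fun s hs he => hd.2 s hs ((key s hs).2 he)⟩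
    · obtain ⟨hp', hq', hr'⟩ := hS _ _ _ hm
      have hne : ¬ (p' = p ∧ q' = q ∧ r' = r) := by
        rintro ⟨rfl, rfl, rfl⟩; exact hn hm
      refine (h.entry _ _ _ hm).congr (fun α hα => ?_) ?_
      · rw [hM, if_neg, if_neg]
        · exact fun hα' => hne (place_eq_of_mem_faceCells hu hv hw huv hvw hwu hp' hq' hr' hp hq hr
            hα hα')
        · rintro rfl
          exact witnessCell_notMem_faceCells hx hp hq hr hu hv hw hp' hq' hr' hα
      · rw [hM, if_neg, if_neg]
        · exact witnessCell_notMem_faceCells hx hp' hq' hr' hu hv hw hp hq hr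
        · rw [witnessCell_inj hx hp' hq' hr' hx hp hq hr]
          exact fun e => hne e.2
  · intro α hα
    have h1 := hα p q r (by simp)
    rw [hM, if_neg h1.2, if_neg h1.1]
    exact h.other α fun p' q' r' hm => hα _ _ _ (Set.mem_insert_of_mem _ hm)

/-- The round is complete when the removed vertex and its neighbours have been recorded. -/
theorem IsTableUpdate.isRound {n t : ℕ}
    (h : IsTableUpdate k pt M M' x u v w {z | z.1 < k ∧ z.2.1 < k ∧ z.2.2 < k})
    (hx : x < k) (hu : u < k) (hv : v < k) (hw : w < k) (ht : t < k) (hn : n ≤ k)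
    (hM : ∀ α, M'' α = if α = recordCell k 3 t then w else if α = recordCell k 2 t then v else
      if α = recordCell k 1 t then u else if α = recordCell k 0 t then x else
      if α = removedCell k x then 1 else M' α) :
    IsRound n k pt M M'' t x u v w ∧ ∀ α < k ^ 6, M'' α = M α := by
  replace hM : ∀ α, M'' α = if α = hornerValue k 7 [t, 0, 0, 0, 0, 0] then w else
      if α = hornerValue k 6 [t, 0, 0, 0, 0, 0] then v else
      if α = hornerValue k 5 [t, 0, 0, 0, 0, 0] then u else
      if α = hornerValue k 4 [t, 0, 0, 0, 0, 0] then x else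
      if α = hornerValue k 3 [x, 0, 0, 0, 0, 0] then 1 else M' α := hM
  have h0 : 0 < k := by omega
  have hrec : ∀ {j}, j < k → [j, 0, 0, 0, 0, 0].length = 6 ∧ ∀ d ∈ [j, 0, 0, 0, 0, 0], d < k :=
    fun hj => ⟨rfl, by simp [*]⟩
  have main : ∀ g l, (l.length = 6 ∧ ∀ d ∈ l, d < k) → g < 3 →
      M'' (hornerValue k g l) = M' (hornerValue k g l) := by
    intro g l hl hg
    have key : ∀ g' j, j < k → 3 ≤ g' →
        hornerValue k g l ≠ hornerValue k g' [j, 0, 0, 0, 0, 0] := by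
      intro g' j hj hg' he
      have := (cell_eq hl (hrec hj) he).1
      omega
    rw [hM, if_neg (key 7 _ ht (by norm_num)), if_neg (key 6 _ ht (by norm_num)),
      if_neg (key 5 _ ht (by norm_num)), if_neg (key 4 _ ht (by norm_num)),
      if_neg (key 3 _ hx (by norm_num))]
  have other : ∀ g l, (l.length = 6 ∧ ∀ d ∈ l, d < k) → 3 ≤ g →
      M' (hornerValue k g l) = M (hornerValue k g l) := by
    intro g l hl hg
    refine h.other _ fun p q r hm => ?_
    obtain ⟨hp, hq, hr⟩ : p < k ∧ q < k ∧ r < k := hm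
    refine ⟨tag_ne_of_mem_faceCells hu hv hw hp hq hr hl.1 hl.2 (by omega) rfl, fun he => ?_⟩
    have := (cell_eq (l' := [x, p, q, r, 0, 0]) hl ⟨rfl, by simp [*]⟩ he).1
    omega
  have hne : ∀ g g' j j', j < k → j' < k → (g ≠ g' ∨ j ≠ j') →
      hornerValue k g [j, 0, 0, 0, 0, 0] ≠ hornerValue k g' [j', 0, 0, 0, 0, 0] := by
    intro g g' j j' hj hj' hd he
    obtain ⟨e1, e2⟩ := cell_eq (hrec hj) (hrec hj') he
    simp only [List.cons.injEq, and_true] at e2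
    omega
  have face : ∀ u' < k, ∀ v' < k, ∀ w' < k, ∀ p < k, ∀ q < k, ∀ r < k,
      M'' (faceCell k u' v' w' p q r) = M' (faceCell k u' v' w' p q r) :=
    fun u' _ v' _ w' _ p _ q _ r _ => main 1 _ ⟨rfl, by simp [*]⟩ (by norm_num)
  have wit : ∀ x' < k, ∀ p < k, ∀ q < k, ∀ r < k,
      M'' (witnessCell k x' p q r) = M' (witnessCell k x' p q r) :=
    fun x' _ p _ q _ r _ => main 2 _ ⟨rfl, by simp [*]⟩ (by norm_num)
  refine ⟨⟨?_, ?_, ?_, ?_, ?_, ?_, ?_, ?_, ?_⟩, ?_⟩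
  · intro p hp q hq r hr
    refine (h.entry p q r ⟨hp, hq, hr⟩).congr (fun α hα => ?_) (wit x hx p hp q hq r hr)
    simp only [faceCells, List.mem_cons, List.not_mem_nil, or_false] at hα
    rcases hα with rfl | rfl | rfl | rfl | rfl | rfl <;> apply face <;> assumption
  · intro u' hu' v' hv' w' hw' p hp q hq r hr hper
    rw [face u' hu' v' hv' w' hw' p hp q hq r hr]
    refine h.other _ fun p' q' r' hm => ?_
    obtain ⟨hp', hq', hr'⟩ : p' < k ∧ q' < k ∧ r' < k := hm
    refine ⟨fun hm => hper (isPermutationOf_of_mem_faceCells hu hv hw hp' hq' hr' hu' hv' hw' hp hq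
      hr hm), fun he => ?_⟩
    have := (cell_eq (l := [u', v', w', p, q, r]) (l' := [x, p', q', r', 0, 0])
      ⟨rfl, by simp [*]⟩ ⟨rfl, by simp [*]⟩ he).1
    omega
  · intro x' hx' p hp q hq r hr hxx
    rw [wit x' hx' p hp q hq r hr]
    refine h.other _ fun p' q' r' hm => ?_
    obtain ⟨hp', hq', hr'⟩ : p' < k ∧ q' < k ∧ r' < k := hm
    refine ⟨witnessCell_notMem_faceCells hx' hp hq hr hu hv hw hp' hq' hr', ?_⟩
    rw [Ne, witnessCell_inj hx' hp hq hr hx hp' hq' hr']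
    exact fun e => hxx e.1
  · intro y hy
    have hyk : y < k := by omega
    unfold removedCell
    rw [hM, if_neg (hne 3 7 _ _ hyk ht (by norm_num)), if_neg (hne 3 6 _ _ hyk ht (by norm_num)),
      if_neg (hne 3 5 _ _ hyk ht (by norm_num)), if_neg (hne 3 4 _ _ hyk ht (by norm_num))]
    by_cases e : y = x
    · simp [e]
    · rw [if_neg (hne 3 3 _ _ hyk hx (Or.inr e)), if_neg e]
      exact other 3 _ (hrec hyk) le_rfl
  · intro j hj i hi
    have hjk : j < k := by omega
    have hjt : j ≠ t := by omega
    unfold recordCell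
    rw [hM, if_neg (hne (4 + i) 7 _ _ hjk ht (Or.inr hjt)),
      if_neg (hne (4 + i) 6 _ _ hjk ht (Or.inr hjt)),
      if_neg (hne (4 + i) 5 _ _ hjk ht (Or.inr hjt)),
      if_neg (hne (4 + i) 4 _ _ hjk ht (Or.inr hjt)),
      if_neg (hne (4 + i) 3 _ _ hjk hx (Or.inl (by omega)))]
    exact other _ _ (hrec hjk) (by omega)
  · change M'' (hornerValue k 4 [t, 0, 0, 0, 0, 0]) = _
    rw [hM, if_neg (hne 4 7 _ _ ht ht (by norm_num)), if_neg (hne 4 6 _ _ ht ht (by norm_num)),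
      if_neg (hne 4 5 _ _ ht ht (by norm_num)), if_pos rfl]
  · change M'' (hornerValue k 5 [t, 0, 0, 0, 0, 0]) = _
    rw [hM, if_neg (hne 5 7 _ _ ht ht (by norm_num)), if_neg (hne 5 6 _ _ ht ht (by norm_num)),
      if_pos rfl]
  · change M'' (hornerValue k 6 [t, 0, 0, 0, 0, 0]) = _
    rw [hM, if_neg (hne 6 7 _ _ ht ht (by norm_num)), if_pos rfl]
  · change M'' (hornerValue k 7 [t, 0, 0, 0, 0, 0]) = _
    rw [hM, if_pos rfl]
  · intro α hα
    -- Every cell written in a round has a positive tag.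
    have key : ∀ g l, l.length = 6 → 1 ≤ g → α ≠ hornerValue k g l := by
      rintro g l hl hg rfl
      have := le_hornerValue k g l
      rw [hl] at this
      have := Nat.mul_le_mul_right (k ^ 6) hg
      omega
    rw [hM, if_neg (key 7 _ rfl (by norm_num)), if_neg (key 6 _ rfl (by norm_num)),
      if_neg (key 5 _ rfl (by norm_num)), if_neg (key 4 _ rfl (by norm_num)),
      if_neg (key 3 _ rfl (by norm_num))]
    refine h.other _ fun p q r _ => ⟨?_, key 2 _ rfl (by norm_num)⟩
    simp only [faceCells, List.mem_cons, List.not_mem_nil, or_false]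
    rintro (e | e | e | e | e | e) <;> exact key 1 _ rfl le_rfl e

/-- Selects a vertex, fills in the tables for its triangle, and removes it. -/
def removeVertex : RAMProg :=
  .seq selectVertex <| .seq (.forTriples fillEntry) <|
  storeAll [(3, [12, 5, 5, 5, 5, 5], 6), (4, [11, 5, 5, 5, 5, 5], 12),
    (5, [11, 5, 5, 5, 5, 5], 13), (6, [11, 5, 5, 5, 5, 5], 14), (7, [11, 5, 5, 5, 5, 5], 15)]

/-- A bound for the number of steps of `removeVertex`. -/
def removeVertexTime (n k : ℕ) : ℕ :=
  n * (n * (24 * k + 62) + 18 * k + 62) + 2 +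
    (k * (k * (k * (300 * k + 400 + 2) + 4) + 4) + 2 + (5 * (18 * k + 30) + 1))

theorem RAMState.inputPoint_congr {σ τ : RAMState} (h : τ.X = σ.X) :
    τ.inputPoint = σ.inputPoint := by
  funext i; simp [RAMState.inputPoint, h]

theorem haltsWithin_removeVertex {n k a b c t : ℕ} {σ : RAMState} {Q : RAMState → Prop}
    (ht : IsTidy σ) (h0 : σ.I 0 = n) (h1 : σ.I 1 = k) (h2 : σ.I 2 = a) (h3 : σ.I 3 = b)
    (h4 : σ.I 4 = c) (h11 : σ.I 11 = t) (hR : σ.R 0 = 0) (hn : n ≤ k) (htk : t < k)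
    (hex : ∃ x < n, IsRemovable n k a b c σ.M x)
    (hirr : ∀ x < n, σ.M (removedCell k x) = 0 → σ.M (x * n + x) = 0)
    (hQ : ∀ τ x u v w, (∀ r < 12, τ.I r = σ.I r) → τ.R 0 = 0 → τ.X = σ.X →
      (∀ α < k ^ 6, τ.M α = σ.M α) → x < n → IsRemovable n k a b c σ.M x →
      remainingNeighbors n k σ.M x n = [u, v, w] →
      IsRound n k σ.inputPoint σ.M τ.M t x u v w → Q τ) :
    HaltsWithin removeVertex (removeVertexTime n k) Q σ := by
  have hk0 : 0 < k := by omega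
  refine HaltsWithin.seq' (haltsWithin_selectVertex ht h0 h1 h2 h3 h4 hn hex ?_) le_rfl
  rintro τ₁ hs ⟨hxn, hrem, hlist⟩
  generalize hx : τ₁.I 12 = x at *
  generalize hu : τ₁.I 13 = u at *
  generalize hv : τ₁.I 14 = v at *
  generalize hw : τ₁.I 15 = w at *
  -- `hirr` provides the zero diagonal of the adjacency matrix, so `x` is not listed as its own
  -- neighbour.
  have hmem : ∀ y ∈ [u, v, w], y < n ∧ y ≠ x := by
    intro y hy
    rw [← hlist, mem_remainingNeighbors] at hy
    refine ⟨hy.1, ?_⟩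
    rintro rfl
    exact hy.2.1 (hirr _ hxn hrem.1)
  have hnd : [u, v, w].Nodup := hlist ▸ nodup_remainingNeighbors n k σ.M x n
  obtain ⟨hun, hux⟩ := hmem u (by simp)
  obtain ⟨hvn, hvx⟩ := hmem v (by simp)
  obtain ⟨hwn, hwx⟩ := hmem w (by simp)
  simp only [List.nodup_cons, List.mem_cons, List.not_mem_nil, or_false, not_or] at hnd
  have hxk : x < k := by omega
  have huk : u < k := by omega
  have hvk : v < k := by omega
  have hwk : w < k := by omega
  obtain ⟨si, sr, sm, sx⟩ := hs
  have ht₁ : IsTidy τ₁ := ht.of_eq fun r hr => si r (by omega)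
  refine HaltsWithin.seq' (HaltsWithin.forTriples (k := k) (T := 300 * k + 400)
    (fun S τ => (∀ r < 16, τ.I r = τ₁.I r) ∧ τ.R 0 = 0 ∧ τ.X = σ.X ∧
      (∀ p q r, (p, q, r) ∈ S → p < k ∧ q < k ∧ r < k) ∧
      IsTableUpdate k σ.inputPoint σ.M τ.M x u v w S) ?_ ((si 1 (by norm_num)).trans h1) ht₁.h6
      ⟨fun _ _ => rfl, by rw [sr, hR], sx, by simp, by rw [sm]; exact .empty⟩ ?_ ?_ le_rfl) le_rfl
  · rintro S τ d z hd ⟨i1, i2⟩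
    refine ⟨fun r hr => ?_, i2⟩
    rw [RAMState.setI_I, if_neg (by omega), i1 r hr]
  · rintro S p q r hp hq hr hpS τ h16 h17 h18 ⟨i1, i2, i3, i4, i5⟩
    refine haltsWithin_fillEntry (ht₁.of_eq fun r hr => i1 r (by omega)) (k := k)
      ((i1 1 (by norm_num)).trans ((si 1 (by norm_num)).trans h1)) i2
      ((i1 12 (by norm_num)).trans hx) ((i1 13 (by norm_num)).trans hu)
      ((i1 14 (by norm_num)).trans hv) ((i1 15 (by norm_num)).trans hw) h16 h17 h18 hk0 ?_
    intro τ' flag wit j1 j2 j3 j4 j5 j6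
    refine ⟨j1, fun r hr => (j1 r (by omega)).trans (i1 r hr), j2, j3.trans i3, ?_, ?_⟩
    · rintro p' q' r' (e | hm)
      · obtain ⟨rfl, rfl, rfl⟩ : p' = p ∧ q' = q ∧ r' = r := by simpa using e
        exact ⟨hp, hq, hr⟩
      · exact i4 _ _ _ hm
    · rw [RAMState.inputPoint_congr i3] at j6
      exact i5.insert i4 hxk huk hvk hwk hux.symm hvx.symm hwx.symm hnd.1.1 hnd.2.1
        (Ne.symm hnd.1.2) hp hq hr hpS j4 j5 j6
  · rintro τ ⟨i1, i2, i3, -, i5⟩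
    have i1' : ∀ r < 12, τ.I r = σ.I r := fun r hr => (i1 r (by omega)).trans (si r hr)
    have htτ : IsTidy τ := ht.of_eq fun r hr => i1' r (by omega)
    have k1 := (i1' 1 (by norm_num)).trans h1
    refine haltsWithin_storeAll (k := k) htτ k1 (by simp) ?_
    intro τ' t1 t2 t3 t4
    have hr := i5.isRound (n := n) (t := t) (M'' := τ'.M) hxk huk hvk hwk htk hn (by
      intro α
      rw [t4]
      simp only [storedMemory, List.map_cons, List.map_nil, k1, htτ.h5, htτ.h6,
        i1' 11 (by norm_num), h11, i1 12 (by norm_num), hx, i1 13 (by norm_num), hu,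
        i1 14 (by norm_num), hv, i1 15 (by norm_num), hw, Function.update_apply]
      rfl)
    exact hQ τ' x u v w (fun r hr => (t1 r (by omega)).trans (i1' r hr)) (by rw [t2, i2])
      (t3.trans i3) hr.2 hxn hrem hlist hr.1

end Round

/-! ## The program: removing all inner vertices -/

section RemoveAll

variable {n k a b c t : ℕ} {pt : ℕ → ℝ × ℝ} {F₀ F : ℕ → ℕ → ℕ → Prop} {M : ℕ → ℕ} {A : Set ℕ}

/-- The original matrix together with the removal marks describes the current triangulation, since
removals do not change adjacency among the remaining vertices. -/
theorem IsReduction.mem_remainingNeighbors_iff (hab : a ≠ b) (hbc : b ≠ c) (hca : c ≠ a)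
    (hI : IsReduction n k pt a b c F₀ M t A F)
    (hadj : ∀ x < n, ∀ y < n, M (x * n + y) ≠ 0 ↔ FaceAdj F₀ x y) {x y : ℕ} (hx : x ∈ A) :
    y ∈ remainingNeighbors n k M x n ↔ FaceAdj F x y := by
  have fs := hI.disc.isFaceSystem hab hbc hca
  rw [mem_remainingNeighbors]
  constructor
  · rintro ⟨h1, h2, h3⟩
    exact (hI.adj x hx y ((hI.removed y h1).1 h3)).2 ((hadj x (hI.lt x hx) y h1).1 h2)
  · intro h
    have hy := h.mem fs
    have hyn := hI.lt y hy
    exact ⟨hyn, (hadj x (hI.lt x hx) y hyn).2 ((hI.adj x hx y hy).1 h), (hI.removed y hyn).2 hy⟩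

/-- More than the three outer vertices are left, so `StackedDisc.exists_degree_three` applies. -/
theorem IsReduction.exists_isRemovable (hab : a ≠ b) (hbc : b ≠ c) (hca : c ≠ a)
    (hI : IsReduction n k pt a b c F₀ M t A F)
    (hadj : ∀ x < n, ∀ y < n, M (x * n + y) ≠ 0 ↔ FaceAdj F₀ x y) (ht : t + 3 < n) :
    ∃ x < n, IsRemovable n k a b c M x := by
  have hA : A ≠ {a, b, c} := by
    rintro rfl
    have := hI.card
    have := Set.ncard_insert_le a {b, c}
    have := Set.ncard_insert_le b {c}
    rw [Set.ncard_singleton] at this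
    omega
  obtain ⟨x, u, v, w, hx, hxo, huv, hvw, hwu, hN⟩ :=
    hI.disc.exists_degree_three hab hbc hca hA
  simp only [Set.mem_insert_iff, Set.mem_singleton_iff, not_or] at hxo
  refine ⟨x, hI.lt x hx, (hI.removed x (hI.lt x hx)).2 hx, hxo.1, hxo.2.1, hxo.2.2, ?_⟩
  have hp : (remainingNeighbors n k M x n).Perm [u, v, w] := by
    rw [List.perm_ext_iff_of_nodup (nodup_remainingNeighbors ..) (by simp [huv, hvw, hwu.symm])]
    intro y
    rw [hI.mem_remainingNeighbors_iff hab hbc hca hadj hx, hN]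
    simp
  simpa using hp.length_eq

/-- Removes all inner vertices; register `10` holds their number. -/
def removeAll : RAMProg := .for 11 10 removeVertex

theorem haltsWithin_removeAll {σ : RAMState} {Q : RAMState → Prop} (hab : a ≠ b) (hbc : b ≠ c)
    (hca : c ≠ a) (ht : IsTidy σ) (h0 : σ.I 0 = n) (h1 : σ.I 1 = k) (h2 : σ.I 2 = a)
    (h3 : σ.I 3 = b) (h4 : σ.I 4 = c) (h10 : σ.I 10 = n - 3) (hR : σ.R 0 = 0) (hn : n ≤ k)
    (hn3 : 3 ≤ n) (hadj : ∀ x < n, ∀ y < n, σ.M (x * n + y) ≠ 0 ↔ FaceAdj F₀ x y)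
    (hred : IsReduction n k σ.inputPoint a b c F₀ σ.M 0 A F)
    (hQ : ∀ τ A F, (∀ r < 11, τ.I r = σ.I r) → τ.R 0 = 0 → τ.X = σ.X →
      (∀ α < k ^ 6, τ.M α = σ.M α) →
      IsReduction n k σ.inputPoint a b c F₀ τ.M (n - 3) A F → Q τ) :
    HaltsWithin removeAll ((n - 3) * (removeVertexTime n k + 2) + 2) Q σ := by
  -- The adjacency matrix lies below `k ^ 6`, the range that no round touches.
  have hlt : ∀ x < n, ∀ y < n, x * n + y < k ^ 6 := by
    intro x hx y hy
    calc x * n + y < (x + 1) * n := by rw [Nat.add_mul]; omega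
      _ ≤ n * n := Nat.mul_le_mul_right _ hx
      _ ≤ k * k := Nat.mul_le_mul hn hn
      _ = k ^ 2 := by ring
      _ ≤ k ^ 6 := Nat.pow_le_pow_right (by omega) (by norm_num)
  refine HaltsWithin.for (N := n - 3) (T := removeVertexTime n k)
    (fun t τ => (∀ r < 11, τ.I r = σ.I r) ∧ τ.R 0 = 0 ∧ τ.X = σ.X ∧
      (∀ α < k ^ 6, τ.M α = σ.M α) ∧ ∃ A F, IsReduction n k σ.inputPoint a b c F₀ τ.M t A F)
    (by norm_num) (by norm_num) ?_ h10 ht.h6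
    ⟨fun _ _ => rfl, hR, rfl, fun _ _ => rfl, A, F, hred⟩ ?_
    (fun τ _ _ ⟨i1, i2, i3, i4, A, F, i5⟩ => hQ τ A F i1 i2 i3 i4 i5) le_rfl
  · rintro j τ v ⟨i1, i2⟩
    refine ⟨fun r hr => ?_, i2⟩
    rw [RAMState.setI_I, if_neg (by omega), i1 r hr]
  · rintro t htn τ h11 h10' h6 ⟨i1, i2, i3, i4, A, F, hI⟩
    have hadj' : ∀ x < n, ∀ y < n, τ.M (x * n + y) ≠ 0 ↔ FaceAdj F₀ x y := fun x hx y hy => by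
      rw [i4 _ (hlt x hx y hy), hadj x hx y hy]
    have fs := hI.disc.isFaceSystem hab hbc hca
    refine haltsWithin_removeVertex (ht.of_eq fun r hr => i1 r (by omega))
      ((i1 0 (by norm_num)).trans h0) ((i1 1 (by norm_num)).trans h1)
      ((i1 2 (by norm_num)).trans h2) ((i1 3 (by norm_num)).trans h3)
      ((i1 4 (by norm_num)).trans h4) h11 i2 hn (by omega)
      (hI.exists_isRemovable hab hbc hca hadj' (by omega)) ?_ ?_
    · intro x hx hr
      by_contra hne
      have hxA := (hI.removed x hx).1 hr
      obtain ⟨r, h | h⟩ := (hI.adj x hxA x hxA).2 ((hadj' x hx x hx).1 hne) <;>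
        exact fs.ne _ _ _ h rfl
    · intro τ' x u v w j1 j2 j3 j4 hx hrem hlist hround
      have hxA := (hI.removed x hx).1 hrem.1
      have hN : ∀ y, FaceAdj F x y ↔ y = u ∨ y = v ∨ y = w := fun y => by
        rw [← hI.mem_remainingNeighbors_iff hab hbc hca hadj' hxA, hlist]
        simp
      have hxo : x ∉ ({a, b, c} : Set ℕ) := by
        simp [hrem.2.1, hrem.2.2.1, hrem.2.2.2.1]
      rw [RAMState.inputPoint_congr i3] at hround
      obtain ⟨F', hI'⟩ := hI.step hn hab hbc hca hxA hxo hN hround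
      exact ⟨(j1 11 (by norm_num)).trans h11, (j1 10 (by norm_num)).trans h10',
        (j1 6 (by norm_num)).trans h6, fun r hr => (j1 r (by omega)).trans (i1 r hr), j2,
        j3.trans i3, fun α hα => (j4 α hα).trans (i4 α hα), _, F', hI'⟩

/-- When all inner vertices have been removed, one face is left. -/
theorem StackedDisc.eq_base_of_ncard {A : Set ℕ} (hab : a ≠ b) (hbc : b ≠ c) (hca : c ≠ a)
    (h : StackedDisc a b c A F) (hfin : A.Finite) (hA : A.ncard = 3) :
    F = IsRotationOf b a c := by
  have h3 : ({a, b, c} : Set ℕ).ncard = 3 := Set.ncard_eq_three.2 ⟨a, b, c, hab, hca.symm, hbc, rfl⟩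
  unfold StackedDisc at h
  cases h with
  | base => rfl
  | @step A F x u v w hs hx hf =>
    have hfin' := hfin.subset (Set.subset_insert x A)
    rw [Set.ncard_insert_of_notMem hx hfin'] at hA
    have := Set.ncard_le_ncard hs.subset hfin'
    omega

/-- The one remaining face is `(b, a, c)`, which runs against the outer triangle; hence the minus
sign. -/
theorem IsReduction.isAdmissible_iff (hab : a ≠ b) (hbc : b ≠ c) (hca : c ≠ a) (ha : a < k)
    (hb : b < k) (hc : c < k) (hn3 : 3 ≤ n) (hI : IsReduction n k pt a b c F₀ M (n - 3) A F)
    {σ : ℝ} {f : ℕ → ℕ} (hf : ∀ v, f v < k) :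
    IsAdmissible k pt M F σ f ↔ 0 < σ * -signedArea (pt (f a)) (pt (f b)) (pt (f c)) ∧
      M (faceCell k a b c (f a) (f b) (f c)) = 0 := by
  have hfin : A.Finite := (Set.finite_lt_nat n).subset hI.lt
  obtain rfl := hI.disc.eq_base_of_ncard hab hbc hca hfin (by have := hI.card; omega)
  have e := hI.swap a ha b hb c hc _ (hf a) _ (hf b) _ (hf c)
  have e1 := hI.rotate b hb a ha c hc _ (hf b) _ (hf a) _ (hf c)
  have e2 := hI.rotate a ha c hc b hb _ (hf a) _ (hf c) _ (hf b)
  constructor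
  · rintro ⟨h1, h2⟩
    refine ⟨?_, ?_⟩
    · rw [← signedArea_swap]; exact h1 _ _ _ (.refl ..)
    · rw [← e]; exact h2 _ _ _ (.refl ..)
  · rintro ⟨h1, h2⟩
    rw [← signedArea_swap] at h1
    refine ⟨fun p q r hr => ?_, fun p q r hr => ?_⟩
    · rw [signedArea_of_rotation (pos := fun v => pt (f v)) hr]; exact h1
    · rcases hr with ⟨rfl, rfl, rfl⟩ | ⟨rfl, rfl, rfl⟩ | ⟨rfl, rfl, rfl⟩
      · rw [e, h2]
      · rw [e1, e, h2]
      · rw [e2, e1, e, h2]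

/-- The initial memory, without any entries in the tables. -/
theorem IsReduction.init (hk : 0 < k) (hD : StackedDisc a b c {v | v < n} F₀)
    (hM : ∀ α, k ^ 6 ≤ α → M α = 0) : IsReduction n k pt a b c F₀ M 0 {v | v < n} F₀ := by
  -- All tagged cells are initially zero: every face is empty and can be placed anywhere, and no
  -- vertex is marked as removed.
  have key : ∀ g l, l.length = 6 → 1 ≤ g → M (hornerValue k g l) = 0 := by
    intro g l hl hg
    refine hM _ ?_
    have := le_hornerValue k g l
    rw [hl] at this
    have := Nat.mul_le_mul_right (k ^ 6) hg
    omega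
  have face : ∀ u v w p q r, M (faceCell k u v w p q r) = 0 := fun u v w p q r =>
    key 1 _ (by simp) le_rfl
  refine ⟨hD, ?_, fun v hv => hv, fun v hv => ?_, fun _ _ _ _ => Iff.rfl,
    fun _ _ _ _ _ _ _ _ _ _ _ _ => by rw [face, face],
    fun _ _ _ _ _ _ _ _ _ _ _ _ => by rw [face, face],
    fun _ _ _ _ _ _ _ _ => ?_, by simp, by simp,
    fun σ f hf ho => ⟨ho, fun _ _ _ _ => face ..⟩, fun σ f hf h => h.1⟩
  · change (Set.Iio n).ncard + 0 = n
    rw [← Finset.coe_range, Set.ncard_coe_finset, Finset.card_range, add_zero]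
  · rw [removedCell, key 3 _ (by simp) (by norm_num)]
    exact iff_of_true rfl hv
  · rw [witnessCell, key 2 _ (by simp) (by norm_num)]; exact hk

end RemoveAll

/-! ## The program: placing the outer triangle and tracing back -/

section Solve

variable {n k a b c : ℕ} {pt : ℕ → ℝ × ℝ} {F₀ F : ℕ → ℕ → ℕ → Prop} {M : ℕ → ℕ} {A : Set ℕ}

/-- The outer triangle can be placed at `(p, q, r)`. -/
def IsOuterPlace (k a b c : ℕ) (pt : ℕ → ℝ × ℝ) (M : ℕ → ℕ) (p q r : ℕ) : Prop :=
  signedArea (pt p) (pt q) (pt r) ≠ 0 ∧ M (faceCell k a b c p q r) = 0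

/-- Tests the place in registers `16`, `17`, `18` for the outer triangle, and keeps it in
registers `31`, `32`, `33`, with register `30` as a flag. -/
def tryOuterPlace : RAMProg :=
  .seq (loadPoint 1 16) <| .seq (loadPoint 3 17) <| .seq (loadPoint 5 18) <|
  .seq (areaTo 12 1 3 5) <| .seq (addressTo 1 22 1 [2, 3, 4, 16, 17, 18]) <|
  .seq (.instr (.load 22 22)) <|
  .ite (.eq 22 5)
    -- Both orientations are accepted; collinear triples fail both comparisons.
    (.ite (.rlt 0 12) (.block (.add 30 6 5) [.add 31 16 5, .add 32 17 5, .add 33 18 5])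
      (.ite (.rlt 12 0) (.block (.add 30 6 5) [.add 31 16 5, .add 32 17 5, .add 33 18 5])
        (.instr (.const 22 0))))
    (.instr (.const 22 0))

theorem haltsWithin_tryOuterPlace {p q r : ℕ} {σ : RAMState} {Q : RAMState → Prop}
    (ht : IsTidy σ) (h1 : σ.I 1 = k) (h2 : σ.I 2 = a) (h3 : σ.I 3 = b) (h4 : σ.I 4 = c)
    (hR : σ.R 0 = 0) (h16 : σ.I 16 = p) (h17 : σ.I 17 = q) (h18 : σ.I 18 = r)
    (hyes : IsOuterPlace k a b c σ.inputPoint σ.M p q r → ∀ τ, (∀ e < 19, τ.I e = σ.I e) →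
      τ.R 0 = 0 → τ.M = σ.M → τ.X = σ.X → τ.I 30 = 1 → τ.I 31 = p → τ.I 32 = q → τ.I 33 = r → Q τ)
    (hno : ¬ IsOuterPlace k a b c σ.inputPoint σ.M p q r → ∀ τ, (∀ e < 19, τ.I e = σ.I e) →
      τ.R 0 = 0 → τ.M = σ.M → τ.X = σ.X → τ.I 30 = σ.I 30 → τ.I 31 = σ.I 31 → τ.I 32 = σ.I 32 →
      τ.I 33 = σ.I 33 → Q τ) :
    HaltsWithin tryOuterPlace (18 * k + 70) Q σ := by
  refine HaltsWithin.loadPoint_seq (T' := 18 * k + 66) ht.h6 (by omega) ?_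
  intro τ₁ i1 m1 x1 r1 p1
  refine HaltsWithin.loadPoint_seq (T' := 18 * k + 62) ((i1 6 (by norm_num)).trans ht.h6)
    (by omega) ?_
  intro τ₂ i2 m2 x2 r2 p2
  refine HaltsWithin.loadPoint_seq (T' := 18 * k + 58)
    (((i2 6 (by norm_num)).trans (i1 6 (by norm_num))).trans ht.h6) (by omega) ?_
  intro τ₃ i3 m3 x3 r3 p3
  have q1 : τ₃.point 1 = σ.inputPoint p := by
    rw [← h16, ← p1]; simp [RAMState.point, r3, r2]
  have q2 : τ₃.point 3 = σ.inputPoint q := by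
    rw [i1 17 (by norm_num), h17, RAMState.inputPoint_congr x1] at p2
    rw [← p2]; simp [RAMState.point, r3]
  have q3 : τ₃.point 5 = σ.inputPoint r := by
    rw [i2 18 (by norm_num), i1 18 (by norm_num), h18, RAMState.inputPoint_congr (x2.trans x1)]
      at p3
    exact p3
  refine HaltsWithin.areaTo_seq (T' := 18 * k + 51) (by norm_num) (by norm_num) (by norm_num)
    (by omega) ?_
  intro τ₄ i4 m4 x4 r4 d4
  rw [q1, q2, q3] at d4
  have hI : ∀ e, e ≠ 25 → τ₄.I e = σ.I e := fun e he => by rw [i4, i3 e he, i2 e he, i1 e he]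
  have hM : τ₄.M = σ.M := by rw [m4, m3, m2, m1]
  have hX : τ₄.X = σ.X := by rw [x4, x3, x2, x1]
  have hR0 : τ₄.R 0 = 0 := by
    rw [r4 0 (by norm_num) (by norm_num), r3 0 (by norm_num) (by norm_num),
      r2 0 (by norm_num) (by norm_num), r1 0 (by norm_num) (by norm_num), hR]
  refine HaltsWithin.addressTo_seq (T' := 10) (ht.of_eq fun e he => hI e (by omega)) (by norm_num)
    (by norm_num) (by simp) ?_
    (by simp only [List.length_cons, List.length_nil, hI 1 (by norm_num), h1]; omega)
  rw [show hornerValue (τ₄.I 1) 1 ([2, 3, 4, 16, 17, 18].map τ₄.I) = faceCell k a b c p q r by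
    simp [faceCell, hI, h1, h2, h3, h4, h16, h17, h18]]
  refine HaltsWithin.instr_seq (T' := 9) ?_ (by omega)
  simp only [RAMInstr.exec_load, RAMState.setI_I, if_true, RAMState.setI_M, hM]
  set τ := (τ₄.setI 22 (faceCell k a b c p q r)).setI 22 (σ.M (faceCell k a b c p q r)) with hτ
  have hI' : ∀ e, e ≠ 25 → e ≠ 22 → τ.I e = σ.I e := fun e he he' => by simp [hτ, he', hI e he]
  have e22 : τ.I 22 = σ.M (faceCell k a b c p q r) := by simp [hτ]
  have e5 : τ.I 5 = 0 := (hI' 5 (by norm_num) (by norm_num)).trans ht.h5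
  have e6 : τ.I 6 = 1 := (hI' 6 (by norm_num) (by norm_num)).trans ht.h6
  have e0 : τ.R 0 = 0 := hR0
  have e12 : τ.R 12 = signedArea (σ.inputPoint p) (σ.inputPoint q) (σ.inputPoint r) := d4
  have yes : IsOuterPlace k a b c σ.inputPoint σ.M p q r → ∀ {T}, 4 ≤ T → HaltsWithin
      (.block (.add 30 6 5) [.add 31 16 5, .add 32 17 5, .add 33 18 5]) T Q τ := by
    intro h T hT
    refine HaltsWithin.block' (hyes h _ ?_ hR0 hM hX ?_ ?_ ?_ ?_) (by simpa using hT)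
    · intro e he
      simp only [List.foldl_cons, List.foldl_nil, RAMInstr.exec_add, RAMState.setI_I]
      rw [if_neg (by omega), if_neg (by omega), if_neg (by omega), if_neg (by omega)]
      exact hI' e (by omega) (by omega)
    · simp [e5, e6]
    · simp [e5, hI', h16]
    · simp [e5, hI', h17]
    · simp [e5, hI', h18]
  have no : ¬ IsOuterPlace k a b c σ.inputPoint σ.M p q r → ∀ {T}, 1 ≤ T → HaltsWithin
      (.instr (.const 22 0)) T Q τ := by
    intro h T hT
    have key : ∀ e, e ≠ 25 → e ≠ 22 → (τ.setI 22 0).I e = σ.I e := fun e he he' => by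
      simp [he', hI' e he he']
    exact HaltsWithin.instr (hno h _ (fun e he => key e (by omega) (by omega)) hR0 hM hX
      (key _ (by norm_num) (by norm_num)) (key _ (by norm_num) (by norm_num))
      (key _ (by norm_num) (by norm_num)) (key _ (by norm_num) (by norm_num))) hT
  refine HaltsWithin.ite' (T := 8) (fun hb => ?_) (fun hb => no ?_ (by norm_num)) (by norm_num)
  · simp only [RAMTest.Holds, e5, e22] at hb
    refine HaltsWithin.ite' (T := 7) (fun h => yes ?_ (by norm_num)) (fun h => ?_) (by norm_num)
    · simp only [RAMTest.Holds, e0, e12] at h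
      exact ⟨h.ne', hb⟩
    · simp only [RAMTest.Holds, e0, e12] at h
      refine HaltsWithin.ite' (T := 6) (fun h' => yes ?_ (by norm_num))
        (fun h' => no ?_ (by norm_num)) (by norm_num)
      · simp only [RAMTest.Holds, e0, e12] at h'
        exact ⟨h'.ne, hb⟩
      · simp only [RAMTest.Holds, e0, e12] at h'
        exact fun hp => hp.1 (le_antisymm (not_lt.1 h) (not_lt.1 h'))
  · simp only [RAMTest.Holds, e5, e22] at hb
    exact fun hp => hb hp.2

/-- Searches for a place for the outer triangle. -/
def findOuterPlace : RAMProg :=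
  .seq (.block (.const 30 0) [.const 31 0, .const 32 0, .const 33 0]) (.forTriples tryOuterPlace)

theorem haltsWithin_findOuterPlace {σ : RAMState} {Q : RAMState → Prop}
    (ht : IsTidy σ) (h1 : σ.I 1 = k) (h2 : σ.I 2 = a) (h3 : σ.I 3 = b) (h4 : σ.I 4 = c)
    (hR : σ.R 0 = 0)
    (hQ : ∀ τ, (∀ e < 16, τ.I e = σ.I e) → τ.R 0 = 0 → τ.M = σ.M → τ.X = σ.X →
      ((τ.I 30 = 0 ∧ ∀ p < k, ∀ q < k, ∀ r < k,
          ¬ IsOuterPlace k a b c σ.inputPoint σ.M p q r) ∨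
        (τ.I 30 = 1 ∧ τ.I 31 < k ∧ τ.I 32 < k ∧ τ.I 33 < k ∧
          IsOuterPlace k a b c σ.inputPoint σ.M (τ.I 31) (τ.I 32) (τ.I 33))) → Q τ) :
    HaltsWithin findOuterPlace (k * (k * (k * (18 * k + 70 + 2) + 4) + 4) + 6) Q σ := by
  refine HaltsWithin.block_seq (T' := k * (k * (k * (18 * k + 70 + 2) + 4) + 4) + 2) ?_
    (by simp only [List.length_cons, List.length_nil]; omega)
  simp only [List.foldl_cons, List.foldl_nil, RAMInstr.exec_const]
  set τ₀ := (((σ.setI 30 0).setI 31 0).setI 32 0).setI 33 0 with hτ₀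
  have hI0 : ∀ e < 30, τ₀.I e = σ.I e := fun e he => by
    simp only [hτ₀, RAMState.setI_I]
    rw [if_neg (by omega), if_neg (by omega), if_neg (by omega), if_neg (by omega)]
  refine HaltsWithin.forTriples (k := k) (T := 18 * k + 70)
    (fun S τ => (∀ e < 16, τ.I e = σ.I e) ∧ τ.R 0 = 0 ∧ τ.M = σ.M ∧ τ.X = σ.X ∧
      ((τ.I 30 = 0 ∧ ∀ p q r, (p, q, r) ∈ S → ¬ IsOuterPlace k a b c σ.inputPoint σ.M p q r) ∨
        (τ.I 30 = 1 ∧ τ.I 31 < k ∧ τ.I 32 < k ∧ τ.I 33 < k ∧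
          IsOuterPlace k a b c σ.inputPoint σ.M (τ.I 31) (τ.I 32) (τ.I 33)))) ?_
    ((hI0 1 (by norm_num)).trans h1) ((hI0 6 (by norm_num)).trans ht.h6)
    ⟨fun e he => hI0 e (by omega), hR, rfl, rfl, Or.inl ⟨by simp [hτ₀], by simp⟩⟩ ?_ ?_ le_rfl
  · rintro S τ d v hd ⟨i1, i2, i3, i4, i5⟩
    have key : ∀ e, e < 16 ∨ 18 < e → (τ.setI d v).I e = τ.I e := fun e he => by
      rw [RAMState.setI_I, if_neg (by omega)]
    rw [key 30 (by norm_num), key 31 (by norm_num), key 32 (by norm_num), key 33 (by norm_num)]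
    exact ⟨fun e he => (key e (by omega)).trans (i1 e he), i2, i3, i4, i5⟩
  · rintro S p q r hp hq hr hS τ h16 h17 h18 ⟨i1, i2, i3, i4, i5⟩
    refine haltsWithin_tryOuterPlace (k := k) (a := a) (b := b) (c := c) (p := p) (q := q) (r := r)
      (ht.of_eq fun e he => i1 e (by omega)) ((i1 1 (by norm_num)).trans h1)
      ((i1 2 (by norm_num)).trans h2) ((i1 3 (by norm_num)).trans h3)
      ((i1 4 (by norm_num)).trans h4) i2 h16 h17 h18 ?_ ?_
    · intro h τ' j1 j2 j3 j4 j5 j6 j7 j8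
      rw [RAMState.inputPoint_congr i4, i3] at h
      refine ⟨j1, fun e he => (j1 e (by omega)).trans (i1 e he), j2, j3.trans i3, j4.trans i4,
        Or.inr ⟨j5, ?_⟩⟩
      rw [j6, j7, j8]
      exact ⟨hp, hq, hr, h⟩
    · intro h τ' j1 j2 j3 j4 j5 j6 j7 j8
      rw [RAMState.inputPoint_congr i4, i3] at h
      refine ⟨j1, fun e he => (j1 e (by omega)).trans (i1 e he), j2, j3.trans i3, j4.trans i4, ?_⟩
      rw [j5, j6, j7, j8]
      refine i5.imp (fun i5 => ⟨i5.1, ?_⟩) id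
      rintro p' q' r' (e | hm)
      · obtain ⟨rfl, rfl, rfl⟩ : p' = p ∧ q' = q ∧ r' = r := by simpa using e
        exact h
      · exact i5.2 _ _ _ hm
  · rintro τ ⟨i1, i2, i3, i4, i5⟩
    exact hQ τ i1 i2 i3 i4 (i5.imp (fun h => ⟨h.1, fun p hp q hq r hr => h.2 p q r ⟨hp, hq, hr⟩⟩) id)

/-! ### Tracing back -/

/-- Computes the position of the last removed vertex that has no position yet; register `11` counts
the vertices with positions. -/
def traceStep : RAMProg :=
  -- The rounds are undone in reverse order: after `j` of `m` steps, the next round is `m - j - 1`.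
  .seq (.block (.sub 22 10 11) [.sub 22 22 6]) <|
  .seq (addressTo 1 12 4 [22, 5, 5, 5, 5, 5]) <| .seq (addressTo 1 13 5 [22, 5, 5, 5, 5, 5]) <|
  .seq (addressTo 1 14 6 [22, 5, 5, 5, 5, 5]) <| .seq (addressTo 1 15 7 [22, 5, 5, 5, 5, 5]) <|
  -- Registers `12` to `15` receive the recorded vertices, and `16` to `18` the positions already
  -- stored in the cells numbered by the three neighbours.
  .seq (.block (.load 12 12) [.load 13 13, .load 14 14, .load 15 15, .load 16 13, .load 17 14,
    .load 18 15]) <|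
  .seq (addressTo 1 23 2 [12, 16, 17, 18, 5, 5]) (.block (.load 23 23) [.store 12 23])

theorem haltsWithin_traceStep {m t j : ℕ} {σ : RAMState} {Q : RAMState → Prop}
    (ht : IsTidy σ) (h1 : σ.I 1 = k) (h10 : σ.I 10 = m) (h11 : σ.I 11 = j) (hm : m = j + (t + 1))
    (hQ : ∀ τ, (∀ r < 12, τ.I r = σ.I r) →
      τ.M = Function.update σ.M (σ.M (recordCell k 0 t))
        (σ.M (witnessCell k (σ.M (recordCell k 0 t)) (σ.M (σ.M (recordCell k 1 t)))
          (σ.M (σ.M (recordCell k 2 t))) (σ.M (σ.M (recordCell k 3 t))))) → Q τ) :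
    HaltsWithin traceStep (90 * k + 160) Q σ := by
  have len : ∀ {i₁ i₂ i₃ i₄ i₅ i₆ : ℕ}, [i₁, i₂, i₃, i₄, i₅, i₆].length = 6 := rfl
  refine HaltsWithin.block_seq (T' := 90 * k + 158) ?_
    (by simp only [List.length_cons, List.length_nil]; omega)
  simp only [List.foldl_cons, List.foldl_nil, RAMInstr.exec_sub, RAMState.setI_I, if_true]
  set τ₀ := (σ.setI 22 _).setI 22 _ with hτ₀
  have f22 : τ₀.I 22 = t := by simp [hτ₀, h10, h11, ht.h6, hm]
  have f0 : ∀ e, e ≠ 22 → τ₀.I e = σ.I e := fun e he => by simp [hτ₀, he]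
  have ht₀ : IsTidy τ₀ := ht.of_eq fun e he => f0 e (by omega)
  refine HaltsWithin.addressTo_seq (T' := 72 * k + 129) ht₀ (by norm_num) (by norm_num)
    (by simp) ?_ (by rw [len, f0 1 (by norm_num), h1]; omega)
  rw [show hornerValue (τ₀.I 1) 4 ([22, 5, 5, 5, 5, 5].map τ₀.I) = recordCell k 0 t by
    simp [recordCell, f22, f0, h1, ht.h5]]
  set τ₁ := τ₀.setI 12 (recordCell k 0 t) with hτ₁
  have f1 : ∀ e, e ≠ 12 → τ₁.I e = τ₀.I e := fun e he => by simp [hτ₁, he]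
  refine HaltsWithin.addressTo_seq (T' := 54 * k + 100) (ht₀.of_eq fun e he => f1 e (by omega))
    (by norm_num) (by norm_num)
    (by simp) ?_ (by rw [len, f1 1 (by norm_num), f0 1 (by norm_num), h1]; omega)
  rw [show hornerValue (τ₁.I 1) 5 ([22, 5, 5, 5, 5, 5].map τ₁.I) = recordCell k 1 t by
    simp [recordCell, f1, f22, f0, h1, ht.h5]]
  set τ₂ := τ₁.setI 13 (recordCell k 1 t) with hτ₂
  have f2 : ∀ e, e ≠ 12 → e ≠ 13 → τ₂.I e = τ₀.I e := fun e he he' => by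
    simp [hτ₂, he', f1 e he]
  refine HaltsWithin.addressTo_seq (T' := 36 * k + 71)
    (ht₀.of_eq fun e he => f2 e (by omega) (by omega)) (by norm_num) (by norm_num)
    (by simp) ?_ (by rw [len, f2 1 (by norm_num) (by norm_num), f0 1 (by norm_num), h1]; omega)
  rw [show hornerValue (τ₂.I 1) 6 ([22, 5, 5, 5, 5, 5].map τ₂.I) = recordCell k 2 t by
    simp [recordCell, f2, f22, f0, h1, ht.h5]]
  set τ₃ := τ₂.setI 14 (recordCell k 2 t) with hτ₃
  have f3 : ∀ e, e ≠ 12 → e ≠ 13 → e ≠ 14 → τ₃.I e = τ₀.I e := fun e he he' he'' => by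
    simp [hτ₃, he'', f2 e he he']
  refine HaltsWithin.addressTo_seq (T' := 18 * k + 42)
    (ht₀.of_eq fun e he => f3 e (by omega) (by omega) (by omega)) (by norm_num) (by norm_num)
    (by simp) ?_ (by
      rw [len, f3 1 (by norm_num) (by norm_num) (by norm_num), f0 1 (by norm_num), h1]; omega)
  rw [show hornerValue (τ₃.I 1) 7 ([22, 5, 5, 5, 5, 5].map τ₃.I) = recordCell k 3 t by
    simp [recordCell, f3, f22, f0, h1, ht.h5]]
  set τ₄ := τ₃.setI 15 (recordCell k 3 t) with hτ₄
  refine HaltsWithin.block_seq (T' := 18 * k + 35) ?_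
    (by simp only [List.length_cons, List.length_nil]; omega)
  simp only [List.foldl_cons, List.foldl_nil, RAMInstr.exec_load]
  set τ₅ := ((((((τ₄.setI 12 _).setI 13 _).setI 14 _).setI 15 _).setI 16 _).setI 17 _).setI 18 _
    with hτ₅
  have g : ∀ e < 12, τ₅.I e = σ.I e := by
    intro e he
    have l : ∀ i, 12 ≤ i → e ≠ i := fun i hi => by omega
    simp [hτ₅, hτ₄, l, f3, f0]
  have g12 : τ₅.I 12 = σ.M (recordCell k 0 t) := by simp [hτ₅, hτ₄, hτ₃, hτ₂, hτ₁, hτ₀]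
  have g16 : τ₅.I 16 = σ.M (σ.M (recordCell k 1 t)) := by
    simp [hτ₅, hτ₄, hτ₃, hτ₂, hτ₁, hτ₀]
  have g17 : τ₅.I 17 = σ.M (σ.M (recordCell k 2 t)) := by
    simp [hτ₅, hτ₄, hτ₃, hτ₂, hτ₁, hτ₀]
  have g18 : τ₅.I 18 = σ.M (σ.M (recordCell k 3 t)) := by
    simp [hτ₅, hτ₄, hτ₃, hτ₂, hτ₁, hτ₀]
  have gM : τ₅.M = σ.M := rfl
  refine HaltsWithin.addressTo_seq (T' := 2) (ht.of_eq fun e he => g e (by omega))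
    (by norm_num) (by norm_num) (by simp) ?_ (by rw [len, g 1 (by norm_num), h1]; omega)
  rw [show hornerValue (τ₅.I 1) 2 ([12, 16, 17, 18, 5, 5].map τ₅.I) = witnessCell k
      (σ.M (recordCell k 0 t)) (σ.M (σ.M (recordCell k 1 t))) (σ.M (σ.M (recordCell k 2 t)))
      (σ.M (σ.M (recordCell k 3 t))) by
    simp only [witnessCell, List.map_cons, List.map_nil, g12, g16, g17, g18, g 1 (by norm_num),
      g 5 (by norm_num), h1, ht.h5]]
  refine HaltsWithin.block' (hQ _ (fun e he => ?_) ?_) (by simp)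
  · simp only [List.foldl_cons, List.foldl_nil, RAMInstr.exec_load, RAMInstr.exec_store,
      RAMState.setM_I, RAMState.setI_I]
    rw [if_neg (by omega), if_neg (by omega)]
    exact g e he
  · simp only [List.foldl_cons, List.foldl_nil, RAMInstr.exec_load, RAMInstr.exec_store,
      RAMState.setI_M, RAMState.setI_I, if_true, gM]
    norm_num
    rw [g12]
    rfl

/-- Computes the positions of all removed vertices. -/
def traceBack : RAMProg := .for 11 10 traceStep

/-- Positions overwrite the first `n` cells, whose old contents are not needed any more. The
invariant is that the part of `reconstruct` still to be done, applied to the current contents of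
these cells, gives the final answer. -/
theorem haltsWithin_traceBack {m : ℕ} {σ : RAMState} {M : ℕ → ℕ} {Q : RAMState → Prop}
    (ht : IsTidy σ) (h1 : σ.I 1 = k) (h10 : σ.I 10 = m) (hn : n ≤ k)
    (hM : ∀ α, n ≤ α → σ.M α = M α)
    (hrec : ∀ j < m, ∀ i < 4, M (recordCell k i j) < n)
    (hQ : ∀ τ, (∀ r < 11, τ.I r = σ.I r) →
      (∀ v < n, τ.M v = reconstruct k M m (fun v => if v < n then σ.M v else 0) v) → Q τ) :
    HaltsWithin traceBack (m * (90 * k + 160 + 2) + 2) Q σ := by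
  -- Records and witnesses have addresses of at least `k ^ 6`, hence at least `n`, so they are safe
  -- while positions are written.
  have key : ∀ g l, l.length = 6 → 1 ≤ g → n ≤ hornerValue k g l := by
    intro g l hl hg
    have := le_hornerValue k g l
    rw [hl] at this
    have h6 : k ≤ k ^ 6 := Nat.le_self_pow (by norm_num) k
    have := Nat.mul_le_mul_right (k ^ 6) hg
    omega
  refine HaltsWithin.for (N := m) (T := 90 * k + 160)
    (fun j τ => (∀ r < 11, τ.I r = σ.I r) ∧ (∀ α, n ≤ α → τ.M α = M α) ∧
      reconstruct k M (m - j) (fun v => if v < n then τ.M v else 0) =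
        reconstruct k M m (fun v => if v < n then σ.M v else 0)) (by norm_num) (by norm_num) ?_
    h10 ht.h6 ⟨fun _ _ => rfl, hM, rfl⟩ ?_ ?_ le_rfl
  · rintro j τ v ⟨i1, i2⟩
    refine ⟨fun r hr => ?_, i2⟩
    rw [RAMState.setI_I, if_neg (by omega), i1 r hr]
  · rintro j hj τ h11 h10' h6 ⟨i1, i2, i3⟩
    obtain ⟨t, rfl⟩ : ∃ t, m = j + (t + 1) := ⟨m - j - 1, by omega⟩
    refine haltsWithin_traceStep (k := k) (t := t) (ht.of_eq fun r hr => i1 r (by omega))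
      ((i1 1 (by norm_num)).trans h1) h10' h11 rfl ?_
    intro τ' j1 j2
    have ec : ∀ i, τ.M (recordCell k i t) = M (recordCell k i t) := fun i =>
      i2 _ (key _ _ rfl (by omega))
    have hr : ∀ i < 4, M (recordCell k i t) < n := fun i hi => hrec t (by omega) i hi
    simp only [ec, i2 _ (show n ≤ witnessCell _ _ _ _ _ from key _ _ rfl (by norm_num))] at j2
    refine ⟨(j1 11 (by norm_num)).trans h11, (j1 10 (by norm_num)).trans h10',
      (j1 6 (by norm_num)).trans h6, fun r hr => (j1 r (by omega)).trans (i1 r hr), ?_, ?_⟩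
    · intro α hα
      rw [j2, Function.update_of_ne (by have := hr 0 (by norm_num); omega), i2 α hα]
    · rw [← i3, show j + (t + 1) - (j + 1) = t by omega, show j + (t + 1) - j = t + 1 by omega,
        reconstruct]
      congr 1
      funext v
      rw [if_pos (hr 1 (by norm_num)), if_pos (hr 2 (by norm_num)), if_pos (hr 3 (by norm_num)), j2]
      simp only [Function.update_apply]
      split_ifs with h1 h2 h2
      · rfl
      · rfl
      · exact absurd (h2 ▸ hr 0 (by norm_num)) h1
      · rfl
  · rintro τ _ _ ⟨i1, i2, i3⟩
    refine hQ τ i1 fun v hv => ?_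
    rw [← i3, Nat.sub_self, reconstruct, if_pos hv]

end Solve

/-! ## The complete program -/

section Main

variable {n k a b c : ℕ} {F₀ : ℕ → ℕ → ℕ → Prop}

/-- Decides point-set embeddability of a plane 3-tree, and finds an embedding. -/
def solveEmbedding : RAMProg :=
  -- Register `6` receives the constant one, and register `10` the number of inner vertices, which
  -- is the number of rounds.
  .seq (.block (.const 6 1) [.const 10 3, .sub 10 0 10]) <| .seq removeAll <| .seq findOuterPlace <|
  .ite (.eq 30 6)
    (.seq (.block (.store 2 31) [.store 3 32, .store 4 33]) <| .seq traceBack (.instr (.const 0 1)))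
    (.instr (.const 0 0))

/-- Since `n ≤ k`, the selection costs only `O(k ^ 3)`; filling the tables dominates. -/
theorem removeVertexTime_le (hn : n ≤ k) (hk : 1 ≤ k) : removeVertexTime n k ≤ 2000 * k ^ 4 := by
  have e : ∀ i ≤ 4, k ^ i ≤ k ^ 4 := fun i hi => Nat.pow_le_pow_right hk hi
  have h0 := e 0 (by norm_num)
  have h1 := e 1 (by norm_num)
  have h2 := e 2 (by norm_num)
  have h3 := e 3 (by norm_num)
  have hb : n * (n * (24 * k + 62) + 18 * k + 62) ≤ k * (k * (24 * k + 62) + 18 * k + 62) := by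
    gcongr
  unfold removeVertexTime
  have e1 : k * (k * (24 * k + 62) + 18 * k + 62) = 24 * k ^ 3 + 80 * k ^ 2 + 62 * k ^ 1 := by ring
  have e2 : k * (k * (k * (300 * k + 400 + 2) + 4) + 4) =
      300 * k ^ 4 + 402 * k ^ 3 + 4 * k ^ 2 + 4 * k ^ 1 := by ring
  rw [e2]
  rw [e1] at hb
  rw [pow_one] at *
  rw [pow_zero] at h0
  omega

theorem solveEmbedding_time_le (hn3 : 3 ≤ n) (hn : n ≤ k) :
    3 + ((n - 3) * (removeVertexTime n k + 2) + 2 +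
      (k * (k * (k * (18 * k + 70 + 2) + 4) + 4) + 6 +
        (1 + (3 + ((n - 3) * (90 * k + 160 + 2) + 2 + 1))))) ≤ 3000 * (n * k ^ 4) := by
  have hk : 1 ≤ k := by omega
  have e : ∀ i ≤ 4, k ^ i ≤ k ^ 4 := fun i hi => Nat.pow_le_pow_right hk hi
  have h0 := e 0 (by norm_num)
  have h1 := e 1 (by norm_num)
  have h2 := e 2 (by norm_num)
  have h3 := e 3 (by norm_num)
  have hr := removeVertexTime_le hn hk
  rw [pow_zero] at h0
  rw [pow_one] at h1
  have b1 : (n - 3) * (removeVertexTime n k + 2) ≤ n * (2002 * k ^ 4) :=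
    Nat.mul_le_mul (by omega) (by omega)
  have b2 : (n - 3) * (90 * k + 160 + 2) ≤ n * (252 * k ^ 4) :=
    Nat.mul_le_mul (by omega) (by omega)
  have b3 : 3 * k ^ 4 ≤ n * k ^ 4 := Nat.mul_le_mul_right _ hn3
  have e2 : k * (k * (k * (18 * k + 70 + 2) + 4) + 4) =
      18 * k ^ 4 + 72 * k ^ 3 + 4 * k ^ 2 + 4 * k := by ring
  have e3 : n * (2002 * k ^ 4) = 2002 * (n * k ^ 4) := by ring
  have e4 : n * (252 * k ^ 4) = 252 * (n * k ^ 4) := by ring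
  rw [e2]
  omega

theorem haltsWithin_solveEmbedding {σ : RAMState} (hab : a ≠ b) (hbc : b ≠ c) (hca : c ≠ a)
    (ha : a < n) (hb : b < n) (hc : c < n) (hn3 : 3 ≤ n) (hn : n ≤ k) (h0 : σ.I 0 = n)
    (h1 : σ.I 1 = k) (h2 : σ.I 2 = a) (h3 : σ.I 3 = b) (h4 : σ.I 4 = c)
    (h5 : ∀ r, 5 ≤ r → σ.I r = 0) (hR : σ.R 0 = 0)
    (hadj : ∀ x < n, ∀ y < n, σ.M (x * n + y) ≠ 0 ↔ FaceAdj F₀ x y)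
    (hlt : ∀ α < n, σ.M α < k) (hM : ∀ α, k ^ 6 ≤ α → σ.M α = 0)
    (hD : StackedDisc a b c {v | v < n} F₀) :
    HaltsWithin solveEmbedding (3000 * (n * k ^ 4)) (fun τ =>
      (τ.I 0 = 1 ∧ ∃ (s : ℝ) (f : ℕ → ℕ), (s = 1 ∨ s = -1) ∧ (∀ v, f v < k) ∧
        IsOriented s F₀ (fun v => σ.inputPoint (f v)) ∧ ∀ v < n, τ.M v = f v) ∨
      (τ.I 0 = 0 ∧ ∀ (s : ℝ) (f : ℕ → ℕ), (∀ v, f v < k) →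
        ¬ IsOriented s F₀ (fun v => σ.inputPoint (f v)))) σ := by
  have hk : 0 < k := by omega
  refine HaltsWithin.mono (T := _) ?_ (solveEmbedding_time_le hn3 hn) fun _ => id
  refine HaltsWithin.block_seq (T' := _) ?_ le_rfl
  simp only [List.foldl_cons, List.foldl_nil, RAMInstr.exec_const, RAMInstr.exec_sub]
  set τ₀ := ((σ.setI 6 1).setI 10 3).setI 10 _ with hτ₀
  have f0 : ∀ r, r ≠ 6 → r ≠ 10 → τ₀.I r = σ.I r := fun r hr hr' => by simp [hτ₀, hr, hr']
  have f10 : τ₀.I 10 = n - 3 := by simp [hτ₀, h0]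
  have ht : IsTidy τ₀ := ⟨by simp [f0, h5], by simp [hτ₀], by simp [f0, h5], by simp [f0, h5],
    by simp [f0, h5]⟩
  have hinit : IsReduction n k τ₀.inputPoint a b c F₀ τ₀.M 0 {v | v < n} F₀ :=
    .init hk hD hM
  refine HaltsWithin.seq' (haltsWithin_removeAll hab hbc hca ht
    ((f0 0 (by norm_num) (by norm_num)).trans h0) ((f0 1 (by norm_num) (by norm_num)).trans h1)
    ((f0 2 (by norm_num) (by norm_num)).trans h2) ((f0 3 (by norm_num) (by norm_num)).trans h3)
    ((f0 4 (by norm_num) (by norm_num)).trans h4) f10 hR hn hn3 hadj hinit ?_) le_rfl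
  intro τ₁ A F i1 iR iX iM hI
  have g : ∀ r, r < 11 → r ≠ 6 → r ≠ 10 → τ₁.I r = σ.I r := fun r hr h6 h10 =>
    (i1 r hr).trans (f0 r h6 h10)
  have hpt : τ₁.inputPoint = σ.inputPoint := RAMState.inputPoint_congr iX
  have hadm := fun {s : ℝ} {f : ℕ → ℕ} => hI.isAdmissible_iff (σ := s) (f := f) hab hbc hca
    (ha.trans_le hn) (hb.trans_le hn) (hc.trans_le hn) hn3
  refine HaltsWithin.seq' (haltsWithin_findOuterPlace (k := k) (a := a) (b := b) (c := c)
    (ht.of_eq fun r hr => i1 r (by omega))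
    ((g 1 (by norm_num) (by norm_num) (by norm_num)).trans h1)
    ((g 2 (by norm_num) (by norm_num) (by norm_num)).trans h2)
    ((g 3 (by norm_num) (by norm_num) (by norm_num)).trans h3)
    ((g 4 (by norm_num) (by norm_num) (by norm_num)).trans h4) iR ?_) le_rfl
  intro τ₂ j1 jR jM jX j
  rw [hpt] at j
  have g2 : ∀ r, r < 11 → τ₂.I r = τ₀.I r := fun r hr => (j1 r (by omega)).trans (i1 r hr)
  have g6 : τ₂.I 6 = 1 := (g2 6 (by norm_num)).trans ht.h6
  have g' : ∀ r, r < 6 → τ₂.I r = σ.I r := fun r hr =>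
    (g2 r (by omega)).trans (f0 r (by omega) (by omega))
  refine HaltsWithin.ite' (fun hb30 => ?_) (fun hb30 => ?_) le_rfl
  · simp only [RAMTest.Holds, g6] at hb30
    obtain ⟨-, hp, hq, hr, hne, hcell⟩ := j.resolve_left fun h => by omega
    generalize ep : τ₂.I 31 = p at *
    generalize eq : τ₂.I 32 = q at *
    generalize er : τ₂.I 33 = r at *
    refine HaltsWithin.block_seq ?_ le_rfl
    simp only [List.foldl_cons, List.foldl_nil, RAMInstr.exec_store, RAMState.setM_I, ep, eq, er,
      g' 2 (by norm_num), g' 3 (by norm_num), g' 4 (by norm_num), h2, h3, h4]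
    set τ₃ := ((τ₂.setM a p).setM b q).setM c r with hτ₃
    have m3 : ∀ α, τ₃.M α = if α = c then r else if α = b then q else if α = a then p else
        τ₁.M α := fun α => by simp [hτ₃, jM]
    refine HaltsWithin.seq' (haltsWithin_traceBack (k := k) (n := n) (m := n - 3) (M := τ₁.M)
      (ht.of_eq fun r hr => g2 r (by omega))
      ((g' 1 (by norm_num)).trans h1) ((g2 10 (by norm_num)).trans f10) hn ?_
      hI.record ?_) le_rfl
    · intro α hα
      rw [m3, if_neg (by omega), if_neg (by omega), if_neg (by omega)]
    intro τ₄ l1 l2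
    -- The cells of the inner vertices still hold input data. Soundness accepts any values below `k`
    -- there, because admissibility now looks only at `a`, `b`, `c`.
    set f : ℕ → ℕ := fun v => if v < n then τ₃.M v else 0 with hf
    have hfk : ∀ v, f v < k := by
      intro v
      simp only [hf, m3]
      split_ifs with hv
      · exact hr
      · exact hq
      · exact hp
      · rw [iM v (hv.trans_le (hn.trans (Nat.le_self_pow (by norm_num) k)))]
        exact hlt v hv
      · exact hk
    have fa : f a = p := by simp [hf, ha, m3, hab, hca.symm]
    have fb : f b = q := by simp [hf, hb, m3, hbc]
    have fc : f c = r := by simp [hf, hc, m3]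
    -- The sign is chosen to make the last face `(b, a, c)` positive; the two choices correspond to
    -- a drawing and its mirror image.
    obtain ⟨s, hs, hsd⟩ : ∃ s : ℝ, (s = 1 ∨ s = -1) ∧
        0 < s * -signedArea (σ.inputPoint p) (σ.inputPoint q) (σ.inputPoint r) := by
      rcases hne.lt_or_gt with h | h
      · exact ⟨1, Or.inl rfl, by linarith⟩
      · exact ⟨-1, Or.inr rfl, by linarith⟩
    have had := (hadm hfk (s := s)).2 ⟨by rw [fa, fb, fc]; exact hsd, by rwa [fa, fb, fc]⟩
    refine HaltsWithin.instr (Or.inl ⟨by simp, s, _, hs, ?_, hI.sound s f hfk had, l2⟩) le_rfl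
    exact reconstruct_lt hn hfk (fun j hj => hI.record j hj 0 (by norm_num)) hI.witness
  · simp only [RAMTest.Holds, g6] at hb30
    obtain ⟨-, hno⟩ := j.resolve_right fun h => hb30 h.1
    refine HaltsWithin.instr (Or.inr ⟨by simp, fun s f hf ho => ?_⟩) (by omega)
    -- By completeness a drawing would still be admissible after all rounds and would place the
    -- outer triangle, contrary to the failed search.
    obtain ⟨h1, h2⟩ := (hadm hf).1 (hI.complete s f hf ho)
    refine hno _ (hf a) _ (hf b) _ (hf c) ⟨fun h => ?_, h2⟩
    change 0 < s * -signedArea (σ.inputPoint _) (σ.inputPoint _) (σ.inputPoint _) at h1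
    rw [h] at h1
    simp at h1

/-! ### The input -/

variable {G : RotationSystem (Fin n)}

theorem inputState_adjacent {a b c : Fin n} {S : Fin k → ℝ × ℝ} (x y : Fin n) :
    (inputState G a b c S).M (x * n + y) ≠ 0 ↔ G.graph.Adj x y := by
  have hn : 0 < n := x.pos
  have e1 : ((x : ℕ) * n + y) / n = x := by
    rw [Nat.mul_comm, Nat.mul_add_div hn, Nat.div_eq_of_lt y.2, add_zero]
  have e2 : ((x : ℕ) * n + y) % n = y := by
    rw [Nat.mul_comm, Nat.mul_add_mod, Nat.mod_eq_of_lt y.2]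
  simp [inputState, e1, e2]

/-- A successor is stored with one added, so the value `n` can occur; with `n < k` every entry is a
valid point index. -/
theorem inputState_le {a b c : Fin n} {S : Fin k → ℝ × ℝ} (α : ℕ) :
    (inputState G a b c S).M α ≤ n := by
  unfold inputState
  dsimp only
  split_ifs
  · exact Fin.is_lt _
  · exact Nat.zero_le _
  · exact Nat.zero_le _

theorem inputState_eq_zero {a b c : Fin n} {S : Fin k → ℝ × ℝ} {α : ℕ} (h : n * n ≤ α) :
    (inputState G a b c S).M α = 0 := by
  unfold inputState
  dsimp only
  rw [dif_neg]
  rintro ⟨h1, -⟩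
  have := (Nat.div_lt_iff_lt_mul a.pos).1 h1
  omega

theorem inputState_inputPoint {a b c : Fin n} {S : Fin k → ℝ × ℝ} (i : Fin k) :
    (inputState G a b c S).inputPoint i = S i := by
  have e1 : ((i : ℕ) + i) / 2 = i := by omega
  have e2 : ((i : ℕ) + i + 1) / 2 = i := by omega
  have e3 : ((i : ℕ) + i) % 2 = 0 := by omega
  have e4 : ((i : ℕ) + i + 1) % 2 = 1 := by omega
  simp [inputState, RAMState.inputPoint, e1, e2, e3, e4]

theorem isOriented_mapFaces {s : ℝ} {F : Fin n → Fin n → Fin n → Prop} {pos : ℕ → ℝ × ℝ} :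
    IsOriented s (mapFaces Fin.val F) pos ↔ IsOriented s F (fun v => pos v) := by
  constructor
  · exact fun h p q r hp => h _ _ _ ⟨p, q, r, rfl, rfl, rfl, hp⟩
  · rintro h _ _ _ ⟨p, q, r, rfl, rfl, rfl, hp⟩
    exact h p q r hp

theorem faceAdj_mapFaces {F : Fin n → Fin n → Fin n → Prop} {x y : Fin n} :
    FaceAdj (mapFaces Fin.val F) x y ↔ FaceAdj F x y := by
  constructor
  · rintro ⟨_, ⟨p, q, r, h1, h2, rfl, hp⟩ | ⟨p, q, r, h1, h2, rfl, hp⟩⟩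
    · rw [Fin.val_inj] at h1 h2
      subst h1 h2
      exact ⟨r, Or.inl hp⟩
    · rw [Fin.val_inj] at h1 h2
      subst h1 h2
      exact ⟨r, Or.inr hp⟩
  · rintro ⟨r, hp | hp⟩
    · exact ⟨r, Or.inl ⟨_, _, _, rfl, rfl, rfl, hp⟩⟩
    · exact ⟨r, Or.inr ⟨_, _, _, rfl, rfl, rfl, hp⟩⟩

end Main

theorem mainTheorem3 :
    ∃ (P : RAMProg) (C : ℕ),
      ∀ (n k : ℕ) (G : RotationSystem (Fin n)) (a b c : Fin n) (S : Fin k → ℝ × ℝ),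
        IsPlane3Tree G → G.IsFacialTriangle a b c → n < k → Function.Injective S →
          ∃ (τ : RAMState) (t : ℕ),
            RAMRun P (inputState G a b c S) τ t ∧ t ≤ C * (n * k ^ 4) ∧
              IsCorrectAnswer G a b c S τ := by
  refine ⟨solveEmbedding, 3000, fun n k G a b c S hG hf hnk _ => ?_⟩
  have hT := hG.isTriangulated
  have hdisc := hG.stackedDisc hf
  have fs := hT.isFaceSystem
  have hab := fs.ne _ _ _ hf
  have hbc := fs.ne₂ hf
  have hca := fs.ne₃ hf
  have hn3 : 3 ≤ n := by simpa using hT.three_le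
  have hD := hdisc.map Fin.val_injective
  have himg : Fin.val '' (Set.univ : Set (Fin n)) = {v | v < n} := by
    ext v
    simp only [Set.image_univ, Set.mem_range, Set.mem_ofPred_eq]
    exact ⟨fun ⟨y, hy⟩ => hy ▸ y.2, fun hv => ⟨⟨v, hv⟩, rfl⟩⟩
  rw [himg] at hD
  obtain ⟨τ, t, hrun, ht, hans⟩ := haltsWithin_solveEmbedding (k := k)
    (σ := inputState G a b c S) (Fin.val_ne_of_ne hab) (Fin.val_ne_of_ne hbc)
    (Fin.val_ne_of_ne hca) a.2 b.2 c.2 hn3 hnk.le rfl rfl rfl rfl rfl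
    (fun r hr => by
      obtain ⟨r, rfl⟩ := Nat.exists_eq_add_of_le' hr
      rfl) rfl
    (fun x hx y hy => by
      have := inputState_adjacent (G := G) (a := a) (b := b) (c := c) (S := S) ⟨x, hx⟩ ⟨y, hy⟩
      rw [this, ← hT.faceAdj_iff hf, ← faceAdj_mapFaces])
    (fun α _ => (inputState_le α).trans_lt hnk)
    (fun α hα => inputState_eq_zero (le_trans (by
      calc n * n ≤ k * k := Nat.mul_le_mul hnk.le hnk.le
        _ = k ^ 2 := by ring
        _ ≤ k ^ 6 := Nat.pow_le_pow_right (by omega) (by norm_num)) hα)) hD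
  have hk : 0 < k := by omega
  refine ⟨τ, t, hrun, ht, ?_⟩
  unfold IsCorrectAnswer IsPointSetEmbedding
  simp only [isStraightLineDrawing_iff hT hf hdisc]
  rcases hans with ⟨h1, s, f, hs, hfk, ho, hM⟩ | ⟨h1, hno⟩
  · refine Or.inl ⟨h1, fun v => ⟨f v, hfk v⟩, ⟨s, hs, ?_⟩, fun v => hM v v.2⟩
    rw [isOriented_mapFaces] at ho
    intro p q r hp
    have key : ∀ v : Fin n, (inputState G a b c S).inputPoint (f v) = S ⟨f v, hfk v⟩ := fun v =>
      inputState_inputPoint ⟨f v, hfk v⟩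
    have := ho p q r hp
    simpa only [key] using this
  · refine Or.inr ⟨h1, ?_⟩
    rintro ⟨f, s, -, ho⟩
    -- The value outside the vertex set is arbitrary: all faces have corners below `n`.
    refine hno s (fun v => if h : v < n then f ⟨v, h⟩ else 0) (fun v => ?_) ?_
    · split_ifs
      · exact Fin.is_lt _
      · exact hk
    · rw [isOriented_mapFaces]
      intro p q r hp
      simpa [inputState_inputPoint] using ho p q r hp
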